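/- Let $d\ge 1$. Let $\Gamma$ be the space of locally finite subsets (configurations) of $\mathbb R^d$ with the vague topology and its Borel $\sigma$-algebra, and let $\Gamma_0\subset\Gamma$ be the set of finite configurations with the trace $\sigma$-algebra. Write $x,y$ for $\{x\},\{y\}$, let $|\eta|$ be the cardinality of $\eta$, let $\lambda=\delta_\varnothing+\sum_{n\ge1}\frac1{n!}dx_1\cdots dx_n$ be the Lebesgue–Poisson measure on $\Gamma_0$, and let $(KG)(\gamma)=\sum_{\eta\subset\gamma,\,|\eta|<\infty}G(\eta)$. The correlation functional of a probability measure $\mu$ on $\Gamma$ is a density $k\ge0$ with respect to $\lambda$ of the measure $\rho$ on $\Gamma_0$ given by $\int_\Gamma KG\,d\mu=\int_{\Gamma_0}G\,d\rho$ for all measurable $G\ge0$. Its Ursell functional $u$ is given by $k(\eta)=\sum_{\pi}\prod_{B\in\pi}u(B)$, the sum being over all partitions $\pi$ of $\eta$. Put $e_\lambda(f,\eta)=\prod_{x\in\eta}f(x)$. Let $a:\mathbb R^d\to[0,\infty)$ be bounded, measurable and even with $\int a\,dx=1$, and let $\phi^\pm:\mathbb R^d\to\mathbb R$ be even, continuous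 and compactly supported. For $\varepsilon>0$ put $a_\varepsilon(x)=\varepsilon^d a(\varepsilon x)$, $E^{\phi}(x,\gamma)=\sum_{y\in\gamma}\phi(x-y)$, $r(x,y,\gamma)=\exp[E^{\phi^-}(x,\gamma)-E^{\phi^+}(y,\gamma)]$, and define $$(L_\varepsilon^-F)(\gamma)=\sum_{x\in\gamma}\int_{\mathbb R^d}dy\,a_\varepsilon(x-y)\,r(x,y,\gamma\setminus x)\,(F(\gamma\setminus x)-F(\gamma)),$$ $$(L_\varepsilon^+F)(\gamma)=\sum_{x\in\gamma}\int_{\mathbb R^d}dy\,a_\varepsilon(x-y)\,r(x,y,\gamma\setminus x)\,(F(\gamma\setminus x\cup y)-F(\gamma\setminus x)),$$ $$(L_0^-F)(\gamma)=\sum_{x\in\gamma}e^{E^{\phi^-}(x,\gamma\setminus x)}(F(\gamma\setminus x)-F(\gamma)),\qquad (L_0^+F)(\gamma)=\int_{\mathbb R^d}dy\,e^{-E^{\phi^+}(y,\gamma)}(F(\gamma\cup y)-F(\gamma)).$$ For each such operator $L$ let $\hat L=K^{-1}LK$ (acting on functions on $\Gamma_0$), where $(K^{-1}F)(\eta)=\sum_{\xi\subset\eta}(-1)^{|\eta\setminus\xi|}F(\xi)$.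 Let $k$ be the correlation functional of a probability measure $\mu$ on $\Gamma$, with Ursell functional $u$, and assume: (i) $k(\eta)\le(|\eta|!)^sC^{|\eta|}$ for all $\eta\in\Gamma_0$, for some $0\le s<1$ and $C>0$; (ii) $k$ is translation invariant: $k(\{y+x: y\in\eta\})=k(\eta)$ for all $x\in\mathbb R^d$, $\eta\in\Gamma_0$; (iii) for all $n,m\ge1$, all distinct $x_1,\dots,x_{n+m}\in\mathbb R^d$ and all $h\in\mathbb R^d$, $h\ne0$: $u(\{x_1,\dots,x_n,x_{n+1}+h/\varepsilon,\dots,x_{n+m}+h/\varepsilon\})\to0$ as $\varepsilon\downarrow0$. Then the following functionals of $\eta\in\Gamma_0$, in which all the integrals converge absolutely, $$(\hat L_\varepsilon^{-*}k)(\eta)=-\sum_{x\in\eta}\int_{\mathbb R^d}dy\,a_\varepsilon(x-y)r(x,y,\eta\setminus x)\int_{\Gamma_0}\lambda(d\xi)\,k(\xi\cup\eta)\,e_\lambda(e^{\phi^-(x-\cdot)-\phi^+(y-\cdot)}-1,\xi),$$ $$(\hat L_\varepsilon^{+*}k)(\eta)=\sum_{y\in\eta}\int_{\mathbb R^d}dx\,a_\varepsilon(x-y)r(x,y,\eta\setminus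 y)\int_{\Gamma_0}\lambda(d\xi)\,k(\xi\cup(\eta\setminus y)\cup x)\,e_\lambda(e^{\phi^-(x-\cdot)-\phi^+(y-\cdot)}-1,\xi),$$ $$(\hat L_0^{-*}k)(\eta)=-\sum_{x\in\eta}e^{E^{\phi^-}(x,\eta\setminus x)}\int_{\Gamma_0}\lambda(d\xi)\,e_\lambda(e^{\phi^-(x-\cdot)}-1,\xi)\,k(\eta\cup\xi),$$ $$(\hat L_0^{+*}k)(\eta)=\sum_{y\in\eta}e^{-E^{\phi^+}(y,\eta\setminus y)}\int_{\Gamma_0}\lambda(d\xi)\,e_\lambda(e^{-\phi^+(y-\cdot)}-1,\xi)\,k((\eta\setminus y)\cup\xi)$$ are the values at $k$ of the dual operators with respect to $\lambda$: for each $L\in\{L_\varepsilon^\pm,L_0^\pm\}$, $\varepsilon>0$, and each bounded measurable $G:\Gamma_0\to\mathbb R$ which vanishes on the configurations that are not contained in a certain bounded set or have more than a certain number of points, $$\int_{\Gamma_0}(\hat LG)(\eta)k(\eta)\,\lambda(d\eta)=\int_{\Gamma_0}G(\eta)(\hat L^*k)(\eta)\,\lambda(d\eta),$$ both integrals converging absolutely.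 Moreover, for each $\eta\in\Gamma_0$, as $\varepsilon\downarrow0$, $$(\hat L_\varepsilon^{-*}k)(\eta)\to c^-(k)\,(\hat L_0^{-*}k)(\eta),\qquad(\hat L_\varepsilon^{+*}k)(\eta)\to c^+(k)\,(\hat L_0^{+*}k)(\eta),$$ where the constants are given by the absolutely convergent integrals $$c^-(k)=\int_{\Gamma_0}\lambda(d\xi)\,e_\lambda(e^{-\phi^+}-1,\xi)\,k(\xi),\qquad c^+(k)=\int_{\Gamma_0}\lambda(d\xi)\,e_\lambda(e^{\phi^-}-1,\xi)\,k(\xi\cup0).$$ -/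

import Mathlib

open MeasureTheory Filter Topology
open scoped ENNReal CompactlySupported

noncomputable section

/-- The position space `ℝᵈ` with its Euclidean structure. -/
abbrev Pos (d : ℕ) : Type := EuclideanSpace ℝ (Fin d)

instance Pos.instDecidableEq {d : ℕ} : DecidableEq (Pos d) := Classical.decEq _

/-! ### The configuration space -/

/-- A configuration: a locally finite subset of `ℝᵈ`. -/
@[ext]
structure Configuration (d : ℕ) where
  /-- the set of positions of the particles -/
  carrier : Set (Pos d)
  /-- local finiteness -/
  finite_inter : ∀ C : Set (Pos d), IsCompact C → (carrier ∩ C).Finite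

namespace Configuration

variable {d : ℕ}

/-- The configuration `γ \ x`. -/
def erase (γ : Configuration d) (x : Pos d) : Configuration d where
  carrier := γ.carrier \ {x}
  finite_inter C hC := (γ.finite_inter C hC).subset fun _ hy => ⟨hy.1.1, hy.2⟩

/-- The configuration `γ ∪ x`. -/
def insert (γ : Configuration d) (x : Pos d) : Configuration d where
  carrier := Set.insert x γ.carrier
  finite_inter C hC := ((γ.finite_inter C hC).union (Set.finite_singleton x)).subset (by
    rintro y ⟨hy | hy, hyC⟩
    · exact Or.inr hy
    · exact Or.inl ⟨hy, hyC⟩)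

/-- A finite configuration, regarded as an element of the whole configuration space. -/
def ofFinset (η : Finset (Pos d)) : Configuration d where
  carrier := (η : Set (Pos d))
  finite_inter _ _ := η.finite_toSet.subset Set.inter_subset_left

/-- The pairing `⟨f, γ⟩ = ∑_{x ∈ γ} f x`. -/
def pairing (f : Pos d → ℝ) (γ : Configuration d) : ℝ := ∑' x : γ.carrier, f x

/-- The vague topology: the weakest topology for which `γ ↦ ⟨f, γ⟩` is continuous for every
continuous compactly supported `f`. -/
instance : TopologicalSpace (Configuration d) :=
  ⨅ f : C_c(Pos d, ℝ), TopologicalSpace.induced (pairing f) inferInstance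

/-- The Borel `σ`-algebra of the vague topology. -/
instance : MeasurableSpace (Configuration d) := borel _

instance : BorelSpace (Configuration d) := ⟨rfl⟩

end Configuration

/-- The space of finite configurations; the set of its `n`-point elements is `{η | η.card = n}`. -/
abbrev FinConf (d : ℕ) : Type := Finset (Pos d)

/-- The trace on the finite configurations of the Borel `σ`-algebra of the configuration space. For
finite subsets of `ℝᵈ` this instance replaces Mathlib's product `σ`-algebra on `Finset`. -/
instance FinConf.instMeasurableSpace {d : ℕ} : MeasurableSpace (FinConf d) :=
  MeasurableSpace.comap Configuration.ofFinset inferInstance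

/-- The measurable sets of finite configurations are the traces of the Borel sets. -/
theorem FinConf.measurableSet_iff {d : ℕ} (S : Set (FinConf d)) :
    MeasurableSet S ↔
      ∃ T : Set (Configuration d), MeasurableSet T ∧ Configuration.ofFinset ⁻¹' T = S :=
  Iff.rfl

section Basic

variable {d : ℕ}

/-- The Lebesgue–Poisson measure `λ = ∑ₙ (1 / n!) dx₁ ⋯ dxₙ`, where `dx₁ ⋯ dxₙ` is the image of
Lebesgue measure on the `n`-tuples of distinct points under `(x₁, …, xₙ) ↦ {x₁, …, xₙ}`; the term
`n = 0` is the Dirac measure at the empty configuration. -/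
def lebesguePoisson (d : ℕ) : Measure (FinConf d) :=
  Measure.sum fun n : ℕ => (n.factorial : ℝ≥0∞)⁻¹ •
    ((volume : Measure (Fin n → Pos d)).restrict {x | Function.Injective x}).map
      fun x => Finset.univ.image x

/-- The `K`-transform `(K G)(γ) = ∑_{η ⋐ γ} G η`, the sum being over all finite subsets. -/
def KTransform {R : Type} [AddCommMonoid R] [TopologicalSpace R] (G : FinConf d → R)
    (γ : Configuration d) : R :=
  ∑' η : {η : FinConf d // (η : Set (Pos d)) ⊆ γ.carrier}, G η

/-- `ρ` is the correlation measure of `μ`. -/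
def IsCorrelationMeasure (μ : Measure (Configuration d)) (ρ : Measure (FinConf d)) : Prop :=
  ∀ G : FinConf d → ℝ≥0∞, Measurable G → ∫⁻ γ, KTransform G γ ∂μ = ∫⁻ η, G η ∂ρ

/-- `k` is the correlation functional of `μ`: a density of the correlation measure of `μ` with
respect to the Lebesgue–Poisson measure. -/
structure IsCorrelationFunctional (μ : Measure (Configuration d)) (k : FinConf d → ℝ) :
    Prop where
  measurable : Measurable k
  nonneg : ∀ η, 0 ≤ k η
  isCorrelationMeasure :
    IsCorrelationMeasure μ ((lebesguePoisson d).withDensity fun η => ENNReal.ofReal (k η))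

/-- The Ursell functional `u` of `k`, that is, the solution of
`k η = ∑_{π partition of η} ∏_{B ∈ π} u B`, obtained by solving for the term of the one-block
partition. -/
def ursell (k : FinConf d → ℝ) (η : FinConf d) : ℝ :=
  k η - ∑ π : {π : Finpartition η // π.parts ≠ {η}}, ∏ B : {B // B ∈ π.1.parts}, ursell k B.1
termination_by η.card
decreasing_by
  obtain ⟨π, hπ⟩ := π
  obtain ⟨B, hB⟩ := B
  refine Finset.card_lt_card (lt_of_le_of_ne (π.le hB) fun h => hπ ?_)
  change B = η at h
  subst h
  refine Finset.eq_singleton_iff_unique_mem.2 ⟨hB, fun D hD => ?_⟩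
  by_contra hne
  exact π.ne_bot hD ((π.disjoint hD hB hne).eq_bot_of_le (π.le hD))

/-- The defining relation between the functional `k` and its Ursell functional. -/
theorem ursell_sum (k : FinConf d → ℝ) (hk : k ∅ = 1) (η : FinConf d) :
    k η = ∑ π : Finpartition η, ∏ B ∈ π.parts, ursell k B := by
  rcases Finset.eq_empty_or_nonempty η with rfl | hη
  · rw [hk]
    have h : ∀ π : Finpartition (∅ : FinConf d), π.parts = ∅ := fun π => by
      refine Finset.eq_empty_of_forall_notMem fun B hB => π.ne_bot hB ?_
      exact Finset.subset_empty.1 (π.le hB)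
    have hu : ∀ π : Finpartition (∅ : FinConf d), π = ⊥ := fun π =>
      Finpartition.ext ((h π).trans (h ⊥).symm)
    rw [Fintype.sum_eq_single ⊥ fun π hπ => absurd (hu π) hπ, h]
    simp
  · have hne : η ≠ ⊥ := hη.ne_empty
    have h1 : (Finpartition.indiscrete hne).parts = {η} := rfl
    have h2 : ∀ π : Finpartition η, π ≠ Finpartition.indiscrete hne ↔ π.parts ≠ {η} := fun π =>
      not_congr ⟨fun h => h ▸ h1, fun h => Finpartition.ext (h.trans h1.symm)⟩
    rw [Fintype.sum_eq_add_sum_compl (Finpartition.indiscrete hne), h1, Finset.prod_singleton,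
      ursell]
    have h3 : ∑ π : {π : Finpartition η // π.parts ≠ {η}},
        ∏ B : {B // B ∈ π.1.parts}, ursell k B.1 =
        ∑ π ∈ ({Finpartition.indiscrete hne}ᶜ : Finset (Finpartition η)),
          ∏ B ∈ π.parts, ursell k B := by
      rw [← Finset.sum_subtype ({Finpartition.indiscrete hne}ᶜ : Finset (Finpartition η))
        (p := fun π => π.parts ≠ {η}) (fun π => by simpa using h2 π)
        (fun π => ∏ B : {B // B ∈ π.parts}, ursell k B.1)]
      exact Finset.sum_congr rfl fun π _ => Finset.prod_coe_sort π.parts (ursell k)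
    rw [h3]
    ring

/-- The shifted configuration `η_x = {y + x | y ∈ η}`. -/
def FinConf.shift (η : FinConf d) (x : Pos d) : FinConf d := η.image (· + x)

/-- Translation invariance of a functional of finite configurations. -/
def IsTranslationInvariant (G : FinConf d → ℝ) : Prop :=
  ∀ (x : Pos d) (η : FinConf d), G (FinConf.shift η x) = G η

/-- The decay of correlations, for the Ursell functional `u`: if a nonempty group of the points of a
configuration is shifted to infinity along a ray and the nonempty rest is kept fixed, `u` tends
to zero. -/
def HasDecay (u : FinConf d → ℝ) : Prop :=
  ∀ A B : FinConf d, A.Nonempty → B.Nonempty → Disjoint A B → ∀ h : Pos d, h ≠ 0 →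
    Tendsto (fun ε : ℝ => u (A ∪ FinConf.shift B (ε⁻¹ • h))) (𝓝[>] 0) (𝓝 0)

/-- The Lebesgue–Poisson exponential `e_λ(f, η) = ∏_{x ∈ η} f x`. -/
def eLambda (f : Pos d → ℝ) (η : FinConf d) : ℝ := ∏ x ∈ η, f x

/-! ### The generators on functions of configurations -/

/-- The relative energy `E^V(x, γ) = ∑_{y ∈ γ} V (x - y)` (a finite sum if `V` has compact
support). -/
def energy (V : Pos d → ℝ) (x : Pos d) (γ : Configuration d) : ℝ :=
  ∑' y : γ.carrier, V (x - y)

/-- The rate `r(x, y, γ) = exp (E^{φ⁻}(x, γ) - E^{φ⁺}(y, γ))`. -/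
def rate (φm φp : Pos d → ℝ) (x y : Pos d) (γ : Configuration d) : ℝ :=
  Real.exp (energy φm x γ - energy φp y γ)

/-- The scaled jump density `a_ε(x) = ε ^ d * a (ε x)`. -/
def scaledJump (a : Pos d → ℝ) (ε : ℝ) (x : Pos d) : ℝ := ε ^ d * a (ε • x)

/-- The part `L_ε⁻` of the scaled Kawasaki generator: particles leave. -/
def kawasakiMinus (a φm φp : Pos d → ℝ) (ε : ℝ) (F : Configuration d → ℝ)
    (γ : Configuration d) : ℝ :=
  ∑' x : γ.carrier, ∫ y : Pos d, scaledJump a ε (x - y) * rate φm φp x y (γ.erase x) *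
    (F (γ.erase x) - F γ)

/-- The part `L_ε⁺` of the scaled Kawasaki generator: particles land. -/
def kawasakiPlus (a φm φp : Pos d → ℝ) (ε : ℝ) (F : Configuration d → ℝ)
    (γ : Configuration d) : ℝ :=
  ∑' x : γ.carrier, ∫ y : Pos d, scaledJump a ε (x - y) * rate φm φp x y (γ.erase x) *
    (F ((γ.erase x).insert y) - F (γ.erase x))

/-- The death part `L_0⁻` of the Glauber generator. -/
def glauberMinus (φm : Pos d → ℝ) (F : Configuration d → ℝ) (γ : Configuration d) : ℝ :=
  ∑' x : γ.carrier, Real.exp (energy φm x (γ.erase x)) * (F (γ.erase x) - F γ)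

/-- The birth part `L_0⁺` of the Glauber generator. -/
def glauberPlus (φp : Pos d → ℝ) (F : Configuration d → ℝ) (γ : Configuration d) : ℝ :=
  ∫ y : Pos d, Real.exp (-energy φp y γ) * (F (γ.insert y) - F γ)

/-! ### Operators on functions of finite configurations and their duals -/

/-- The inverse `K`-transform `(K⁻¹ F)(η) = ∑_{ξ ⊆ η} (-1)^{|η \ ξ|} F ξ`. -/
def KInverse (F : Configuration d → ℝ) (η : FinConf d) : ℝ :=
  ∑ ξ ∈ η.powerset, (-1) ^ (η \ ξ).card * F (Configuration.ofFinset ξ)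

/-- On a finite configuration the `K`-transform is a finite sum. -/
theorem KTransform_ofFinset (G : FinConf d → ℝ) (η : FinConf d) :
    KTransform G (Configuration.ofFinset η) = ∑ ξ ∈ η.powerset, G ξ := by
  unfold KTransform
  have h := Finset.tsum_subtype η.powerset G
  rw [← h]
  exact (Equiv.subtypeEquivRight fun ξ => by
    simp [Configuration.ofFinset]).tsum_eq (fun ξ : {ξ // ξ ∈ η.powerset} => G ξ)

/-- The alternating sum over the subsets of a finite set. -/
theorem sum_alternating {α : Type} [DecidableEq α] (η : Finset α) :
    ∑ ξ ∈ η.powerset, (-1 : ℝ) ^ ξ.card = if η = ∅ then 1 else 0 := by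
  have h := congrArg (Int.cast : ℤ → ℝ) (Finset.sum_powerset_neg_one_pow_card (x := η))
  push_cast at h
  exact h

/-- Moebius inversion over the subsets of a finite set. -/
theorem sum_moebius_right {α : Type} [DecidableEq α] (F : Finset α → ℝ) (η : Finset α) :
    ∑ ζ ∈ η.powerset, ∑ ξ ∈ ζ.powerset, (-1 : ℝ) ^ (ζ \ ξ).card * F ξ = F η := by
  rw [Finset.sum_comm' (t' := η.powerset)
    (s' := fun ξ => (η \ ξ).powerset.image fun ζ => ξ ∪ ζ)]
  · have h : ∀ ξ ∈ η.powerset, ∑ ζ ∈ (η \ ξ).powerset.image (fun ζ => ξ ∪ ζ),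
        (-1 : ℝ) ^ (ζ \ ξ).card * F ξ =
        if η = ξ then F ξ else 0 := fun ξ hξ => by
      have hξ' := Finset.mem_powerset.1 hξ
      have hd : ∀ ζ ∈ (η \ ξ).powerset, (ξ ∪ ζ) \ ξ = ζ := fun ζ hζ => by
        have := Finset.mem_powerset.1 hζ
        grind
      rw [Finset.sum_image fun ζ hζ ζ' hζ' hh => by
        rw [← hd ζ hζ, ← hd ζ' hζ']; exact congrArg (· \ ξ) hh]
      rw [Finset.sum_congr rfl fun ζ hζ => by rw [hd ζ hζ], ← Finset.sum_mul, sum_alternating]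
      have h0 : η \ ξ = ∅ ↔ η = ξ :=
        ⟨fun h => (Finset.sdiff_eq_empty_iff_subset.1 h).antisymm hξ', fun h => by simp [h]⟩
      simp only [h0, ite_mul, one_mul, zero_mul]
    rw [Finset.sum_congr rfl h]
    simp
  · intro ζ ξ
    simp only [Finset.mem_powerset, Finset.mem_image]
    constructor
    · rintro ⟨h1, h2⟩
      exact ⟨⟨ζ \ ξ, by grind, by grind⟩, by grind⟩
    · rintro ⟨⟨θ, h1, rfl⟩, h2⟩
      exact ⟨by grind, by grind⟩

/-- Moebius inversion over the subsets of a finite set. -/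
theorem sum_moebius_left {α : Type} [DecidableEq α] (G : Finset α → ℝ) (η : Finset α) :
    ∑ ξ ∈ η.powerset, (-1 : ℝ) ^ (η \ ξ).card * ∑ ζ ∈ ξ.powerset, G ζ = G η := by
  simp only [Finset.mul_sum]
  rw [Finset.sum_comm' (t' := η.powerset)
    (s' := fun ζ => (η \ ζ).powerset.image fun ξ => η \ ξ)]
  · have h : ∀ ζ ∈ η.powerset, ∑ ξ ∈ (η \ ζ).powerset.image (fun ξ => η \ ξ),
        (-1 : ℝ) ^ (η \ ξ).card * G ζ = if η = ζ then G ζ else 0 := fun ζ hζ => by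
      have hζ' := Finset.mem_powerset.1 hζ
      have hd : ∀ ξ ∈ (η \ ζ).powerset, η \ (η \ ξ) = ξ := fun ξ hξ => by
        have := Finset.mem_powerset.1 hξ
        grind
      rw [Finset.sum_image fun ξ hξ ξ' hξ' hh => by
        rw [← hd ξ hξ, ← hd ξ' hξ']; exact congrArg (η \ ·) hh]
      rw [Finset.sum_congr rfl fun ξ hξ => by rw [hd ξ hξ], ← Finset.sum_mul, sum_alternating]
      have h0 : η \ ζ = ∅ ↔ η = ζ :=
        ⟨fun h => (Finset.sdiff_eq_empty_iff_subset.1 h).antisymm hζ', fun h => by simp [h]⟩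
      simp only [h0, ite_mul, one_mul, zero_mul]
    rw [Finset.sum_congr rfl h]
    simp
  · intro ξ ζ
    simp only [Finset.mem_powerset, Finset.mem_image]
    constructor
    · rintro ⟨h1, h2⟩
      exact ⟨⟨η \ ξ, by grind, by grind⟩, by grind⟩
    · rintro ⟨⟨θ, h1, rfl⟩, h2⟩
      exact ⟨by grind, by grind⟩

/-- `KInverse` is a right inverse of the `K`-transform on finite configurations. -/
theorem KTransform_KInverse (F : Configuration d → ℝ) (η : FinConf d) :
    KTransform (KInverse F) (Configuration.ofFinset η) = F (Configuration.ofFinset η) := by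
  rw [KTransform_ofFinset]
  exact sum_moebius_right (fun ξ => F (Configuration.ofFinset ξ)) η

/-- `KInverse` is a left inverse of the `K`-transform. -/
theorem KInverse_KTransform (G : FinConf d → ℝ) : KInverse (KTransform G) = G := by
  funext η
  unfold KInverse
  simp only [KTransform_ofFinset]
  exact sum_moebius_left G η

/-- The operator `L̂ = K⁻¹ L K` on functions of finite configurations. -/
def hatOp (L : (Configuration d → ℝ) → Configuration d → ℝ) (G : FinConf d → ℝ) :
    FinConf d → ℝ :=
  KInverse (L (KTransform G))

/-- Bounded measurable functions of finite configurations with bounded support: they vanish on the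
configurations that are not contained in a certain bounded set or have too many points. -/
structure IsBbs (G : FinConf d → ℝ) : Prop where
  measurable : Measurable G
  bounded : ∃ M : ℝ, ∀ η, |G η| ≤ M
  support : ∃ (Λ : Set (Pos d)) (N : ℕ), Bornology.IsBounded Λ ∧
    ∀ η, G η ≠ 0 → (η : Set (Pos d)) ⊆ Λ ∧ η.card ≤ N

/-- `g` is (a version of) the value at `k` of the dual of `L̂` with respect to the Lebesgue–Poisson
measure: `∫ (L̂ G) k dλ = ∫ G g dλ` for all bounded `G` with bounded support, both integrals
converging absolutely. -/
def IsDualValue (L : (Configuration d → ℝ) → Configuration d → ℝ) (k g : FinConf d → ℝ) : Prop :=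
  ∀ G : FinConf d → ℝ, IsBbs G →
    Integrable (fun η => hatOp L G η * k η) (lebesguePoisson d) ∧
    Integrable (fun η => G η * g η) (lebesguePoisson d) ∧
    ∫ η, hatOp L G η * k η ∂(lebesguePoisson d) = ∫ η, G η * g η ∂(lebesguePoisson d)

/-- The integrand of the functional `L̂_ε⁻* k` at `η`, for a point `x` of `η`. -/
def dualKawasakiMinusIntegrand (a φm φp : Pos d → ℝ) (ε : ℝ) (k : FinConf d → ℝ) (η : FinConf d)
    (x y : Pos d) (ξ : FinConf d) : ℝ :=
  scaledJump a ε (x - y) * rate φm φp x y (Configuration.ofFinset (η.erase x)) *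
    (k (ξ ∪ η) * eLambda (fun u => Real.exp (φm (x - u) - φp (y - u)) - 1) ξ)

/-- The pointwise version of `L̂_ε⁻* k`. -/
def dualKawasakiMinus (a φm φp : Pos d → ℝ) (ε : ℝ) (k : FinConf d → ℝ) (η : FinConf d) : ℝ :=
  -∑ x ∈ η, ∫ y : Pos d, ∫ ξ, dualKawasakiMinusIntegrand a φm φp ε k η x y ξ ∂(lebesguePoisson d)

/-- The integrand of the functional `L̂_ε⁺* k` at `η`, for a point `y` of `η`. -/
def dualKawasakiPlusIntegrand (a φm φp : Pos d → ℝ) (ε : ℝ) (k : FinConf d → ℝ) (η : FinConf d)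
    (y x : Pos d) (ξ : FinConf d) : ℝ :=
  scaledJump a ε (x - y) * rate φm φp x y (Configuration.ofFinset (η.erase y)) *
    (k (insert x (ξ ∪ η.erase y)) *
      eLambda (fun u => Real.exp (φm (x - u) - φp (y - u)) - 1) ξ)

/-- The pointwise version of `L̂_ε⁺* k`. -/
def dualKawasakiPlus (a φm φp : Pos d → ℝ) (ε : ℝ) (k : FinConf d → ℝ) (η : FinConf d) : ℝ :=
  ∑ y ∈ η, ∫ x : Pos d, ∫ ξ, dualKawasakiPlusIntegrand a φm φp ε k η y x ξ ∂(lebesguePoisson d)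

/-- The integrand of the functional `L̂_0⁻* k` at `η`, for a point `x` of `η`. -/
def dualGlauberMinusIntegrand (φm : Pos d → ℝ) (k : FinConf d → ℝ) (η : FinConf d) (x : Pos d)
    (ξ : FinConf d) : ℝ :=
  Real.exp (energy φm x (Configuration.ofFinset (η.erase x))) *
    (eLambda (fun u => Real.exp (φm (x - u)) - 1) ξ * k (η ∪ ξ))

/-- The pointwise version of `L̂_0⁻* k`. -/
def dualGlauberMinus (φm : Pos d → ℝ) (k : FinConf d → ℝ) (η : FinConf d) : ℝ :=
  -∑ x ∈ η, ∫ ξ, dualGlauberMinusIntegrand φm k η x ξ ∂(lebesguePoisson d)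

/-- The integrand of the functional `L̂_0⁺* k` at `η`, for a point `y` of `η`. -/
def dualGlauberPlusIntegrand (φp : Pos d → ℝ) (k : FinConf d → ℝ) (η : FinConf d) (y : Pos d)
    (ξ : FinConf d) : ℝ :=
  Real.exp (-energy φp y (Configuration.ofFinset (η.erase y))) *
    (eLambda (fun u => Real.exp (-φp (y - u)) - 1) ξ * k (η.erase y ∪ ξ))

/-- The pointwise version of `L̂_0⁺* k`. -/
def dualGlauberPlus (φp : Pos d → ℝ) (k : FinConf d → ℝ) (η : FinConf d) : ℝ :=
  ∑ y ∈ η, ∫ ξ, dualGlauberPlusIntegrand φp k η y ξ ∂(lebesguePoisson d)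

/-- The integrand of the constant `c⁻(k)`. -/
def cMinusIntegrand (φp : Pos d → ℝ) (k : FinConf d → ℝ) (ξ : FinConf d) : ℝ :=
  eLambda (fun u => Real.exp (-φp u) - 1) ξ * k ξ

/-- The constant `c⁻(k) = ∫ e_λ(e^{-φ⁺} - 1, ξ) k(ξ) λ(dξ)`. -/
def cMinus (φp : Pos d → ℝ) (k : FinConf d → ℝ) : ℝ :=
  ∫ ξ, cMinusIntegrand φp k ξ ∂(lebesguePoisson d)

/-- The integrand of the constant `c⁺(k)`. -/
def cPlusIntegrand (φm : Pos d → ℝ) (k : FinConf d → ℝ) (ξ : FinConf d) : ℝ :=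
  eLambda (fun u => Real.exp (φm u) - 1) ξ * k (insert 0 ξ)

/-- The constant `c⁺(k) = ∫ e_λ(e^{φ⁻} - 1, ξ) k(ξ ∪ 0) λ(dξ)`. -/
def cPlus (φm : Pos d → ℝ) (k : FinConf d → ℝ) : ℝ :=
  ∫ ξ, cPlusIntegrand φm k ξ ∂(lebesguePoisson d)

end Basic

end

/-! ### Measurability on the space of finite configurations -/

namespace FinConf

variable {d : ℕ}

theorem pairing_ofFinset (f : Pos d → ℝ) (η : FinConf d) :
    Configuration.pairing f (Configuration.ofFinset η) = ∑ x ∈ η, f x :=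
  Finset.tsum_subtype η f

theorem measurable_sum_compactlySupported (f : C_c(Pos d, ℝ)) :
    Measurable fun η : FinConf d => ∑ x ∈ η, f x := by
  have h : Continuous (Configuration.pairing (d := d) f) :=
    continuous_iInf_dom (i := f) continuous_induced_dom
  have h' := h.measurable.comp (comap_measurable (Configuration.ofFinset (d := d)))
  have he : (fun η : FinConf d => ∑ x ∈ η, f x) =
      Configuration.pairing f ∘ Configuration.ofFinset :=
    funext fun η => (pairing_ofFinset f η).symm
  rwa [he]

theorem measurable_sum_continuous (f : Pos d → ℝ) (hf : Continuous f) :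
    Measurable fun η : FinConf d => ∑ x ∈ η, f x := by
  let g : ℕ → Pos d → ℝ := fun n x => max 0 (1 - ‖x‖ / (n + 1)) * f x
  have hg : ∀ n, Continuous (g n) := fun n => by fun_prop
  have hs : ∀ n, HasCompactSupport (g n) := fun n => by
    refine HasCompactSupport.intro (isCompact_closedBall (0 : Pos d) (n + 1)) fun x hx => ?_
    have hx' : (n : ℝ) + 1 < ‖x‖ := by simpa using hx
    have : 1 - ‖x‖ / ((n : ℝ) + 1) ≤ 0 := by
      rw [sub_nonpos, le_div_iff₀ (by positivity)]; linarith
    simp [g, max_eq_left this]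
  have hm : ∀ n, Measurable fun η : FinConf d => ∑ x ∈ η, g n x := fun n =>
    measurable_sum_compactlySupported ⟨⟨g n, hg n⟩, hs n⟩
  refine measurable_of_tendsto_metrizable hm (tendsto_pi_nhds.2 fun η => ?_)
  refine tendsto_finsetSum _ fun x _ => ?_
  have h1 : Tendsto (fun n : ℕ => ‖x‖ / ((n : ℝ) + 1)) atTop (𝓝 0) :=
    tendsto_const_nhds.div_atTop
      (tendsto_atTop_add_const_right _ _ tendsto_natCast_atTop_atTop)
  have h2 : Tendsto (fun n : ℕ => max 0 (1 - ‖x‖ / ((n : ℝ) + 1)) * f x) atTop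
      (𝓝 (max 0 (1 - 0) * f x)) :=
    (tendsto_const_nhds.max (tendsto_const_nhds.sub h1)).mul_const _
  simpa [g] using h2

/-- The number of points in a Borel set depends measurably on the configuration. -/
theorem measurable_sum_indicator {B : Set (Pos d)} (hB : MeasurableSet B) :
    Measurable fun η : FinConf d => ∑ x ∈ η, B.indicator (1 : Pos d → ℝ) x := by
  have huniv : Measurable fun η : FinConf d => ∑ x ∈ η, (1 : ℝ) :=
    measurable_sum_continuous (fun _ => 1) continuous_const
  refine MeasurableSpace.induction_on_inter
    (C := fun B _ => Measurable fun η : FinConf d => ∑ x ∈ η, B.indicator (1 : Pos d → ℝ) x)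
    ((BorelSpace.measurable_eq (α := Pos d)).trans borel_eq_generateFrom_isClosed)
    isPiSystem_isClosed (by simp) (fun F hF => ?_) (fun B _ ih => ?_) (fun f hf hfm ih => ?_) B hB
  · have hδ : ∀ n : ℕ, (0 : ℝ) < 1 / ((n : ℝ) + 1) := fun n => by positivity
    have ht := tendsto_pi_nhds.1
      (thickenedIndicator_tendsto_indicator_closure hδ tendsto_one_div_add_atTop_nhds_zero_nat F)
    have hF' : IsClosed F := hF
    refine measurable_of_tendsto_metrizable
      (f := fun (n : ℕ) (η : FinConf d) => ∑ x ∈ η, (thickenedIndicator (hδ n) F x : ℝ))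
      (fun n => measurable_sum_continuous _
        (NNReal.continuous_coe.comp (thickenedIndicator (hδ n) F).continuous))
      (tendsto_pi_nhds.2 fun η => tendsto_finsetSum _ fun x _ => ?_)
    have := (NNReal.continuous_coe.tendsto _).comp (ht x)
    rw [hF'.closure_eq] at this
    have hv : F.indicator (1 : Pos d → ℝ) x = ((F.indicator (fun _ => 1) x : NNReal) : ℝ) := by
      by_cases hx : x ∈ F <;> simp [hx]
    rw [hv]
    exact this
  · convert huniv.sub ih using 2 with η
    simp only [Pi.sub_apply]
    rw [← Finset.sum_sub_distrib]
    refine Finset.sum_congr rfl fun x _ => ?_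
    by_cases hx : x ∈ B <;> simp [hx]
  · have ht : ∀ x : Pos d, Tendsto
        (fun n : ℕ => ∑ i ∈ Finset.range n, (f i).indicator (1 : Pos d → ℝ) x) atTop
        (𝓝 ((⋃ i, f i).indicator (1 : Pos d → ℝ) x)) := fun x => by
      refine HasSum.tendsto_sum_nat ?_
      by_cases hx : x ∈ ⋃ i, f i
      · obtain ⟨i, hi⟩ := Set.mem_iUnion.1 hx
        rw [Set.indicator_of_mem hx]
        have := hasSum_single (f := fun j => (f j).indicator (1 : Pos d → ℝ) x) i
          fun j hj => Set.indicator_of_notMem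
            (fun hxj => (hf hj).le_bot ⟨hxj, hi⟩) _
        simpa [Set.indicator_of_mem hi] using this
      · rw [Set.indicator_of_notMem hx]
        have h0 : ∀ j, (f j).indicator (1 : Pos d → ℝ) x = 0 := fun j =>
          Set.indicator_of_notMem (fun h => hx (Set.mem_iUnion_of_mem j h)) _
        simp only [h0]
        exact hasSum_zero
    refine measurable_of_tendsto_metrizable
      (f := fun (n : ℕ) (η : FinConf d) => ∑ x ∈ η,
        ∑ i ∈ Finset.range n, (f i).indicator (1 : Pos d → ℝ) x)
      (fun n => ?_) (tendsto_pi_nhds.2 fun η => tendsto_finsetSum _ fun x _ => ht x)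
    simp only [Finset.sum_comm (s := _) (t := Finset.range n)]
    exact Finset.measurable_fun_sum _ fun i _ => ih i

open Classical in
theorem measurable_card_filter {B : Set (Pos d)} (hB : MeasurableSet B) :
    Measurable fun η : FinConf d => (η.filter (· ∈ B)).card := by
  have h := measurable_sum_indicator hB
  have h' : ∀ η : FinConf d, ∑ x ∈ η, B.indicator (1 : Pos d → ℝ) x =
      ((η.filter (· ∈ B)).card : ℝ) := fun η => by
    rw [Finset.card_filter]; push_cast
    exact Finset.sum_congr rfl fun x _ => by simp [Set.indicator_apply]
  simp only [h'] at h
  refine measurable_to_countable' fun n => ?_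
  have := h (measurableSet_singleton (n : ℝ))
  convert this using 1
  ext η; simp

theorem measurable_card : Measurable fun η : FinConf d => η.card := by
  classical
  simpa using measurable_card_filter (d := d) MeasurableSet.univ

theorem orderEmbOfFin_le_iff {α : Type*} [LinearOrder α] (S : Finset α) {n : ℕ} (h : S.card = n)
    (i : Fin n) (t : α) :
    S.orderEmbOfFin h i ≤ t ↔ (i : ℕ) < (S.filter (· ≤ t)).card := by
  constructor
  · intro hi
    have hsub : (Finset.Iic i).map (S.orderEmbOfFin h).toEmbedding ⊆ S.filter (· ≤ t) := by
      intro y hy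
      obtain ⟨j, hj, rfl⟩ := Finset.mem_map.1 hy
      refine Finset.mem_filter.2 ⟨S.orderEmbOfFin_mem h j, ?_⟩
      exact ((S.orderEmbOfFin h).monotone (Finset.mem_Iic.1 hj)).trans hi
    have := Finset.card_le_card hsub
    rw [Finset.card_map, Fin.card_Iic] at this
    omega
  · intro hi
    by_contra hlt
    rw [not_le] at hlt
    have hsub : S.filter (· ≤ t) ⊆ (Finset.Iio i).map (S.orderEmbOfFin h).toEmbedding := by
      intro y hy
      obtain ⟨hyS, hyt⟩ := Finset.mem_filter.1 hy
      have : y ∈ Set.range (S.orderEmbOfFin h) := by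
        rw [Finset.range_orderEmbOfFin]; exact hyS
      obtain ⟨j, rfl⟩ := this
      refine Finset.mem_map.2 ⟨j, Finset.mem_Iio.2 ?_, rfl⟩
      exact (S.orderEmbOfFin h).lt_iff_lt.1 (hyt.trans_lt hlt)
    have := Finset.card_le_card hsub
    rw [Finset.card_map, Fin.card_Iio] at this
    omega

/-- The points of a configuration can be listed measurably. -/
theorem exists_measurable_enumeration (d n : ℕ) :
    ∃ s : FinConf d → Fin n → Pos d, Measurable s ∧ ∀ η : FinConf d, η.card = n →
      Function.Injective (s η) ∧ Finset.univ.image (s η) = η := by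
  classical
  obtain ⟨e, he⟩ := exists_measurableEmbedding_real (Pos d)
  have hc : ∀ η : FinConf d, η.card = n → (η.image e).card = n := fun η h => by
    rw [Finset.card_image_of_injective _ he.injective, h]
  let s : FinConf d → Fin n → Pos d := fun η i =>
    if h : η.card = n then Function.invFun e ((η.image e).orderEmbOfFin (hc η h) i) else 0
  have hs : ∀ η (h : η.card = n) i, e (s η i) = (η.image e).orderEmbOfFin (hc η h) i :=
    fun η h i => by
      have hmem := (η.image e).orderEmbOfFin_mem (hc η h) i
      obtain ⟨x, _, hx⟩ := Finset.mem_image.1 hmem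
      simp only [s, dif_pos h]
      exact Function.invFun_eq ⟨x, hx⟩
  refine ⟨s, measurable_pi_lambda _ fun i => ?_, fun η h => ⟨fun i j hij => ?_, ?_⟩⟩
  · rw [← he.measurable_comp_iff]
    refine measurable_of_Iic fun t => ?_
    have hcard : MeasurableSet {η : FinConf d | η.card = n} :=
      measurable_card (measurableSet_singleton n)
    have hN : MeasurableSet {η : FinConf d | (i : ℕ) < (η.filter (· ∈ e ⁻¹' Set.Iic t)).card} :=
      measurable_card_filter (he.measurable measurableSet_Iic) (measurableSet_Ioi (a := (i : ℕ)))
    have : ((e ∘ fun η => s η i) ⁻¹' Set.Iic t) =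
        {η : FinConf d | η.card = n} ∩
          {η : FinConf d | (i : ℕ) < (η.filter (· ∈ e ⁻¹' Set.Iic t)).card} ∪
        {η : FinConf d | η.card = n}ᶜ ∩ {_η : FinConf d | e 0 ≤ t} := by
      ext η
      by_cases h : η.card = n
      · simp only [Set.mem_preimage, Function.comp, Set.mem_Iic, hs η h, orderEmbOfFin_le_iff,
          Finset.filter_image, Finset.card_image_of_injective _ he.injective]
        simp [h]
      · simp [h, s]
    rw [this]
    exact (hcard.inter hN).union (hcard.compl.inter (MeasurableSet.const _))
  · have := congrArg e hij
    rw [hs η h, hs η h] at this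
    exact ((η.image e).orderEmbOfFin (hc η h)).injective this
  · refine Finset.image_injective he.injective ?_
    rw [Finset.image_image]
    have : (e ∘ s η) = (η.image e).orderEmbOfFin (hc η h) := funext fun i => hs η h i
    rw [this, Finset.image_orderEmbOfFin_univ]

theorem continuousOn_ofFinset_image (n : ℕ) :
    Continuous fun x : {x : Fin n → Pos d // Function.Injective x} =>
      Configuration.ofFinset (Finset.univ.image x.1) := by
  refine continuous_iInf_rng.2 fun f => continuous_induced_rng.2 ?_
  have : (Configuration.pairing f ∘
      fun x : {x : Fin n → Pos d // Function.Injective x} =>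
        Configuration.ofFinset (Finset.univ.image x.1)) = fun x => ∑ i, f (x.1 i) := by
    funext x
    rw [Function.comp, pairing_ofFinset, Finset.sum_image fun i _ j _ h => x.2 h]
  rw [this]
  exact continuous_finsetSum _ fun i _ =>
    f.continuous.comp ((continuous_apply i).comp continuous_subtype_val)

theorem measurableSet_injective (n : ℕ) :
    MeasurableSet {x : Fin n → Pos d | Function.Injective x} := by
  have : {x : Fin n → Pos d | Function.Injective x} =
      ⋂ (i : Fin n) (j : Fin n), {x | x i = x j → i = j} := by
    ext x; simp [Function.Injective]
  rw [this]
  refine MeasurableSet.iInter fun i => MeasurableSet.iInter fun j => ?_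
  by_cases h : i = j
  · simp [h]
  · simp only [h, imp_false]
    exact (measurableSet_eq_fun (measurable_pi_apply i) (measurable_pi_apply j)).compl

theorem measurableSet_injective_image {S : Set (FinConf d)} (hS : MeasurableSet S) (n : ℕ) :
    MeasurableSet {x : Fin n → Pos d | Function.Injective x ∧ Finset.univ.image x ∈ S} := by
  obtain ⟨T, hT, rfl⟩ := hS
  have h := (continuousOn_ofFinset_image (d := d) n).measurable hT
  have h' := (measurableSet_injective (d := d) n).subtype_image h
  convert h' using 1
  ext x
  simp [and_comm]

theorem measurable_of_injective_tuples {Y Z : Type*} [MeasurableSpace Y] [MeasurableSpace Z]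
    {F : Y × FinConf d → Z}
    (h : ∀ n, ∀ S : Set Z, MeasurableSet S → MeasurableSet
      {q : Y × (Fin n → Pos d) | Function.Injective q.2 ∧ F (q.1, Finset.univ.image q.2) ∈ S}) :
    Measurable F := by
  intro S hS
  choose s hs hs' using exists_measurable_enumeration d
  have : F ⁻¹' S = ⋃ n, {p : Y × FinConf d | p.2.card = n} ∩
      (fun p : Y × FinConf d => (p.1, s n p.2)) ⁻¹'
        {q | Function.Injective q.2 ∧ F (q.1, Finset.univ.image q.2) ∈ S} := by
    ext ⟨y, η⟩
    simp only [Set.mem_preimage, Set.mem_iUnion, Set.mem_inter_iff, Set.mem_ofPred_eq]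
    constructor
    · intro hy
      refine ⟨η.card, rfl, (hs' _ η rfl).1, ?_⟩
      rwa [(hs' _ η rfl).2]
    · rintro ⟨n, hn, -, hy⟩
      rwa [(hs' n η hn).2] at hy
  rw [this]
  refine MeasurableSet.iUnion fun n => MeasurableSet.inter ?_ ?_
  · exact (measurable_card.comp measurable_snd) (measurableSet_singleton n)
  · exact (measurable_fst.prodMk ((hs n).comp measurable_snd)) (h n S hS)

theorem measurable_insert : Measurable fun p : Pos d × FinConf d => insert p.1 p.2 := by
  refine measurable_of_injective_tuples fun n S hS => ?_
  have hcons : Measurable fun q : Pos d × (Fin n → Pos d) =>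
      (Fin.cons q.1 q.2 : Fin (n + 1) → Pos d) := by
    refine measurable_pi_lambda _ fun i => ?_
    refine Fin.cases ?_ (fun j => ?_) i
    · simpa using measurable_fst
    · simpa [Function.comp_def] using (measurable_pi_apply j).comp (measurable_snd (α := Pos d))
  have h1 := hcons (measurableSet_injective_image hS (n + 1))
  have h2 := measurableSet_preimage (measurable_snd : Measurable (Prod.snd : Pos d × _ → _))
    (measurableSet_injective_image hS n)
  have h3 : MeasurableSet {q : Pos d × (Fin n → Pos d) | ∃ i, q.2 i = q.1} := by
    have : {q : Pos d × (Fin n → Pos d) | ∃ i, q.2 i = q.1} = ⋃ i, {q | q.2 i = q.1} := by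
      ext; simp
    rw [this]
    exact MeasurableSet.iUnion fun i =>
      measurableSet_eq_fun ((measurable_pi_apply i).comp measurable_snd) measurable_fst
  convert (h3.inter h2).union h1 using 1
  ext ⟨y, x⟩
  simp only [Set.mem_ofPred_eq, Set.mem_union, Set.mem_inter_iff, Set.mem_preimage,
    Fin.cons_injective_iff, Set.mem_range]
  have hc : Finset.univ.image (Fin.cons y x : Fin (n + 1) → Pos d) =
      insert y (Finset.univ.image x) := by
    ext z; simp [Fin.exists_fin_succ, eq_comm]
  rw [hc]
  by_cases hy : ∃ i, x i = y
  · have : insert y (Finset.univ.image x) = Finset.univ.image x :=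
      Finset.insert_eq_of_mem (by simpa using hy)
    rw [this]
    tauto
  · tauto

theorem measurable_union_image {ι : Type*} [DecidableEq ι] (S : Finset ι) :
    Measurable fun q : FinConf d × (ι → Pos d) => q.1 ∪ S.image q.2 := by
  induction S using Finset.induction_on with
  | empty => simpa using measurable_fst
  | insert i S _ ih =>
    have : (fun q : FinConf d × (ι → Pos d) => q.1 ∪ (insert i S).image q.2) =
        fun q => insert (q.2 i) (q.1 ∪ S.image q.2) := by
      funext q; ext; simp
    rw [this]
    exact measurable_insert.comp (((measurable_pi_apply i).comp measurable_snd).prodMk ih)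

theorem measurable_image {ι : Type*} [DecidableEq ι] (S : Finset ι) :
    Measurable fun x : ι → Pos d => S.image x := by
  have := (measurable_union_image (d := d) S).comp
    (measurable_const (a := (∅ : FinConf d)).prodMk measurable_id)
  simpa [Function.comp_def] using this

/-- A map is measurable if it is measurable in terms of the points of the configuration. -/
theorem measurable_of_tuples {Y Z : Type*} [MeasurableSpace Y] [MeasurableSpace Z]
    {F : Y × FinConf d → Z} (Fn : ∀ n, Y × (Fin n → Pos d) → Z) (hFn : ∀ n, Measurable (Fn n))
    (h : ∀ n y x, Function.Injective x → F (y, Finset.univ.image x) = Fn n (y, x)) :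
    Measurable F := by
  refine measurable_of_injective_tuples fun n S hS => ?_
  convert (measurable_snd (α := Y) (measurableSet_injective (d := d) n)).inter (hFn n hS) using 1
  ext ⟨y, x⟩
  simp only [Set.mem_ofPred_eq, Set.mem_inter_iff, Set.mem_preimage]
  exact and_congr_right fun hx => by rw [h n y x hx]

theorem measurable_union : Measurable fun p : FinConf d × FinConf d => p.1 ∪ p.2 :=
  measurable_of_tuples _ (fun _ => measurable_union_image Finset.univ) fun _ _ _ _ => rfl

theorem measurable_shift : Measurable fun p : Pos d × FinConf d => shift p.2 p.1 := by
  refine measurable_of_tuples (fun n q => Finset.univ.image fun i => q.2 i + q.1) (fun n => ?_)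
    fun n y x _ => by simp [shift, Finset.image_image, Function.comp_def]
  exact (measurable_image Finset.univ).comp (measurable_pi_lambda _ fun i =>
    ((measurable_pi_apply i).comp measurable_snd).add measurable_fst)

theorem erase_image {n : ℕ} {x : Fin n → Pos d} (hx : Function.Injective x) (i : Fin n) :
    (Finset.univ.image x).erase (x i) = (Finset.univ.erase i).image x :=
  (Finset.image_erase hx _ _).symm

theorem measurable_sum_erase {Y Z : Type*} [MeasurableSpace Y] [MeasurableSpace Z]
    [AddCommMonoid Z] [MeasurableAdd₂ Z] {H : Y × Pos d × FinConf d → Z} (hH : Measurable H) :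
    Measurable fun p : Y × FinConf d => ∑ x ∈ p.2, H (p.1, x, p.2.erase x) := by
  refine measurable_of_tuples
    (fun n q => ∑ i, H (q.1, q.2 i, (Finset.univ.erase i).image q.2)) (fun n => ?_)
    fun n y x hx => ?_
  · exact Finset.measurable_fun_sum _ fun i _ => hH.comp (measurable_fst.prodMk
      (((measurable_pi_apply i).comp measurable_snd).prodMk
        ((measurable_image _).comp measurable_snd)))
  · simp only
    rw [Finset.sum_image fun i _ j _ h => hx h]
    exact Finset.sum_congr rfl fun i _ => by rw [erase_image hx]

theorem measurable_sum_powerset {Y Z : Type*} [MeasurableSpace Y] [MeasurableSpace Z]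
    [AddCommMonoid Z] [MeasurableAdd₂ Z] {H : Y × FinConf d × FinConf d → Z} (hH : Measurable H) :
    Measurable fun p : Y × FinConf d => ∑ ζ ∈ p.2.powerset, H (p.1, ζ, p.2 \ ζ) := by
  refine measurable_of_tuples
    (fun n q => ∑ S : Finset (Fin n), H (q.1, S.image q.2, (Finset.univ \ S).image q.2))
    (fun n => ?_) fun n y x hx => ?_
  · exact Finset.measurable_fun_sum _ fun i _ => hH.comp (measurable_fst.prodMk
      (((measurable_image _).comp measurable_snd).prodMk
        ((measurable_image _).comp measurable_snd)))
  · simp only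
    rw [Finset.powerset_image, Finset.sum_image fun S _ T _ h => Finset.image_injective hx h,
      Finset.powerset_univ]
    exact Finset.sum_congr rfl fun S _ => by rw [Finset.image_sdiff _ _ hx]

theorem measurable_eLambda {Y : Type*} [MeasurableSpace Y] {f : Y → Pos d → ℝ}
    (hf : Measurable fun p : Y × Pos d => f p.1 p.2) :
    Measurable fun p : Y × FinConf d => eLambda (f p.1) p.2 := by
  refine measurable_of_tuples (fun n q => ∏ i, f q.1 (q.2 i)) (fun n => ?_) fun n y x hx => ?_
  · exact Finset.measurable_fun_prod _ fun i _ => hf.comp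
      (measurable_fst.prodMk ((measurable_pi_apply i).comp measurable_snd))
  · simp only [eLambda]
    exact Finset.prod_image fun i _ j _ h => hx h

end FinConf

/-! ### Integration with respect to the Lebesgue–Poisson measure -/

/-- Transfer of an identity for nonnegative functions to integrable real functions. -/
theorem integral_sum_of_lintegral {A B ι : Type*} [MeasurableSpace A] [MeasurableSpace B]
    {mA : Measure A} {mB : Measure B} {s : B → Finset ι} {c : B → ι → A}
    (hm : ∀ H : A → ℝ, Measurable H → Measurable fun b => ∑ i ∈ s b, H (c b i))
    (hl : ∀ H : A → ℝ≥0∞, Measurable H →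
      ∫⁻ b, ∑ i ∈ s b, H (c b i) ∂mB = ∫⁻ a, H a ∂mA)
    {H : A → ℝ} (hH : Measurable H) (hi : Integrable H mA) :
    Integrable (fun b => ∑ i ∈ s b, H (c b i)) mB ∧
      ∫ b, ∑ i ∈ s b, H (c b i) ∂mB = ∫ a, H a ∂mA := by
  have key : ∀ H : A → ℝ, Measurable H → Integrable H mA →
      Integrable (fun b => ∑ i ∈ s b, H (c b i)) mB := fun H hH hi => by
    refine ⟨(hm H hH).aestronglyMeasurable, ?_⟩
    refine lt_of_le_of_lt (lintegral_mono fun b => ?_)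
      ((hl (fun a => ‖H a‖ₑ) hH.enorm).trans_lt hi.2)
    exact enorm_sum_le _ _
  have nonneg : ∀ H : A → ℝ, Measurable H → (∀ a, 0 ≤ H a) →
      ∫ b, ∑ i ∈ s b, H (c b i) ∂mB = ∫ a, H a ∂mA := fun H hH h0 => by
    rw [integral_eq_lintegral_of_nonneg_ae (ae_of_all _ h0) hH.aestronglyMeasurable,
      integral_eq_lintegral_of_nonneg_ae (ae_of_all _ fun b => Finset.sum_nonneg fun i _ => h0 _)
        (hm H hH).aestronglyMeasurable, ← hl _ hH.ennreal_ofReal]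
    congr 1
    exact lintegral_congr fun b => ENNReal.ofReal_sum_of_nonneg fun i _ => h0 _
  refine ⟨key H hH hi, ?_⟩
  have hp : Measurable fun a => max (H a) 0 := hH.max measurable_const
  have hn : Measurable fun a => max (-H a) 0 := hH.neg.max measurable_const
  have hsub : ∀ a, H a = max (H a) 0 - max (-H a) 0 := fun a => by
    rcases le_total 0 (H a) with h | h
    · rw [max_eq_left h, max_eq_right (by linarith)]; ring
    · rw [max_eq_right h, max_eq_left (by linarith)]; ring
  have e1 : ∀ b, ∑ i ∈ s b, H (c b i) =
      ∑ i ∈ s b, max (H (c b i)) 0 - ∑ i ∈ s b, max (-H (c b i)) 0 := fun b => by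
    rw [← Finset.sum_sub_distrib]
    exact Finset.sum_congr rfl fun i _ => hsub _
  rw [integral_congr_ae (ae_of_all _ e1), integral_congr_ae (ae_of_all _ hsub),
    integral_sub (key _ hp hi.pos_part) (key _ hn hi.neg_part),
    integral_sub hi.pos_part hi.neg_part,
    nonneg _ hp fun a => le_max_right _ _, nonneg _ hn fun a => le_max_right _ _]

/-- Choosing a subset and then a point of it, or the other way round. -/
theorem sum_powerset_sum_mem {α M : Type*} [DecidableEq α] [AddCommMonoid M]
    (P : α → Finset α → Finset α → M) (η : Finset α) :
    ∑ ζ ∈ η.powerset, ∑ x ∈ ζ, P x (ζ.erase x) (η \ ζ) =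
      ∑ x ∈ η, ∑ ζ ∈ (η.erase x).powerset, P x ζ (η.erase x \ ζ) := by
  rw [Finset.sum_sigma', Finset.sum_sigma']
  refine Finset.sum_bij' (fun p _ => ⟨p.2, p.1.erase p.2⟩) (fun p _ => ⟨insert p.1 p.2, p.1⟩)
    ?_ ?_ ?_ ?_ ?_
  · rintro ⟨ζ, x⟩ h; simp only [Finset.mem_sigma, Finset.mem_powerset] at h ⊢; grind
  · rintro ⟨ζ, x⟩ h; simp only [Finset.mem_sigma, Finset.mem_powerset] at h ⊢; grind
  · rintro ⟨ζ, x⟩ h; simp only [Finset.mem_sigma, Finset.mem_powerset] at h ⊢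
    rw [Finset.insert_erase h.2]
  · rintro ⟨x, ζ⟩ h; simp only [Finset.mem_sigma, Finset.mem_powerset] at h ⊢
    rw [Finset.erase_insert (by grind)]
  · rintro ⟨ζ, x⟩ h; simp only [Finset.mem_sigma, Finset.mem_powerset] at h ⊢
    congr 1
    grind

namespace FinConf

variable {d : ℕ}

instance : SFinite (lebesguePoisson d) := by unfold lebesguePoisson; infer_instance

instance [NeZero d] : NullSingletonClass (volume : Measure (Pos d)) :=
  Measure.IsAddHaarMeasure.nullSingletonClass _

theorem ae_injective [NeZero d] (n : ℕ) :
    ∀ᵐ x : Fin n → Pos d, Function.Injective x := by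
  have h : ∀ i j : Fin n, ∀ᵐ x : Fin n → Pos d, x i = x j → i = j := fun i j => by
    by_cases hij : i = j
    · simp [hij]
    simp only [hij, imp_false]
    let p : Submodule ℝ (Fin n → Pos d) := LinearMap.ker
      (LinearMap.proj (R := ℝ) (φ := fun _ : Fin n => Pos d) i - LinearMap.proj j)
    have hp : p ≠ ⊤ := fun htop => by
      obtain ⟨z, hz⟩ := exists_ne (0 : Pos d)
      have : (Pi.single i z : Fin n → Pos d) ∈ p := htop ▸ Submodule.mem_top
      simp only [p, LinearMap.mem_ker, LinearMap.sub_apply, LinearMap.proj_apply,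
        Pi.single_eq_same, Pi.single_eq_of_ne (Ne.symm hij), sub_zero] at this
      exact hz this
    have h0 := Measure.addHaar_submodule (volume : Measure (Fin n → Pos d)) p hp
    refine measure_mono_null (fun x hx => ?_) h0
    simpa [p, sub_eq_zero] using hx
  filter_upwards [ae_all_iff.2 fun i => ae_all_iff.2 (h i)] with x hx i j using hx i j

theorem lintegral_lebesguePoisson [NeZero d] {F : FinConf d → ℝ≥0∞} (hF : Measurable F) :
    ∫⁻ η, F η ∂(lebesguePoisson d) = ∑' n : ℕ, (n.factorial : ℝ≥0∞)⁻¹ *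
      ∫⁻ x : Fin n → Pos d, F (Finset.univ.image x) := by
  rw [lebesguePoisson, lintegral_sum_measure]
  refine tsum_congr fun n => ?_
  rw [lintegral_smul_measure, lintegral_map hF (measurable_image _), smul_eq_mul]
  rw [Measure.restrict_eq_self_of_ae_mem (s := {x | Function.Injective x}) (ae_injective n)]

theorem lintegral_eq_empty [NeZero d] {F : FinConf d → ℝ≥0∞} (hF : Measurable F)
    (h : ∀ η, η ≠ ∅ → F η = 0) : ∫⁻ η, F η ∂(lebesguePoisson d) = F ∅ := by
  rw [lintegral_lebesguePoisson hF, tsum_eq_single 0]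
  · simp [volume_pi]
  · intro n hn
    have : ∀ x : Fin n → Pos d, F (Finset.univ.image x) = 0 := fun x => h _ (by
      have : NeZero n := ⟨hn⟩
      exact (Finset.univ_nonempty.image x).ne_empty)
    simp [this]

/-- The Mecke formula for the Lebesgue–Poisson measure. -/
theorem lintegral_sum_erase [NeZero d] {H : Pos d × FinConf d → ℝ≥0∞} (hH : Measurable H) :
    ∫⁻ η, ∑ x ∈ η, H (x, η.erase x) ∂(lebesguePoisson d) =
      ∫⁻ p, H p ∂((volume : Measure (Pos d)).prod (lebesguePoisson d)) := by
  have hmeas : Measurable fun η : FinConf d => ∑ x ∈ η, H (x, η.erase x) :=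
    (measurable_sum_erase (Y := Unit) (H := fun q => H q.2) (hH.comp measurable_snd)).comp
      (measurable_const (a := ()).prodMk measurable_id)
  have hq : ∀ n, Measurable fun q : Pos d × (Fin n → Pos d) => H (q.1, Finset.univ.image q.2) :=
    fun n => hH.comp (measurable_fst.prodMk ((measurable_image _).comp measurable_snd))
  rw [lintegral_lebesguePoisson hmeas, lintegral_prod _ hH.aemeasurable]
  have hR : ∀ x : Pos d, ∫⁻ η, H (x, η) ∂(lebesguePoisson d) =
      ∑' n : ℕ, (n.factorial : ℝ≥0∞)⁻¹ *
        ∫⁻ y : Fin n → Pos d, H (x, Finset.univ.image y) := fun x =>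
    lintegral_lebesguePoisson (hH.comp (measurable_const.prodMk measurable_id))
  simp only [hR]
  rw [lintegral_tsum fun n =>
    ((hq n).lintegral_prod_right' (ν := volume)).const_mul _ |>.aemeasurable]
  rw [tsum_eq_zero_add' ENNReal.summable]
  have h0 : ∀ x : Fin 0 → Pos d, Finset.univ.image x = ∅ := fun x => by simp
  simp only [h0, Finset.sum_empty, lintegral_zero, mul_zero, zero_add]
  refine tsum_congr fun n => ?_
  rw [lintegral_const_mul _ ((hq n).lintegral_prod_right' (ν := volume))]
  have hterm : ∀ i : Fin (n + 1), ∫⁻ x : Fin (n + 1) → Pos d,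
      H (x i, (Finset.univ.erase i).image x) =
      ∫⁻ y : Pos d, ∫⁻ z : Fin n → Pos d, H (y, Finset.univ.image z) := fun i => by
    rw [← lintegral_prod _ (hq n).aemeasurable]
    refine Eq.trans ?_
      ((volume_preserving_piFinSuccAbove (fun _ => Pos d) i).lintegral_comp (hq n))
    refine lintegral_congr fun x => ?_
    have : (Finset.univ.erase i).image x =
        Finset.univ.image (MeasurableEquiv.piFinSuccAbove (fun _ => Pos d) i x).2 := by
      ext z
      simp only [Finset.mem_image, Finset.mem_erase, Finset.mem_univ, and_true, true_and,
        MeasurableEquiv.piFinSuccAbove_apply, Fin.insertNthEquiv_symm_apply, Fin.removeNth]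
      constructor
      · rintro ⟨j, hj, rfl⟩
        obtain ⟨l, rfl⟩ := Fin.exists_succAbove_eq hj
        exact ⟨l, rfl⟩
      · rintro ⟨l, rfl⟩
        exact ⟨_, Fin.succAbove_ne i l, rfl⟩
    rw [this]
    rfl
  have hsum : ∫⁻ x : Fin (n + 1) → Pos d, ∑ z ∈ Finset.univ.image x,
      H (z, (Finset.univ.image x).erase z) =
      ((n + 1 : ℕ) : ℝ≥0∞) * ∫⁻ y : Pos d, ∫⁻ z : Fin n → Pos d, H (y, Finset.univ.image z) := by
    have : ∀ᵐ x : Fin (n + 1) → Pos d, ∑ z ∈ Finset.univ.image x,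
        H (z, (Finset.univ.image x).erase z) =
        ∑ i, H (x i, (Finset.univ.erase i).image x) := by
      filter_upwards [ae_injective (n + 1)] with x hx
      rw [Finset.sum_image fun i _ j _ h => hx h]
      exact Finset.sum_congr rfl fun i _ => by rw [erase_image hx]
    have hmi : ∀ i : Fin (n + 1), Measurable fun x : Fin (n + 1) → Pos d =>
        H (x i, (Finset.univ.erase i).image x) := fun i =>
      hH.comp ((measurable_pi_apply i).prodMk (measurable_image _))
    rw [lintegral_congr_ae this, lintegral_finsetSum _ fun i _ => hmi i]
    simp [hterm]
  rw [hsum, ← mul_assoc]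
  congr 1
  rw [Nat.factorial_succ, Nat.cast_mul, ENNReal.mul_inv (by simp) (by simp), mul_right_comm,
    ENNReal.inv_mul_cancel (by simp) (by simp), one_mul]

theorem lintegral_sum_powerset_of_card [NeZero d] (n : ℕ) :
    ∀ {H : FinConf d × FinConf d → ℝ≥0∞}, Measurable H → (∀ ζ ξ, ζ.card ≠ n → H (ζ, ξ) = 0) →
    ∫⁻ η, ∑ ζ ∈ η.powerset, H (ζ, η \ ζ) ∂(lebesguePoisson d) =
      ∫⁻ ζ, ∫⁻ ξ, H (ζ, ξ) ∂(lebesguePoisson d) ∂(lebesguePoisson d) := by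
  induction n with
  | zero =>
    intro H hH h0
    rw [lintegral_eq_empty hH.lintegral_prod_right' fun ζ hζ => by
      simp [h0 ζ _ (Finset.card_ne_zero.2 (Finset.nonempty_iff_ne_empty.2 hζ))]]
    refine lintegral_congr fun η => ?_
    rw [Finset.sum_eq_single ∅]
    · simp
    · intro ζ _ hζ
      exact h0 _ _ (Finset.card_ne_zero.2 (Finset.nonempty_iff_ne_empty.2 hζ))
    · simp
  | succ n ih =>
    intro H hH h0
    have hcard : MeasurableSet {p : Pos d × FinConf d × FinConf d | p.2.1.card = n} :=
      (measurable_card.comp (measurable_fst.comp measurable_snd)) (measurableSet_singleton n)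
    have hins : Measurable fun p : Pos d × FinConf d × FinConf d => H (insert p.1 p.2.1, p.2.2) :=
      hH.comp ((measurable_insert.comp
        (measurable_fst.prodMk (measurable_fst.comp measurable_snd))).prodMk
          (measurable_snd.comp measurable_snd))
    let H' : Pos d × FinConf d × FinConf d → ℝ≥0∞ :=
      fun p => if p.2.1.card = n then H (insert p.1 p.2.1, p.2.2) else 0
    have hH' : Measurable H' := Measurable.ite hcard hins measurable_const
    have hx : ∀ x : Pos d, ∫⁻ η, ∑ ζ ∈ η.powerset, H' (x, ζ, η \ ζ) ∂(lebesguePoisson d) =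
        ∫⁻ ζ, ∫⁻ ξ, H' (x, ζ, ξ) ∂(lebesguePoisson d) ∂(lebesguePoisson d) := fun x =>
      ih (hH'.comp (measurable_const.prodMk measurable_id)) fun ζ ξ h => if_neg h
    have hn : ((n + 1 : ℕ) : ℝ≥0∞) ≠ 0 := by simp
    have hn' : ((n + 1 : ℕ) : ℝ≥0∞) ≠ ∞ := by simp
    rw [← ENNReal.mul_right_inj hn hn', ← lintegral_const_mul' _ _ hn',
      ← lintegral_const_mul' _ _ hn']
    have hA : Measurable fun p : Pos d × FinConf d =>
        ∑ ζ ∈ p.2.powerset, H' (p.1, ζ, p.2 \ ζ) := measurable_sum_powerset hH'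
    have hB : Measurable fun p : Pos d × FinConf d =>
        ∫⁻ ξ, H' (p.1, p.2, ξ) ∂(lebesguePoisson d) :=
      (hH'.comp (MeasurableEquiv.prodAssoc.measurable)).lintegral_prod_right'
    calc ∫⁻ η, ((n + 1 : ℕ) : ℝ≥0∞) * ∑ ζ ∈ η.powerset, H (ζ, η \ ζ) ∂(lebesguePoisson d)
        = ∫⁻ η, ∑ x ∈ η, ∑ ζ ∈ (η.erase x).powerset, H' (x, ζ, η.erase x \ ζ)
            ∂(lebesguePoisson d) := by
          refine lintegral_congr fun η => ?_
          rw [← sum_powerset_sum_mem (fun x ζ ξ => H' (x, ζ, ξ)), Finset.mul_sum]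
          refine Finset.sum_congr rfl fun ζ _ => ?_
          by_cases hζ : ζ.card = n + 1
          · have : ∀ x ∈ ζ, H' (x, ζ.erase x, η \ ζ) = H (ζ, η \ ζ) := fun x hx => by
              simp only [H', Finset.card_erase_of_mem hx, hζ, Nat.add_sub_cancel, if_true,
                Finset.insert_erase hx]
            rw [Finset.sum_congr rfl this, Finset.sum_const, hζ, nsmul_eq_mul]
          · rw [h0 _ _ hζ, mul_zero, Finset.sum_eq_zero]
            intro x hx
            refine if_neg ?_
            simp only [Finset.card_erase_of_mem hx]
            have := Finset.card_pos.2 ⟨x, hx⟩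
            omega
      _ = ∫⁻ x, ∫⁻ η, ∑ ζ ∈ η.powerset, H' (x, ζ, η \ ζ) ∂(lebesguePoisson d) := by
          rw [lintegral_sum_erase (H := fun p => ∑ ζ ∈ p.2.powerset, H' (p.1, ζ, p.2 \ ζ)) hA,
            lintegral_prod _ hA.aemeasurable]
      _ = ∫⁻ x, ∫⁻ ζ, ∫⁻ ξ, H' (x, ζ, ξ) ∂(lebesguePoisson d) ∂(lebesguePoisson d) :=
          lintegral_congr hx
      _ = ∫⁻ ζ, ∑ x ∈ ζ, ∫⁻ ξ, H' (x, ζ.erase x, ξ) ∂(lebesguePoisson d)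
            ∂(lebesguePoisson d) := by
          rw [lintegral_sum_erase
            (H := fun p => ∫⁻ ξ, H' (p.1, p.2, ξ) ∂(lebesguePoisson d)) hB,
            lintegral_prod _ hB.aemeasurable]
      _ = ∫⁻ ζ, ((n + 1 : ℕ) : ℝ≥0∞) * ∫⁻ ξ, H (ζ, ξ) ∂(lebesguePoisson d)
            ∂(lebesguePoisson d) := by
          refine lintegral_congr fun ζ => ?_
          by_cases hζ : ζ.card = n + 1
          · have : ∀ x ∈ ζ, ∫⁻ ξ, H' (x, ζ.erase x, ξ) ∂(lebesguePoisson d) =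
                ∫⁻ ξ, H (ζ, ξ) ∂(lebesguePoisson d) := fun x hx => by
              simp only [H', Finset.card_erase_of_mem hx, hζ, Nat.add_sub_cancel, if_true,
                Finset.insert_erase hx]
            rw [Finset.sum_congr rfl this, Finset.sum_const, hζ, nsmul_eq_mul]
          · simp only [h0 _ _ hζ, lintegral_zero, mul_zero]
            refine Finset.sum_eq_zero fun x hx => ?_
            have hne : (ζ.erase x).card ≠ n := by
              have := Finset.card_pos.2 ⟨x, hx⟩
              rw [Finset.card_erase_of_mem hx]; omega
            simp [H', hne]

/-- Summation over the subsets of a configuration turns the Lebesgue–Poisson measure into its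
product with itself. -/
theorem lintegral_sum_powerset [NeZero d] {H : FinConf d × FinConf d → ℝ≥0∞}
    (hH : Measurable H) :
    ∫⁻ η, ∑ ζ ∈ η.powerset, H (ζ, η \ ζ) ∂(lebesguePoisson d) =
      ∫⁻ p, H p ∂((lebesguePoisson d).prod (lebesguePoisson d)) := by
  let Hn : ℕ → FinConf d × FinConf d → ℝ≥0∞ := fun n p => if p.1.card = n then H p else 0
  have hHn : ∀ n, Measurable (Hn n) := fun n =>
    Measurable.ite ((measurable_card.comp measurable_fst) (measurableSet_singleton n)) hH
      measurable_const
  have hsum : ∀ p, H p = ∑' n, Hn n p := fun p => by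
    rw [tsum_eq_single p.1.card fun n hn => if_neg (Ne.symm hn)]
    exact (if_pos rfl).symm
  have hS : ∀ n, Measurable fun η : FinConf d => ∑ ζ ∈ η.powerset, Hn n (ζ, η \ ζ) := fun n =>
    (measurable_sum_powerset (Y := Unit) (H := fun q => Hn n q.2)
      ((hHn n).comp measurable_snd)).comp (measurable_const (a := ()).prodMk measurable_id)
  calc ∫⁻ η, ∑ ζ ∈ η.powerset, H (ζ, η \ ζ) ∂(lebesguePoisson d)
      = ∫⁻ η, ∑' n, ∑ ζ ∈ η.powerset, Hn n (ζ, η \ ζ) ∂(lebesguePoisson d) := by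
        refine lintegral_congr fun η => ?_
        rw [Summable.tsum_finsetSum fun _ _ => ENNReal.summable]
        exact Finset.sum_congr rfl fun ζ _ => hsum _
    _ = ∑' n, ∫⁻ p, Hn n p ∂((lebesguePoisson d).prod (lebesguePoisson d)) := by
        rw [lintegral_tsum fun n => (hS n).aemeasurable]
        refine tsum_congr fun n => ?_
        rw [lintegral_prod _ (hHn n).aemeasurable]
        exact lintegral_sum_powerset_of_card n (hHn n) fun ζ ξ h => if_neg h
    _ = ∫⁻ p, H p ∂((lebesguePoisson d).prod (lebesguePoisson d)) := by
        rw [← lintegral_tsum fun n => (hHn n).aemeasurable]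
        exact lintegral_congr fun p => (hsum p).symm

variable {W : Type*} [MeasurableSpace W] {ν : Measure W}

theorem lintegral_prod_sum_powerset [NeZero d] {H : W × FinConf d × FinConf d → ℝ≥0∞}
    (hH : Measurable H) :
    ∫⁻ p, ∑ ζ ∈ p.2.powerset, H (p.1, ζ, p.2 \ ζ) ∂(ν.prod (lebesguePoisson d)) =
      ∫⁻ q, H q ∂(ν.prod ((lebesguePoisson d).prod (lebesguePoisson d))) := by
  rw [lintegral_prod _ (measurable_sum_powerset hH).aemeasurable, lintegral_prod _ hH.aemeasurable]
  exact lintegral_congr fun w =>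
    lintegral_sum_powerset (H := fun p => H (w, p))
      (hH.comp (measurable_const.prodMk measurable_id))

theorem integral_prod_sum_powerset [NeZero d] {H : W × FinConf d × FinConf d → ℝ}
    (hH : Measurable H)
    (hi : Integrable H (ν.prod ((lebesguePoisson d).prod (lebesguePoisson d)))) :
    Integrable (fun p => ∑ ζ ∈ p.2.powerset, H (p.1, ζ, p.2 \ ζ)) (ν.prod (lebesguePoisson d)) ∧
      ∫ p, ∑ ζ ∈ p.2.powerset, H (p.1, ζ, p.2 \ ζ) ∂(ν.prod (lebesguePoisson d)) =
        ∫ q, H q ∂(ν.prod ((lebesguePoisson d).prod (lebesguePoisson d))) :=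
  integral_sum_of_lintegral (s := fun p : W × FinConf d => p.2.powerset)
    (c := fun p ζ => (p.1, ζ, p.2 \ ζ)) (fun _ hH => measurable_sum_powerset hH)
    (fun _ hH => lintegral_prod_sum_powerset hH) hH hi

theorem integral_sum_powerset [NeZero d] {H : FinConf d × FinConf d → ℝ} (hH : Measurable H)
    (hi : Integrable H ((lebesguePoisson d).prod (lebesguePoisson d))) :
    Integrable (fun η => ∑ ζ ∈ η.powerset, H (ζ, η \ ζ)) (lebesguePoisson d) ∧
      ∫ η, ∑ ζ ∈ η.powerset, H (ζ, η \ ζ) ∂(lebesguePoisson d) =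
        ∫ q, H q ∂((lebesguePoisson d).prod (lebesguePoisson d)) :=
  integral_sum_of_lintegral (s := fun η : FinConf d => η.powerset)
    (c := fun η ζ => (ζ, η \ ζ))
    (fun H hH => (measurable_sum_powerset (Y := Unit) (H := fun q => H q.2)
      (hH.comp measurable_snd)).comp (measurable_const (a := ()).prodMk measurable_id))
    (fun _ hH => lintegral_sum_powerset hH) hH hi

theorem integral_sum_erase [NeZero d] {H : Pos d × FinConf d → ℝ} (hH : Measurable H)
    (hi : Integrable H ((volume : Measure (Pos d)).prod (lebesguePoisson d))) :
    Integrable (fun η => ∑ x ∈ η, H (x, η.erase x)) (lebesguePoisson d) ∧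
      ∫ η, ∑ x ∈ η, H (x, η.erase x) ∂(lebesguePoisson d) =
        ∫ q, H q ∂((volume : Measure (Pos d)).prod (lebesguePoisson d)) :=
  integral_sum_of_lintegral (s := fun η : FinConf d => η)
    (c := fun η x => (x, η.erase x))
    (fun H hH => (measurable_sum_erase (Y := Unit) (H := fun q => H q.2)
      (hH.comp measurable_snd)).comp (measurable_const (a := ()).prodMk measurable_id))
    (fun _ hH => lintegral_sum_erase hH) hH hi

theorem measurable_shift_right (v : Pos d) : Measurable fun η : FinConf d => shift η v :=
  measurable_shift.comp (measurable_const.prodMk measurable_id)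

theorem measurePreserving_shift [NeZero d] (v : Pos d) :
    MeasurePreserving (fun η : FinConf d => shift η v) (lebesguePoisson d) (lebesguePoisson d) := by
  refine ⟨measurable_shift_right v, Measure.ext_of_lintegral _ fun F hF => ?_⟩
  rw [lintegral_map hF (measurable_shift_right v), lintegral_lebesguePoisson hF]
  refine (lintegral_lebesguePoisson (hF.comp (measurable_shift_right v))).trans ?_
  refine tsum_congr fun n => ?_
  congr 1
  rw [← lintegral_add_right_eq_self (fun x => F (Finset.univ.image x)) (fun _ => v)]
  refine lintegral_congr fun x => ?_
  simp only [Function.comp_apply, shift, Finset.image_image]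
  rfl

end FinConf

theorem IsCorrelationFunctional.apply_empty {d : ℕ} [NeZero d] {μ : Measure (Configuration d)}
    [IsProbabilityMeasure μ] {k : FinConf d → ℝ} (hk : IsCorrelationFunctional μ k) :
    k ∅ = 1 := by
  let G : FinConf d → ℝ≥0∞ := fun η => if η.card = 0 then 1 else 0
  have hG : Measurable G := Measurable.ite
    (FinConf.measurable_card (measurableSet_singleton 0)) measurable_const measurable_const
  have h := hk.isCorrelationMeasure G hG
  have h1 : ∀ γ : Configuration d, KTransform G γ = 1 := fun γ => by
    unfold KTransform
    rw [tsum_eq_single ⟨∅, by simp⟩]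
    · simp [G]
    · rintro ⟨η, hη⟩ hne
      refine if_neg fun h => hne (Subtype.ext (Finset.card_eq_zero.1 h))
  rw [lintegral_withDensity_eq_lintegral_mul _ hk.measurable.ennreal_ofReal hG] at h
  rw [FinConf.lintegral_eq_empty (hk.measurable.ennreal_ofReal.mul hG) fun η hη => by
    simp [G, hη]] at h
  simp only [h1, lintegral_one, measure_univ, Pi.mul_apply, G, Finset.card_empty, if_true,
    mul_one] at h
  exact (ENNReal.ofReal_eq_one.1 h.symm)

/-! ### Bounds -/

/-- The bound `(n!)^s C^n`, made monotone in `n`. -/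
noncomputable def growthBound (s C : ℝ) (n : ℕ) : ℝ := (n.factorial : ℝ) ^ s * (max C 1) ^ n

theorem one_le_growthBound {s : ℝ} (hs : 0 ≤ s) (C : ℝ) (n : ℕ) : 1 ≤ growthBound s C n :=
  one_le_mul_of_one_le_of_one_le
    (Real.one_le_rpow (by exact_mod_cast Nat.one_le_iff_ne_zero.2 n.factorial_ne_zero) hs)
    (one_le_pow₀ (le_max_right _ _))

theorem growthBound_nonneg {s : ℝ} (hs : 0 ≤ s) (C : ℝ) (n : ℕ) : 0 ≤ growthBound s C n :=
  zero_le_one.trans (one_le_growthBound hs C n)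

theorem growthBound_mono {s : ℝ} (hs : 0 ≤ s) (C : ℝ) : Monotone (growthBound s C) := by
  intro m n h
  unfold growthBound
  gcongr
  exact le_max_right _ _

theorem le_growthBound {s C x : ℝ} {n : ℕ} (hC : 0 < C)
    (hx : x ≤ (n.factorial : ℝ) ^ s * C ^ n) : x ≤ growthBound s C n := by
  refine hx.trans ?_
  unfold growthBound
  gcongr
  exact le_max_left _ _

theorem growthBound_succ (s C : ℝ) (n : ℕ) :
    growthBound s C (n + 1) = growthBound s C n * (((n : ℝ) + 1) ^ s * max C 1) := by
  unfold growthBound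
  rw [Nat.factorial_succ, Nat.cast_mul, Real.mul_rpow (by positivity) (by positivity), pow_succ]
  push_cast
  ring

theorem summable_growthBound {s : ℝ} (hs0 : 0 ≤ s) (hs1 : s < 1) (C : ℝ) (N : ℕ) {I : ℝ}
    (hI : 0 ≤ I) :
    Summable fun n : ℕ => (n.factorial : ℝ)⁻¹ * growthBound s C (n + N) * I ^ n := by
  let ρ : ℕ → ℝ := fun n => ((n : ℝ) + 1)⁻¹ * (((n + N : ℕ) : ℝ) + 1) ^ s * (max C 1 * I)
  have hρ0 : ∀ n, 0 ≤ ρ n := fun n => by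
    have : 0 ≤ max C 1 := zero_le_one.trans (le_max_right _ _)
    positivity
  have hρ : Tendsto ρ atTop (𝓝 0) := by
    have h1 : Tendsto (fun n : ℕ => ((n : ℝ) + 1) ^ (-(1 - s))) atTop (𝓝 0) :=
      (tendsto_rpow_neg_atTop (by linarith)).comp
        (tendsto_atTop_add_const_right _ _ tendsto_natCast_atTop_atTop)
    have h2 := h1.mul_const (((N : ℝ) + 1) ^ s * (max C 1 * I))
    rw [zero_mul] at h2
    refine squeeze_zero hρ0 (fun n => ?_) h2
    have h3 : (((n + N : ℕ) : ℝ) + 1) ^ s ≤ ((n : ℝ) + 1) ^ s * ((N : ℝ) + 1) ^ s := by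
      rw [← Real.mul_rpow (by positivity) (by positivity)]
      refine Real.rpow_le_rpow (by positivity) ?_ hs0
      push_cast
      nlinarith [(Nat.cast_nonneg n : (0 : ℝ) ≤ n), (Nat.cast_nonneg N : (0 : ℝ) ≤ N),
        mul_nonneg (Nat.cast_nonneg (α := ℝ) n) (Nat.cast_nonneg (α := ℝ) N)]
    have h4 : ((n : ℝ) + 1) ^ (-(1 - s)) = ((n : ℝ) + 1)⁻¹ * ((n : ℝ) + 1) ^ s := by
      rw [show -(1 - s) = -1 + s by ring, Real.rpow_add (by positivity), Real.rpow_neg_one]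
    have h5 : 0 ≤ max C 1 * I := mul_nonneg (zero_le_one.trans (le_max_right _ _)) hI
    calc ρ n ≤ ((n : ℝ) + 1)⁻¹ * (((n : ℝ) + 1) ^ s * ((N : ℝ) + 1) ^ s) * (max C 1 * I) := by
          exact mul_le_mul_of_nonneg_right (mul_le_mul_of_nonneg_left h3 (by positivity)) h5
      _ = _ := by rw [h4]; ring
  refine summable_of_ratio_norm_eventually_le (r := 1 / 2) (by norm_num) ?_
  filter_upwards [hρ.eventually_le_const (show (0 : ℝ) < 1 / 2 by norm_num)] with n hn
  have hstep : ((n + 1).factorial : ℝ)⁻¹ * growthBound s C (n + 1 + N) * I ^ (n + 1) =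
      ρ n * ((n.factorial : ℝ)⁻¹ * growthBound s C (n + N) * I ^ n) := by
    rw [show n + 1 + N = n + N + 1 by ring, growthBound_succ, Nat.factorial_succ, pow_succ]
    simp only [ρ]
    push_cast
    rw [mul_inv]
    ring
  rw [hstep, norm_mul, Real.norm_of_nonneg (hρ0 n)]
  exact mul_le_mul_of_nonneg_right hn (norm_nonneg _)

/-- The integral of a Lebesgue–Poisson exponential, weighted with the growth bound. -/
noncomputable def expBound (s C : ℝ) (N : ℕ) (I : ℝ≥0∞) : ℝ≥0∞ :=
  ∑' n : ℕ, (n.factorial : ℝ≥0∞)⁻¹ * (ENNReal.ofReal (growthBound s C (n + N)) * I ^ n)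

theorem expBound_lt_top {s : ℝ} (hs0 : 0 ≤ s) (hs1 : s < 1) (C : ℝ) (N : ℕ) {I : ℝ≥0∞}
    (hI : I ≠ ∞) : expBound s C N I < ∞ := by
  have h :=
    (summable_growthBound hs0 hs1 C N (I := I.toReal) ENNReal.toReal_nonneg).tsum_ofReal_lt_top
  convert h using 1
  unfold expBound
  refine tsum_congr fun n => ?_
  have h1 := growthBound_nonneg hs0 C (n + N)
  rw [ENNReal.ofReal_mul (by positivity), ENNReal.ofReal_mul (by positivity),
    ENNReal.ofReal_inv_of_pos (by positivity), ENNReal.ofReal_natCast,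
    ENNReal.ofReal_pow ENNReal.toReal_nonneg, ENNReal.ofReal_toReal hI, mul_assoc]

theorem lintegral_pi_prod {d : ℕ} {g : Pos d → ℝ≥0∞} (hg : Measurable g) (n : ℕ) :
    ∫⁻ x : Fin n → Pos d, ∏ i, g (x i) = (∫⁻ y, g y) ^ n := by
  induction n with
  | zero => simp [volume_pi]
  | succ n ih =>
    have hm : Measurable fun x : Fin n → Pos d => ∏ i, g (x i) :=
      Finset.measurable_fun_prod _ fun i _ => hg.comp (measurable_pi_apply i)
    have hp := (volume_preserving_piFinSuccAbove (fun _ : Fin (n + 1) => Pos d) 0).lintegral_comp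
      (f := fun q : Pos d × (Fin n → Pos d) => g q.1 * ∏ i, g (q.2 i))
      ((hg.comp measurable_fst).mul (hm.comp measurable_snd))
    rw [pow_succ', ← ih, ← lintegral_prod_mul hg.aemeasurable hm.aemeasurable]
    refine Eq.trans (lintegral_congr fun x => ?_) hp
    rw [Fin.prod_univ_succ]
    rfl

namespace FinConf

variable {d : ℕ}

theorem measurable_eLambda_right {f : Pos d → ℝ} (hf : Measurable f) : Measurable (eLambda f) :=
  (measurable_eLambda (Y := Unit) (f := fun _ => f) (hf.comp measurable_snd)).comp
    (measurable_const (a := ()).prodMk measurable_id)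

theorem measurable_growthBound_card (s C : ℝ) (N : ℕ) :
    Measurable fun ξ : FinConf d => growthBound s C (ξ.card + N) :=
  (measurable_from_top (f := fun n : ℕ => growthBound s C (n + N))).comp measurable_card

theorem lintegral_eLambda_mul_growthBound_le [NeZero d] (s C : ℝ) (N : ℕ) {f : Pos d → ℝ}
    (hf : Measurable f) {I : ℝ≥0∞} (hI : ∫⁻ u, ‖f u‖ₑ ≤ I) :
    ∫⁻ ξ, ‖eLambda f ξ‖ₑ * ENNReal.ofReal (growthBound s C (ξ.card + N)) ∂(lebesguePoisson d) ≤
      expBound s C N I := by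
  have hm : Measurable fun ξ : FinConf d =>
      ‖eLambda f ξ‖ₑ * ENNReal.ofReal (growthBound s C (ξ.card + N)) :=
    (measurable_eLambda_right hf).enorm.mul (measurable_growthBound_card s C N).ennreal_ofReal
  rw [lintegral_lebesguePoisson hm]
  refine ENNReal.tsum_le_tsum fun n => ?_
  gcongr
  have : ∀ᵐ x : Fin n → Pos d, ‖eLambda f (Finset.univ.image x)‖ₑ *
      ENNReal.ofReal (growthBound s C ((Finset.univ.image x).card + N)) =
      ENNReal.ofReal (growthBound s C (n + N)) * ∏ i, ‖f (x i)‖ₑ := by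
    filter_upwards [ae_injective n] with x hx
    rw [Finset.card_image_of_injective _ hx, Finset.card_univ, Fintype.card_fin, mul_comm, eLambda,
      Finset.prod_image fun i _ j _ h => hx h]
    congr 1
    simp [enorm_eq_nnnorm, nnnorm_prod]
  rw [lintegral_congr_ae this, lintegral_const_mul' _ _ ENNReal.ofReal_ne_top,
    lintegral_pi_prod hf.enorm]
  gcongr

theorem lintegral_eLambda_lt_top [NeZero d] {f : Pos d → ℝ} (hf : Measurable f)
    (hI : ∫⁻ u, ‖f u‖ₑ ≠ ∞) : ∫⁻ ξ, ‖eLambda f ξ‖ₑ ∂(lebesguePoisson d) < ∞ := by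
  refine lt_of_le_of_lt (lintegral_mono fun ξ => ?_)
    ((lintegral_eLambda_mul_growthBound_le 0 1 0 hf le_rfl).trans_lt
      (expBound_lt_top le_rfl zero_lt_one 1 0 hI))
  refine le_mul_of_one_le_right' ?_
  exact ENNReal.one_le_ofReal.2 (one_le_growthBound le_rfl _ _)

theorem abs_eLambda_le {f : Pos d → ℝ} {R : ℝ} (hf : ∀ u, |f u| ≤ R) (η : FinConf d) :
    |eLambda f η| ≤ R ^ η.card := by
  rw [eLambda, Finset.abs_prod]
  exact (Finset.prod_le_prod (fun u _ => abs_nonneg _) fun u _ => hf u).trans_eq (by simp)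

theorem eLambda_add (f g : Pos d → ℝ) (η : FinConf d) :
    eLambda (fun u => f u + g u) η =
      ∑ ζ ∈ η.powerset, eLambda f ζ * eLambda g (η \ ζ) := by
  unfold eLambda
  exact Finset.prod_add f g η

theorem eLambda_sdiff (f : Pos d → ℝ) {ζ η : FinConf d} (h : ζ ⊆ η) :
    eLambda f ζ * eLambda f (η \ ζ) = eLambda f η := by
  rw [mul_comm]; exact Finset.prod_sdiff h

end FinConf

theorem sum_powerset_powerset {α M : Type*} [DecidableEq α] [AddCommMonoid M]
    (P : Finset α → Finset α → Finset α → M) (η : Finset α) :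
    ∑ ξ ∈ η.powerset, ∑ ζ ∈ ξ.powerset, P ζ (ξ \ ζ) (η \ ξ) =
      ∑ ζ ∈ η.powerset, ∑ θ ∈ (η \ ζ).powerset, P ζ θ ((η \ ζ) \ θ) := by
  rw [Finset.sum_sigma', Finset.sum_sigma']
  refine Finset.sum_bij' (fun p _ => ⟨p.2, p.1 \ p.2⟩) (fun p _ => ⟨p.1 ∪ p.2, p.1⟩)
    ?_ ?_ ?_ ?_ ?_
  · rintro ⟨ζ, x⟩ h; simp only [Finset.mem_sigma, Finset.mem_powerset] at h ⊢; grind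
  · rintro ⟨ζ, x⟩ h; simp only [Finset.mem_sigma, Finset.mem_powerset] at h ⊢; grind
  · rintro ⟨ζ, x⟩ h; simp only [Finset.mem_sigma, Finset.mem_powerset] at h ⊢
    rw [Finset.union_sdiff_of_subset h.2]
  · rintro ⟨x, ζ⟩ h; simp only [Finset.mem_sigma, Finset.mem_powerset] at h ⊢
    have : (x ∪ ζ) \ x = ζ := by grind
    rw [this]
  · rintro ⟨ζ, x⟩ h; simp only [Finset.mem_sigma, Finset.mem_powerset] at h ⊢
    congr 1
    grind

/-- The inverse `K`-transform of the product of an exponential and a `K`-transform. -/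
theorem sum_alternating_eLambda_mul {d : ℕ} (f : Pos d → ℝ) (g : FinConf d → ℝ) (η : FinConf d) :
    ∑ ξ ∈ η.powerset, (-1) ^ (η \ ξ).card * (eLambda f ξ * ∑ ζ ∈ ξ.powerset, g ζ) =
      ∑ ζ ∈ η.powerset, g ζ * (eLambda f ζ * eLambda (fun u => f u - 1) (η \ ζ)) := by
  have h1 : ∀ ξ ∈ η.powerset, (-1) ^ (η \ ξ).card * (eLambda f ξ * ∑ ζ ∈ ξ.powerset, g ζ) =
      ∑ ζ ∈ ξ.powerset, g ζ * (eLambda f ζ * (eLambda f (ξ \ ζ) * (-1) ^ (η \ ξ).card)) :=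
    fun ξ _ => by
      rw [Finset.mul_sum, Finset.mul_sum]
      refine Finset.sum_congr rfl fun ζ hζ => ?_
      rw [← FinConf.eLambda_sdiff f (Finset.mem_powerset.1 hζ)]
      ring
  rw [Finset.sum_congr rfl h1, sum_powerset_powerset
    (fun ζ θ ρ => g ζ * (eLambda f ζ * (eLambda f θ * (-1) ^ ρ.card)))]
  refine Finset.sum_congr rfl fun ζ _ => ?_
  simp only [sub_eq_add_neg]
  rw [FinConf.eLambda_add, Finset.mul_sum, Finset.mul_sum]
  simp [eLambda]

/-- The same identity under an integral. -/
theorem sum_alternating_integral {d : ℕ} {W : Type*} [MeasurableSpace W] {ν : Measure W}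
    {wt : W → ℝ} {f : W → Pos d → ℝ} {g : W → FinConf d → ℝ} {R : ℝ}
    (hf : ∀ u, Measurable fun w => f w u) (hR : ∀ w u, |f w u| ≤ R)
    (hg : ∀ ζ, Integrable (fun w => wt w * g w ζ) ν) (η : FinConf d) :
    ∑ ξ ∈ η.powerset, (-1) ^ (η \ ξ).card *
      ∫ w, wt w * (eLambda (f w) ξ * ∑ ζ ∈ ξ.powerset, g w ζ) ∂ν =
      ∫ w, ∑ ζ ∈ η.powerset,
        wt w * (g w ζ * (eLambda (f w) ζ * eLambda (fun u => f w u - 1) (η \ ζ))) ∂ν := by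
  have hint : ∀ ξ, Integrable
      (fun w => wt w * (eLambda (f w) ξ * ∑ ζ ∈ ξ.powerset, g w ζ)) ν := fun ξ => by
    have h1 : Integrable (fun w => ∑ ζ ∈ ξ.powerset, wt w * g w ζ) ν :=
      integrable_finsetSum _ fun ζ _ => hg ζ
    have h2 := h1.bdd_mul (f := fun w => eLambda (f w) ξ) (c := R ^ ξ.card)
      (Finset.measurable_fun_prod _ fun u _ => hf u).aestronglyMeasurable
      (ae_of_all _ fun w => FinConf.abs_eLambda_le (hR w) ξ)
    refine h2.congr (ae_of_all _ fun w => ?_)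
    simp only [← Finset.mul_sum]
    ring
  simp only [← integral_const_mul]
  rw [← integral_finsetSum _ fun ξ _ => (hint ξ).const_mul _]
  refine integral_congr_ae (ae_of_all _ fun w => ?_)
  simp only
  rw [← Finset.mul_sum, ← sum_alternating_eLambda_mul, Finset.mul_sum]
  exact Finset.sum_congr rfl fun ξ _ => by ring

/-! ### The dual pairing -/

namespace FinConf

variable {d : ℕ}

theorem measurePreserving_rearrange {X Y Z : Type*} [MeasurableSpace X] [MeasurableSpace Y]
    [MeasurableSpace Z] (μ : Measure X) (ν : Measure Y) (τ : Measure Z) [SFinite μ] [SFinite ν]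
    [SFinite τ] :
    MeasurePreserving (fun p : (X × Z) × Y => ((p.1.1, p.2), p.1.2)) ((μ.prod τ).prod ν)
      ((μ.prod ν).prod τ) :=
  ((measurePreserving_prodAssoc μ ν τ).symm MeasurableEquiv.prodAssoc).comp
    (((MeasurePreserving.id μ).prod Measure.measurePreserving_swap).comp
      (measurePreserving_prodAssoc μ τ ν))

theorem integral_comp_of_measurePreserving {X Y : Type*} [MeasurableSpace X] [MeasurableSpace Y]
    {μ : Measure X} {ν : Measure Y} {e : X → Y} (he : MeasurePreserving e μ ν) {S : Y → ℝ}
    (hS : Measurable S) : ∫ x, S (e x) ∂μ = ∫ y, S y ∂ν := by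
  rw [← he.map_eq, integral_map he.measurable.aemeasurable hS.aestronglyMeasurable]

variable {V : Type*} [MeasurableSpace V] {ν : Measure V} [SFinite ν]

theorem integral_sum_erase_integral [NeZero d] {S : (Pos d × V) × FinConf d → ℝ}
    (hS : Measurable S)
    (hi : Integrable S (((volume : Measure (Pos d)).prod ν).prod (lebesguePoisson d))) :
    Integrable (fun η => ∑ x ∈ η, ∫ v, S ((x, v), η.erase x) ∂ν) (lebesguePoisson d) ∧
      ∫ η, ∑ x ∈ η, ∫ v, S ((x, v), η.erase x) ∂ν ∂(lebesguePoisson d) =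
        ∫ q, S q ∂(((volume : Measure (Pos d)).prod ν).prod (lebesguePoisson d)) := by
  have he := measurePreserving_rearrange (volume : Measure (Pos d)) ν (lebesguePoisson d)
  have hSe : Measurable fun p : (Pos d × FinConf d) × V => S ((p.1.1, p.2), p.1.2) :=
    hS.comp he.measurable
  have hie : Integrable (fun p : (Pos d × FinConf d) × V => S ((p.1.1, p.2), p.1.2))
      (((volume : Measure (Pos d)).prod (lebesguePoisson d)).prod ν) :=
    he.integrable_comp_of_integrable hi
  have hH : Measurable fun p : Pos d × FinConf d => ∫ v, S ((p.1, v), p.2) ∂ν :=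
    hSe.stronglyMeasurable.integral_prod_right'.measurable
  obtain ⟨h1, h2⟩ := integral_sum_erase hH hie.integral_prod_left
  refine ⟨h1, h2.trans ?_⟩
  rw [← integral_comp_of_measurePreserving he hS, integral_prod _ hie]

/-- The two ways of evaluating the pairing with a kernel. -/
theorem integral_kernel_erase [NeZero d] {Ψ : (Pos d × V) × FinConf d × FinConf d → ℝ}
    (hΨ : Measurable Ψ) (hi : Integrable Ψ (((volume : Measure (Pos d)).prod ν).prod
      ((lebesguePoisson d).prod (lebesguePoisson d)))) :
    (Integrable (fun η => ∑ x ∈ η, ∫ v, ∑ ζ ∈ (η.erase x).powerset,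
        Ψ ((x, v), ζ, η.erase x \ ζ) ∂ν) (lebesguePoisson d) ∧
      ∫ η, ∑ x ∈ η, ∫ v, ∑ ζ ∈ (η.erase x).powerset, Ψ ((x, v), ζ, η.erase x \ ζ) ∂ν
          ∂(lebesguePoisson d) =
        ∫ q, Ψ q ∂(((volume : Measure (Pos d)).prod ν).prod
          ((lebesguePoisson d).prod (lebesguePoisson d)))) ∧
    (Integrable (fun η => ∑ x ∈ η, ∫ v, ∫ ξ, Ψ ((x, v), η.erase x, ξ) ∂(lebesguePoisson d) ∂ν)
        (lebesguePoisson d) ∧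
      ∫ η, ∑ x ∈ η, ∫ v, ∫ ξ, Ψ ((x, v), η.erase x, ξ) ∂(lebesguePoisson d) ∂ν
          ∂(lebesguePoisson d) =
        ∫ q, Ψ q ∂(((volume : Measure (Pos d)).prod ν).prod
          ((lebesguePoisson d).prod (lebesguePoisson d)))) := by
  constructor
  · obtain ⟨h1, h2⟩ := integral_prod_sum_powerset hΨ hi
    obtain ⟨h3, h4⟩ := integral_sum_erase_integral (measurable_sum_powerset hΨ) h1
    exact ⟨h3, h4.trans h2⟩
  · have he := measurePreserving_prodAssoc ((volume : Measure (Pos d)).prod ν) (lebesguePoisson d)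
      (lebesguePoisson d)
    have hie := he.integrable_comp_of_integrable hi
    have hm := hΨ.comp he.measurable
    obtain ⟨h3, h4⟩ := integral_sum_erase_integral
      hm.stronglyMeasurable.integral_prod_right'.measurable hie.integral_prod_left
    refine ⟨h3, h4.trans ?_⟩
    rw [← integral_prod _ hie]
    exact integral_comp_of_measurePreserving he hΨ

theorem integral_kernel [NeZero d] {Ψ : Pos d × FinConf d × FinConf d → ℝ}
    (hΨ : Measurable Ψ) (hi : Integrable Ψ ((volume : Measure (Pos d)).prod
      ((lebesguePoisson d).prod (lebesguePoisson d)))) :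
    (Integrable (fun η => ∫ y, ∑ ζ ∈ η.powerset, Ψ (y, ζ, η \ ζ)) (lebesguePoisson d) ∧
      ∫ η, (∫ y, ∑ ζ ∈ η.powerset, Ψ (y, ζ, η \ ζ)) ∂(lebesguePoisson d) =
        ∫ q, Ψ q ∂((volume : Measure (Pos d)).prod
          ((lebesguePoisson d).prod (lebesguePoisson d)))) ∧
    (Integrable (fun η => ∑ x ∈ η, ∫ ξ, Ψ (x, η.erase x, ξ) ∂(lebesguePoisson d))
        (lebesguePoisson d) ∧
      ∫ η, ∑ x ∈ η, ∫ ξ, Ψ (x, η.erase x, ξ) ∂(lebesguePoisson d) ∂(lebesguePoisson d) =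
        ∫ q, Ψ q ∂((volume : Measure (Pos d)).prod
          ((lebesguePoisson d).prod (lebesguePoisson d)))) := by
  constructor
  · obtain ⟨h1, h2⟩ := integral_prod_sum_powerset hΨ hi
    exact ⟨h1.integral_prod_right, (integral_prod_symm _ h1).symm.trans h2⟩
  · have he := measurePreserving_prodAssoc (volume : Measure (Pos d)) (lebesguePoisson d)
      (lebesguePoisson d)
    have hie := he.integrable_comp_of_integrable hi
    have hm := hΨ.comp he.measurable
    obtain ⟨h3, h4⟩ := integral_sum_erase
      hm.stronglyMeasurable.integral_prod_right'.measurable hie.integral_prod_left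
    refine ⟨h3, h4.trans ?_⟩
    rw [← integral_prod _ hie]
    exact integral_comp_of_measurePreserving he hΨ

end FinConf

/-- The common kernel of the pairings `∫ (L̂ G) k dλ` and `∫ G (L̂^* k) dλ`. -/
noncomputable def dualKernel {d : ℕ} {W : Type*} (wt : W → ℝ) (z : W → Pos d) (B : W → FinConf d)
    (f : W → Pos d → ℝ) (k G : FinConf d → ℝ) (q : W × FinConf d × FinConf d) : ℝ :=
  wt q.1 * (G (insert (z q.1) q.2.1) *
    (eLambda (f q.1) q.2.1 * eLambda (fun u => f q.1 u - 1) q.2.2)) * k (q.2.1 ∪ q.2.2 ∪ B q.1)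

section dualKernel

variable {d : ℕ} {W : Type*} [MeasurableSpace W] {ν : Measure W}
  {wt : W → ℝ} {z : W → Pos d} {B : W → FinConf d} {f : W → Pos d → ℝ} {k G : FinConf d → ℝ}

theorem measurable_dualKernel (hwt : Measurable wt) (hz : Measurable z) (hB : Measurable B)
    (hf : Measurable fun p : W × Pos d => f p.1 p.2) (hk : Measurable k) (hG : Measurable G) :
    Measurable (dualKernel wt z B f k G) := by
  have h1 : Measurable fun q : W × FinConf d × FinConf d => insert (z q.1) q.2.1 :=
    FinConf.measurable_insert.comp ((hz.comp measurable_fst).prodMk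
      (measurable_fst.comp measurable_snd))
  have h2 : Measurable fun q : W × FinConf d × FinConf d => eLambda (f q.1) q.2.1 :=
    (FinConf.measurable_eLambda hf).comp (measurable_fst.prodMk
      (measurable_fst.comp measurable_snd))
  have h3 : Measurable fun q : W × FinConf d × FinConf d =>
      eLambda (fun u => f q.1 u - 1) q.2.2 :=
    (FinConf.measurable_eLambda (f := fun w u => f w u - 1) (hf.sub_const 1)).comp
      (measurable_fst.prodMk (measurable_snd.comp measurable_snd))
  have h4 : Measurable fun q : W × FinConf d × FinConf d => q.2.1 ∪ q.2.2 ∪ B q.1 :=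
    FinConf.measurable_union.comp ((FinConf.measurable_union.comp measurable_snd).prodMk
      (hB.comp measurable_fst))
  exact ((hwt.comp measurable_fst).mul ((hG.comp h1).mul (h2.mul h3))).mul (hk.comp h4)

theorem integrable_dualKernel [NeZero d] {s C R : ℝ} {I : ℝ≥0∞} (hs0 : 0 ≤ s) (hs1 : s < 1)
    (hwt : Measurable wt) (hz : Measurable z) (hB : Measurable B)
    (hf : Measurable fun p : W × Pos d => f p.1 p.2) (hk : Measurable k) (hG : IsBbs G)
    (hwti : ∀ r : ℝ, ∫⁻ w, ‖wt w‖ₑ * (Metric.closedBall (0 : Pos d) r).indicator 1 (z w) ∂ν < ∞)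
    (hB1 : ∀ w, (B w).card ≤ 1) (hR : 1 ≤ R) (hfR : ∀ w u, |f w u| ≤ R) (hI : I ≠ ∞)
    (hfI : ∀ w, ∫⁻ u, ‖f w u - 1‖ₑ ≤ I) (hk0 : ∀ η, 0 ≤ k η)
    (hkb : ∀ η, k η ≤ growthBound s C η.card) :
    Integrable (dualKernel wt z B f k G)
      (ν.prod ((lebesguePoisson d).prod (lebesguePoisson d))) := by
  obtain ⟨M, hM⟩ := hG.bounded
  obtain ⟨Λ, N, hΛ, hsupp⟩ := hG.support
  obtain ⟨r, hr⟩ := hΛ.subset_closedBall (0 : Pos d)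
  have hM0 : 0 ≤ M := (abs_nonneg _).trans (hM ∅)
  have hΨ := measurable_dualKernel hwt hz hB hf hk hG.measurable
  refine ⟨hΨ.aestronglyMeasurable, ?_⟩
  let K : Set (Pos d) := Metric.closedBall 0 r
  have hK : MeasurableSet K := Metric.isClosed_closedBall.measurableSet
  let χ : Pos d → ℝ := K.indicator 1
  have hχ : Measurable χ := measurable_one.indicator hK
  let A : W → ℝ≥0∞ := fun w => ‖wt w‖ₑ * K.indicator 1 (z w) * ENNReal.ofReal (M * R ^ N)
  let E : W → FinConf d → ℝ≥0∞ := fun w ξ => ‖eLambda (fun u => f w u - 1) ξ‖ₑ *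
    ENNReal.ofReal (growthBound s C (ξ.card + (N + 1)))
  have hbound : ∀ w ζ ξ, ‖dualKernel wt z B f k G (w, ζ, ξ)‖ₑ ≤
      A w * (‖eLambda χ ζ‖ₑ * E w ξ) := fun w ζ ξ => by
    by_cases h0 : G (insert (z w) ζ) = 0
    · simp [dualKernel, h0]
    obtain ⟨hsub, hcard⟩ := hsupp _ h0
    have hsub' : ∀ u ∈ insert (z w) ζ, u ∈ K := fun u hu => hr (hsub (Finset.mem_coe.2 hu))
    have h1 : eLambda χ ζ = 1 := Finset.prod_eq_one fun u hu =>
      Set.indicator_of_mem (hsub' u (Finset.mem_insert_of_mem hu)) _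
    have h2 : K.indicator (1 : Pos d → ℝ≥0∞) (z w) = 1 :=
      Set.indicator_of_mem (hsub' _ (Finset.mem_insert_self _ _)) _
    have hζ : ζ.card ≤ N := (Finset.card_le_card (Finset.subset_insert _ _)).trans hcard
    have h3 : |eLambda (f w) ζ| ≤ R ^ N :=
      (FinConf.abs_eLambda_le (hfR w) ζ).trans (pow_le_pow_right₀ hR hζ)
    have h4 : |k (ζ ∪ ξ ∪ B w)| ≤ growthBound s C (ξ.card + (N + 1)) := by
      rw [abs_of_nonneg (hk0 _)]
      refine (hkb _).trans (growthBound_mono hs0 C ?_)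
      have e1 := Finset.card_union_le (ζ ∪ ξ) (B w)
      have e2 := Finset.card_union_le ζ ξ
      have e3 := hB1 w
      omega
    have h5 : |dualKernel wt z B f k G (w, ζ, ξ)| ≤ |wt w| * (M * R ^ N) *
        (|eLambda (fun u => f w u - 1) ξ| * growthBound s C (ξ.card + (N + 1))) := by
      simp only [dualKernel, abs_mul]
      calc |wt w| * (|G (insert (z w) ζ)| *
            (|eLambda (f w) ζ| * |eLambda (fun u => f w u - 1) ξ|)) * |k (ζ ∪ ξ ∪ B w)|
          ≤ |wt w| * (M * (R ^ N * |eLambda (fun u => f w u - 1) ξ|)) *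
            growthBound s C (ξ.card + (N + 1)) := by
            gcongr
            exact hM _
        _ = _ := by ring
    have hg := growthBound_nonneg hs0 C (ξ.card + (N + 1))
    simp only [A, E, h1, h2, enorm_one, one_mul, mul_one]
    rw [Real.enorm_eq_ofReal_abs, Real.enorm_eq_ofReal_abs, Real.enorm_eq_ofReal_abs,
      ← ENNReal.ofReal_mul (abs_nonneg _), ← ENNReal.ofReal_mul (abs_nonneg _),
      ← ENNReal.ofReal_mul (by positivity)]
    exact ENNReal.ofReal_le_ofReal h5
  have hE : ∀ w, ∫⁻ ξ, E w ξ ∂(lebesguePoisson d) ≤ expBound s C (N + 1) I := fun w =>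
    FinConf.lintegral_eLambda_mul_growthBound_le s C (N + 1)
      (f := fun u => f w u - 1)
      ((hf.comp (measurable_const.prodMk measurable_id)).sub_const 1) (hfI w)
  have hχi : ∫⁻ ζ, ‖eLambda χ ζ‖ₑ ∂(lebesguePoisson d) < ∞ := by
    refine FinConf.lintegral_eLambda_lt_top hχ (ne_of_lt ?_)
    have : ∀ u, ‖χ u‖ₑ = K.indicator 1 u := fun u => by
      by_cases hu : u ∈ K <;> simp [χ, hu]
    simp only [this, lintegral_indicator_one hK]
    exact measure_closedBall_lt_top
  have hEm : ∀ w, Measurable (E w) := fun w =>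
    (FinConf.measurable_eLambda_right (f := fun u => f w u - 1)
      ((hf.comp (measurable_const.prodMk measurable_id)).sub_const 1)).enorm.mul
      (FinConf.measurable_growthBound_card s C (N + 1)).ennreal_ofReal
  have hXm : Measurable fun ζ : FinConf d => ‖eLambda χ ζ‖ₑ :=
    (FinConf.measurable_eLambda_right hχ).enorm
  have hAm : Measurable fun w => ‖wt w‖ₑ * K.indicator (1 : Pos d → ℝ≥0∞) (z w) :=
    hwt.enorm.mul ((measurable_one.indicator hK).comp hz)
  have hin : ∀ w, ∫⁻ p, ‖dualKernel wt z B f k G (w, p)‖ₑ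
      ∂((lebesguePoisson d).prod (lebesguePoisson d)) ≤
      A w * ((∫⁻ ζ, ‖eLambda χ ζ‖ₑ ∂(lebesguePoisson d)) * expBound s C (N + 1) I) := fun w => by
    have hm : Measurable fun p : FinConf d × FinConf d => ‖eLambda χ p.1‖ₑ * E w p.2 :=
      (hXm.comp measurable_fst).mul ((hEm w).comp measurable_snd)
    have h1 : ∫⁻ p, ‖dualKernel wt z B f k G (w, p)‖ₑ
        ∂((lebesguePoisson d).prod (lebesguePoisson d)) ≤
        ∫⁻ p : FinConf d × FinConf d, A w * (‖eLambda χ p.1‖ₑ * E w p.2)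
          ∂((lebesguePoisson d).prod (lebesguePoisson d)) :=
      lintegral_mono fun p => hbound w p.1 p.2
    refine h1.trans ?_
    rw [lintegral_const_mul _ hm, lintegral_prod_mul hXm.aemeasurable (hEm w).aemeasurable]
    exact mul_le_mul_right (mul_le_mul_right (hE w) _) _
  change ∫⁻ q, ‖dualKernel wt z B f k G q‖ₑ
      ∂(ν.prod ((lebesguePoisson d).prod (lebesguePoisson d))) < ∞
  rw [lintegral_prod _ hΨ.enorm.aemeasurable]
  refine (lintegral_mono hin).trans_lt ?_
  have hD := ENNReal.mul_lt_top hχi (expBound_lt_top hs0 hs1 C (N + 1) hI)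
  generalize (∫⁻ ζ, ‖eLambda χ ζ‖ₑ ∂(lebesguePoisson d)) * expBound s C (N + 1) I = D at hD ⊢
  simp only [A, mul_assoc _ (ENNReal.ofReal (M * R ^ N)) D]
  rw [lintegral_mul_const _ hAm]
  exact ENNReal.mul_lt_top (hwti r) (ENNReal.mul_lt_top ENNReal.ofReal_lt_top hD)

end dualKernel

/-! ### The operators on finite configurations -/

section

variable {d : ℕ}

/-- The factor `exp (φ⁻(x - u) - φ⁺(y - u))` of the rate. -/
noncomputable def jumpFactor (φm φp : Pos d → ℝ) (x y u : Pos d) : ℝ :=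
  Real.exp (φm (x - u) - φp (y - u))

theorem energy_ofFinset (V : Pos d → ℝ) (x : Pos d) (ξ : FinConf d) :
    energy V x (Configuration.ofFinset ξ) = ∑ y ∈ ξ, V (x - y) :=
  Finset.tsum_subtype ξ fun y => V (x - y)

theorem rate_ofFinset (φm φp : Pos d → ℝ) (x y : Pos d) (ξ : FinConf d) :
    rate φm φp x y (Configuration.ofFinset ξ) = eLambda (jumpFactor φm φp x y) ξ := by
  simp only [rate, energy_ofFinset, eLambda, jumpFactor, ← Real.exp_sum,
    Finset.sum_sub_distrib]

theorem erase_ofFinset (ξ : FinConf d) (x : Pos d) :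
    (Configuration.ofFinset ξ).erase x = Configuration.ofFinset (ξ.erase x) :=
  Configuration.ext (by simp [Configuration.erase, Configuration.ofFinset])

theorem insert_ofFinset (ξ : FinConf d) (x : Pos d) :
    (Configuration.ofFinset ξ).insert x = Configuration.ofFinset (insert x ξ) :=
  Configuration.ext (by simp [Configuration.insert, Configuration.ofFinset]; rfl)

theorem KTransform_insert_sub (G : FinConf d → ℝ) {ξ : FinConf d} {x : Pos d} (hx : x ∉ ξ) :
    KTransform G (Configuration.ofFinset (insert x ξ)) - KTransform G (Configuration.ofFinset ξ) =
      ∑ ζ ∈ ξ.powerset, G (insert x ζ) := by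
  rw [KTransform_ofFinset, KTransform_ofFinset, Finset.sum_powerset_insert hx]
  ring

theorem hatOp_of_sum {L : (Configuration d → ℝ) → Configuration d → ℝ} {G : FinConf d → ℝ}
    {Q : Pos d → FinConf d → ℝ} (h : ∀ ξ : FinConf d,
      L (KTransform G) (Configuration.ofFinset ξ) = ∑ x ∈ ξ, Q x (ξ.erase x)) (η : FinConf d) :
    hatOp L G η = ∑ x ∈ η, ∑ ζ ∈ (η.erase x).powerset,
      (-1) ^ (η.erase x \ ζ).card * Q x ζ := by
  unfold hatOp KInverse
  simp only [h, Finset.mul_sum]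
  exact sum_powerset_sum_mem (fun x ζ ρ => (-1) ^ ρ.card * Q x ζ) η

theorem IsBbs.measurable_insert {G : FinConf d → ℝ} (hG : IsBbs G) (ζ : FinConf d) :
    Measurable fun y : Pos d => G (insert y ζ) :=
  hG.measurable.comp (FinConf.measurable_insert.comp (measurable_id.prodMk measurable_const))

theorem IsBbs.integrable_insert {G : FinConf d → ℝ} (hG : IsBbs G) (ζ : FinConf d) :
    Integrable fun y : Pos d => G (insert y ζ) := by
  obtain ⟨M, hM⟩ := hG.bounded
  obtain ⟨Λ, N, hΛ, hsupp⟩ := hG.support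
  obtain ⟨r, hr⟩ := hΛ.subset_closedBall (0 : Pos d)
  have hK : MeasurableSet (Metric.closedBall (0 : Pos d) r) :=
    Metric.isClosed_closedBall.measurableSet
  have hi : Integrable ((Metric.closedBall (0 : Pos d) r).indicator fun _ => M) :=
    (integrable_indicator_iff hK).2 (integrableOn_const measure_closedBall_lt_top.ne)
  refine hi.mono' (hG.measurable_insert ζ).aestronglyMeasurable (ae_of_all _ fun y => ?_)
  by_cases h0 : G (insert y ζ) = 0
  · rw [h0, norm_zero]
    exact Set.indicator_nonneg (fun _ _ => (abs_nonneg _).trans (hM ∅)) _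
  · rw [Set.indicator_of_mem (hr ((hsupp _ h0).1 (by simp)))]
    exact hM _

end

section

variable {d : ℕ} {a φm φp : Pos d → ℝ} {ε : ℝ}

theorem integrable_scaledJump (ha : Integrable a) (hε : 0 < ε) : Integrable (scaledJump a ε) :=
  (ha.comp_smul hε.ne').const_mul _

theorem measurable_scaledJump (ha : Measurable a) (ε : ℝ) : Measurable (scaledJump a ε) :=
  (ha.comp (measurable_const_smul ε)).const_mul _

theorem scaledJump_sub_comm (ha : Function.Even a) (ε : ℝ) (x y : Pos d) :
    scaledJump a ε (x - y) = scaledJump a ε (y - x) := by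
  unfold scaledJump
  rw [← ha, ← smul_neg, neg_sub]

theorem measurable_jumpFactor (hm : Continuous φm) (hp : Continuous φp) :
    Measurable fun p : (Pos d × Pos d) × Pos d => jumpFactor φm φp p.1.1 p.1.2 p.2 := by
  unfold jumpFactor
  exact (by fun_prop : Continuous fun p : (Pos d × Pos d) × Pos d =>
    Real.exp (φm (p.1.1 - p.2) - φp (p.1.2 - p.2))).measurable

theorem exists_jumpFactor_le (hm : Continuous φm) (hms : HasCompactSupport φm)
    (hp : Continuous φp) (hps : HasCompactSupport φp) :
    ∃ R : ℝ, 1 ≤ R ∧ ∀ x y u : Pos d, |jumpFactor φm φp x y u| ≤ R := by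
  obtain ⟨A, hA⟩ := hm.bounded_above_of_compact_support hms
  obtain ⟨B, hB⟩ := hp.bounded_above_of_compact_support hps
  have hA0 : 0 ≤ A := (norm_nonneg _).trans (hA 0)
  have hB0 : 0 ≤ B := (norm_nonneg _).trans (hB 0)
  refine ⟨Real.exp (A + B), Real.one_le_exp (by positivity), fun x y u => ?_⟩
  rw [jumpFactor, abs_of_pos (Real.exp_pos _), Real.exp_le_exp]
  have h1 := (abs_le.1 (hA (x - u))).2
  have h2 := (abs_le.1 (hB (y - u))).1
  linarith

theorem integrable_exp_sub_one {φ : Pos d → ℝ} (hc : Continuous φ) (hs : HasCompactSupport φ) :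
    Integrable fun u => Real.exp (φ u) - 1 := by
  have : HasCompactSupport fun u => Real.exp (φ u) - 1 :=
    hs.comp_left (g := fun t => Real.exp t - 1) (by simp)
  exact (by fun_prop : Continuous fun u => Real.exp (φ u) - 1).integrable_of_hasCompactSupport this

theorem lintegral_mul_sub_one_le {α β : Pos d → ℝ} {M : ℝ} (hα : Measurable α) (hβ : Measurable β)
    (hM : ∀ u, |1 + α u| ≤ M) :
    ∫⁻ u, ‖(1 + α u) * (1 + β u) - 1‖ₑ ≤
      (∫⁻ u, ‖α u‖ₑ) + ENNReal.ofReal M * ∫⁻ u, ‖β u‖ₑ := by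
  rw [← lintegral_const_mul _ hβ.enorm, ← lintegral_add_left hα.enorm]
  refine lintegral_mono fun u => ?_
  rw [show (1 + α u) * (1 + β u) - 1 = α u + (1 + α u) * β u by ring]
  refine (enorm_add_le _ _).trans ?_
  rw [enorm_mul]
  gcongr
  rw [Real.enorm_eq_ofReal_abs]
  exact ENNReal.ofReal_le_ofReal (hM u)

theorem exists_lintegral_jumpFactor_le (hm : Continuous φm) (hms : HasCompactSupport φm)
    (hp : Continuous φp) (hps : HasCompactSupport φp) :
    ∃ I : ℝ≥0∞, I ≠ ∞ ∧ ∀ x y : Pos d, ∫⁻ u, ‖jumpFactor φm φp x y u - 1‖ₑ ≤ I := by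
  obtain ⟨A, hA⟩ := hm.bounded_above_of_compact_support hms
  have i1 := integrable_exp_sub_one hm hms
  have i2 := integrable_exp_sub_one (φ := fun u => -φp u) hp.neg
    (hps.comp_left (g := fun t => -t) (by simp))
  refine ⟨(∫⁻ u, ‖Real.exp (φm u) - 1‖ₑ) + ENNReal.ofReal (Real.exp A) *
    ∫⁻ u, ‖Real.exp (-φp u) - 1‖ₑ, ?_, fun x y => ?_⟩
  · exact ENNReal.add_ne_top.2 ⟨i1.2.ne, ENNReal.mul_ne_top ENNReal.ofReal_ne_top i2.2.ne⟩
  · rw [← lintegral_sub_left_eq_self (fun u => ‖Real.exp (φm u) - 1‖ₑ) x,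
      ← lintegral_sub_left_eq_self (fun u => ‖Real.exp (-φp u) - 1‖ₑ) y]
    refine le_trans (le_of_eq (lintegral_congr fun u => ?_))
      (lintegral_mul_sub_one_le (α := fun u => Real.exp (φm (x - u)) - 1)
      (β := fun u => Real.exp (-φp (y - u)) - 1) (M := Real.exp A) ?_ ?_ fun u => ?_)
    · simp [jumpFactor, sub_eq_add_neg, Real.exp_add]
    · exact (by fun_prop : Continuous _).measurable
    · exact (by fun_prop : Continuous _).measurable
    · rw [add_sub_cancel, abs_of_pos (Real.exp_pos _), Real.exp_le_exp]
      exact (le_abs_self _).trans (hA _)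

theorem lintegral_scaledJump_mul_indicator_lt_top (ham : Measurable a) (ha : Integrable a)
    (hε : 0 < ε) (r : ℝ) :
    ∫⁻ w : Pos d × Pos d, ‖scaledJump a ε (w.1 - w.2)‖ₑ *
      (Metric.closedBall (0 : Pos d) r).indicator 1 w.1 < ∞ := by
  have hK : MeasurableSet (Metric.closedBall (0 : Pos d) r) :=
    Metric.isClosed_closedBall.measurableSet
  have hm := measurable_scaledJump ham ε
  have hmeas : Measurable fun w : Pos d × Pos d => ‖scaledJump a ε (w.1 - w.2)‖ₑ *
      (Metric.closedBall (0 : Pos d) r).indicator (1 : Pos d → ℝ≥0∞) w.1 :=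
    (hm.comp (measurable_fst.sub measurable_snd)).enorm.mul
      ((measurable_one.indicator hK).comp measurable_fst)
  rw [Measure.volume_eq_prod, lintegral_prod _ hmeas.aemeasurable]
  have : ∀ x : Pos d, ∫⁻ y : Pos d, ‖scaledJump a ε (x - y)‖ₑ *
      (Metric.closedBall (0 : Pos d) r).indicator 1 x =
      (∫⁻ y, ‖scaledJump a ε y‖ₑ) * (Metric.closedBall (0 : Pos d) r).indicator 1 x := fun x => by
    have hmx : Measurable fun y : Pos d => ‖scaledJump a ε (x - y)‖ₑ :=
      (hm.comp (measurable_const.sub measurable_id)).enorm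
    rw [lintegral_mul_const _ hmx, lintegral_sub_left_eq_self (fun u => ‖scaledJump a ε u‖ₑ) x]
  simp only [this]
  rw [lintegral_const_mul _ (measurable_one.indicator hK), lintegral_indicator_one hK]
  exact ENNReal.mul_lt_top (integrable_scaledJump ha hε).2 measure_closedBall_lt_top

variable {G : FinConf d → ℝ}

theorem hatOp_kawasakiMinus (ha : Integrable a) (hε : 0 < ε)
    (hm : Continuous φm) (hms : HasCompactSupport φm)
    (hp : Continuous φp) (hps : HasCompactSupport φp) (G : FinConf d → ℝ) (η : FinConf d) :
    hatOp (kawasakiMinus a φm φp ε) G η =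
      -∑ x ∈ η, ∫ y, ∑ ζ ∈ (η.erase x).powerset, scaledJump a ε (x - y) *
        (G (insert x ζ) * (eLambda (jumpFactor φm φp x y) ζ *
          eLambda (fun u => jumpFactor φm φp x y u - 1) (η.erase x \ ζ))) := by
  obtain ⟨R, -, hR⟩ := exists_jumpFactor_le hm hms hp hps
  have hL : ∀ ξ : FinConf d,
      kawasakiMinus a φm φp ε (KTransform G) (Configuration.ofFinset ξ) =
      ∑ x ∈ ξ, -∫ y, scaledJump a ε (x - y) * (eLambda (jumpFactor φm φp x y) (ξ.erase x) *
        ∑ ζ ∈ (ξ.erase x).powerset, G (insert x ζ)) := fun ξ => by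
    refine (Finset.tsum_subtype ξ fun x => ∫ y : Pos d, scaledJump a ε (x - y) *
      rate φm φp x y ((Configuration.ofFinset ξ).erase x) *
      (KTransform G ((Configuration.ofFinset ξ).erase x) -
        KTransform G (Configuration.ofFinset ξ))).trans ?_
    refine Finset.sum_congr rfl fun x hx => ?_
    have h := KTransform_insert_sub G (Finset.notMem_erase x ξ)
    rw [Finset.insert_erase hx] at h
    rw [← integral_neg]
    refine integral_congr_ae (ae_of_all _ fun y => ?_)
    simp only [erase_ofFinset, rate_ofFinset]
    rw [← h]
    ring
  rw [hatOp_of_sum (Q := fun x ζ => -∫ y, scaledJump a ε (x - y) *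
    (eLambda (jumpFactor φm φp x y) ζ * ∑ θ ∈ ζ.powerset, G (insert x θ))) hL,
    ← Finset.sum_neg_distrib]
  refine Finset.sum_congr rfl fun x _ => ?_
  rw [← sum_alternating_integral (wt := fun y => scaledJump a ε (x - y))
    (f := fun y => jumpFactor φm φp x y) (g := fun _ ζ => G (insert x ζ))
    (fun u => (measurable_jumpFactor hm hp).comp
      ((measurable_const.prodMk measurable_id).prodMk measurable_const))
    (fun y u => hR x y u)
    (fun ζ => ((integrable_scaledJump ha hε).comp_sub_left x).mul_const _)]
  simp

theorem hatOp_kawasakiPlus [NeZero d] (ha : Integrable a) (hε : 0 < ε)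
    (hm : Continuous φm) (hms : HasCompactSupport φm)
    (hp : Continuous φp) (hps : HasCompactSupport φp) (hG : IsBbs G) (η : FinConf d) :
    hatOp (kawasakiPlus a φm φp ε) G η =
      ∑ x ∈ η, ∫ y, ∑ ζ ∈ (η.erase x).powerset, scaledJump a ε (x - y) *
        (G (insert y ζ) * (eLambda (jumpFactor φm φp x y) ζ *
          eLambda (fun u => jumpFactor φm φp x y u - 1) (η.erase x \ ζ))) := by
  obtain ⟨R, -, hR⟩ := exists_jumpFactor_le hm hms hp hps
  obtain ⟨M, hM⟩ := hG.bounded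
  have hL : ∀ ξ : FinConf d,
      kawasakiPlus a φm φp ε (KTransform G) (Configuration.ofFinset ξ) =
      ∑ x ∈ ξ, ∫ y, scaledJump a ε (x - y) * (eLambda (jumpFactor φm φp x y) (ξ.erase x) *
        ∑ ζ ∈ (ξ.erase x).powerset, G (insert y ζ)) := fun ξ => by
    refine (Finset.tsum_subtype ξ fun x => ∫ y : Pos d, scaledJump a ε (x - y) *
      rate φm φp x y ((Configuration.ofFinset ξ).erase x) *
      (KTransform G (((Configuration.ofFinset ξ).erase x).insert y) -
        KTransform G ((Configuration.ofFinset ξ).erase x))).trans ?_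
    refine Finset.sum_congr rfl fun x hx => integral_congr_ae ?_
    filter_upwards [(ξ.erase x).finite_toSet.countable.ae_notMem volume] with y hy
    simp only [erase_ofFinset, insert_ofFinset, rate_ofFinset]
    rw [KTransform_insert_sub G (fun h => hy (Finset.mem_coe.2 h))]
    ring
  rw [hatOp_of_sum (Q := fun x ζ => ∫ y, scaledJump a ε (x - y) *
    (eLambda (jumpFactor φm φp x y) ζ * ∑ θ ∈ ζ.powerset, G (insert y θ))) hL]
  refine Finset.sum_congr rfl fun x _ => ?_
  refine sum_alternating_integral (wt := fun y => scaledJump a ε (x - y))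
    (f := fun y => jumpFactor φm φp x y) (g := fun y ζ => G (insert y ζ))
    (fun u => (measurable_jumpFactor hm hp).comp
      ((measurable_const.prodMk measurable_id).prodMk measurable_const))
    (fun y u => hR x y u) (fun ζ => ?_) _
  exact ((integrable_scaledJump ha hε).comp_sub_left x).mul_bdd (c := M)
    (hG.measurable_insert ζ).aestronglyMeasurable (ae_of_all _ fun y => hM _)

theorem hatOp_glauberPlus [NeZero d] (hp : Continuous φp) (hps : HasCompactSupport φp)
    (hG : IsBbs G) (η : FinConf d) :
    hatOp (glauberPlus φp) G η =
      ∫ y, ∑ ζ ∈ η.powerset, 1 * (G (insert y ζ) * (eLambda (jumpFactor 0 φp y y) ζ *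
          eLambda (fun u => jumpFactor 0 φp y y u - 1) (η \ ζ))) := by
  have hm : Continuous (0 : Pos d → ℝ) := continuous_zero
  obtain ⟨R, -, hR⟩ := exists_jumpFactor_le hm HasCompactSupport.zero hp hps
  have hL : ∀ ξ : FinConf d, glauberPlus φp (KTransform G) (Configuration.ofFinset ξ) =
      ∫ y, 1 * (eLambda (jumpFactor 0 φp y y) ξ * ∑ ζ ∈ ξ.powerset, G (insert y ζ)) := fun ξ => by
    refine integral_congr_ae ?_
    filter_upwards [ξ.finite_toSet.countable.ae_notMem volume] with y hy
    rw [insert_ofFinset, KTransform_insert_sub G (fun h => hy (Finset.mem_coe.2 h)),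
      ← rate_ofFinset]
    simp [rate, energy]
  unfold hatOp KInverse
  simp only [hL]
  refine sum_alternating_integral (wt := fun _ => 1)
    (f := fun y => jumpFactor 0 φp y y) (g := fun y ζ => G (insert y ζ))
    (fun u => (measurable_jumpFactor hm hp).comp
      ((measurable_id.prodMk measurable_id).prodMk measurable_const))
    (fun y u => hR y y u) (fun ζ => ?_) _
  simpa using hG.integrable_insert ζ

end

/-! ### The dual operators -/

theorem Finset.union_sdiff_union_singleton {α : Type*} [DecidableEq α] {η ζ : Finset α} {x : α}
    (hx : x ∈ η) (hζ : ζ ⊆ η.erase x) : ζ ∪ η.erase x \ ζ ∪ {x} = η := by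
  rw [Finset.union_sdiff_of_subset hζ, Finset.union_comm, ← Finset.insert_eq,
    Finset.insert_erase hx]

theorem Finset.erase_union_union_singleton {α : Type*} [DecidableEq α] (η ξ : Finset α) (x y : α) :
    η.erase x ∪ ξ ∪ {y} = insert y (ξ ∪ η.erase x) := by
  rw [Finset.union_comm, ← Finset.insert_eq, Finset.union_comm ξ]

theorem Finset.erase_union_union_self {α : Type*} [DecidableEq α] {η : Finset α} (ξ : Finset α)
    {x : α} (hx : x ∈ η) : η.erase x ∪ ξ ∪ {x} = ξ ∪ η := by
  rw [Finset.erase_union_union_singleton, ← Finset.union_insert, Finset.insert_erase hx]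

section

variable {d : ℕ} {a φm φp : Pos d → ℝ} {ε s C : ℝ} {k : FinConf d → ℝ}

theorem FinConf.measurable_singleton : Measurable fun x : Pos d => ({x} : FinConf d) := by
  have := FinConf.measurable_insert.comp
    ((measurable_id (α := Pos d)).prodMk (measurable_const (a := (∅ : FinConf d))))
  simpa [Function.comp_def] using this

theorem FinConf.measurable_eLambda_left {Y : Type*} [MeasurableSpace Y] {f : Y → Pos d → ℝ}
    (hf : ∀ u, Measurable fun y => f y u) (η : FinConf d) : Measurable fun y => eLambda (f y) η :=
  Finset.measurable_fun_prod _ fun u _ => hf u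

theorem isDualValue_kawasakiMinus [NeZero d] (hs0 : 0 ≤ s) (hs1 : s < 1) (ham : Measurable a)
    (ha : Integrable a) (hε : 0 < ε) (hm : Continuous φm) (hms : HasCompactSupport φm)
    (hp : Continuous φp) (hps : HasCompactSupport φp) (hk : Measurable k) (hk0 : ∀ η, 0 ≤ k η)
    (hkb : ∀ η, k η ≤ growthBound s C η.card) :
    IsDualValue (kawasakiMinus a φm φp ε) k (dualKawasakiMinus a φm φp ε k) := by
  intro G hG
  obtain ⟨R, hR1, hR⟩ := exists_jumpFactor_le hm hms hp hps
  obtain ⟨I, hI, hfI⟩ := exists_lintegral_jumpFactor_le hm hms hp hps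
  have hwt : Measurable fun w : Pos d × Pos d => scaledJump a ε (w.1 - w.2) :=
    (measurable_scaledJump ham ε).comp (measurable_fst.sub measurable_snd)
  have hB : Measurable fun w : Pos d × Pos d => ({w.1} : FinConf d) :=
    FinConf.measurable_singleton.comp measurable_fst
  let Ψ := dualKernel (W := Pos d × Pos d) (fun w => scaledJump a ε (w.1 - w.2)) Prod.fst
    (fun w => {w.1}) (fun w => jumpFactor φm φp w.1 w.2) k G
  have hΨ : Measurable Ψ :=
    measurable_dualKernel hwt measurable_fst hB (measurable_jumpFactor hm hp) hk hG.measurable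
  have hi : Integrable Ψ (((volume : Measure (Pos d)).prod volume).prod
      ((lebesguePoisson d).prod (lebesguePoisson d))) :=
    integrable_dualKernel hs0 hs1 hwt measurable_fst hB (measurable_jumpFactor hm hp) hk hG
      (lintegral_scaledJump_mul_indicator_lt_top ham ha hε) (fun w => by simp) hR1
      (fun w u => hR _ _ _) hI (fun w => hfI _ _) hk0 hkb
  obtain ⟨⟨h1, h2⟩, h3, h4⟩ := FinConf.integral_kernel_erase hΨ hi
  have e1 : (fun η => hatOp (kawasakiMinus a φm φp ε) G η * k η) = fun η =>
      -∑ x ∈ η, ∫ y, ∑ ζ ∈ (η.erase x).powerset, Ψ ((x, y), ζ, η.erase x \ ζ) := by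
    funext η
    rw [hatOp_kawasakiMinus ha hε hm hms hp hps, neg_mul, Finset.sum_mul]
    congr 1
    refine Finset.sum_congr rfl fun x hx => ?_
    rw [← integral_mul_const]
    refine integral_congr_ae (ae_of_all _ fun y => ?_)
    simp only [Finset.sum_mul]
    refine Finset.sum_congr rfl fun ζ hζ => ?_
    have : ζ ∪ η.erase x \ ζ ∪ {x} = η :=
      Finset.union_sdiff_union_singleton hx (Finset.mem_powerset.1 hζ)
    simp only [Ψ, dualKernel, this]
  have e2 : (fun η => G η * dualKawasakiMinus a φm φp ε k η) = fun η =>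
      -∑ x ∈ η, ∫ y, ∫ ξ, Ψ ((x, y), η.erase x, ξ) ∂(lebesguePoisson d) := by
    funext η
    rw [dualKawasakiMinus, mul_neg, Finset.mul_sum]
    congr 1
    refine Finset.sum_congr rfl fun x hx => ?_
    rw [← integral_const_mul]
    refine integral_congr_ae (ae_of_all _ fun y => ?_)
    simp only [← integral_const_mul]
    refine integral_congr_ae (ae_of_all _ fun ξ => ?_)
    have : η.erase x ∪ ξ ∪ {x} = ξ ∪ η := Finset.erase_union_union_self ξ hx
    simp only [Ψ, dualKernel, this, Finset.insert_erase hx, dualKawasakiMinusIntegrand,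
      rate_ofFinset]
    simp only [jumpFactor]
    ring
  rw [e1, e2, integral_neg, integral_neg, h2, h4]
  exact ⟨h1.neg, h3.neg, rfl⟩

theorem isDualValue_kawasakiPlus [NeZero d] (hs0 : 0 ≤ s) (hs1 : s < 1) (ham : Measurable a)
    (hae : Function.Even a) (ha : Integrable a) (hε : 0 < ε) (hm : Continuous φm)
    (hms : HasCompactSupport φm) (hp : Continuous φp) (hps : HasCompactSupport φp)
    (hk : Measurable k) (hk0 : ∀ η, 0 ≤ k η) (hkb : ∀ η, k η ≤ growthBound s C η.card) :
    IsDualValue (kawasakiPlus a φm φp ε) k (dualKawasakiPlus a φm φp ε k) := by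
  intro G hG
  obtain ⟨R, hR1, hR⟩ := exists_jumpFactor_le hm hms hp hps
  obtain ⟨I, hI, hfI⟩ := exists_lintegral_jumpFactor_le hm hms hp hps
  have hwt : Measurable fun w : Pos d × Pos d => scaledJump a ε (w.1 - w.2) :=
    (measurable_scaledJump ham ε).comp (measurable_fst.sub measurable_snd)
  have hB : Measurable fun w : Pos d × Pos d => ({w.2} : FinConf d) :=
    FinConf.measurable_singleton.comp measurable_snd
  have hf : Measurable fun p : (Pos d × Pos d) × Pos d => jumpFactor φm φp p.1.2 p.1.1 p.2 :=
    (measurable_jumpFactor hm hp).comp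
      ((measurable_swap.comp measurable_fst).prodMk measurable_snd)
  let Ψ := dualKernel (W := Pos d × Pos d) (fun w => scaledJump a ε (w.1 - w.2)) Prod.fst
    (fun w => {w.2}) (fun w => jumpFactor φm φp w.2 w.1) k G
  have hΨ : Measurable Ψ := measurable_dualKernel hwt measurable_fst hB hf hk hG.measurable
  have hi : Integrable Ψ (((volume : Measure (Pos d)).prod volume).prod
      ((lebesguePoisson d).prod (lebesguePoisson d))) :=
    integrable_dualKernel hs0 hs1 hwt measurable_fst hB hf hk hG
      (lintegral_scaledJump_mul_indicator_lt_top ham ha hε) (fun w => by simp) hR1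
      (fun w u => hR _ _ _) hI (fun w => hfI _ _) hk0 hkb
  have hsw : MeasurePreserving (Prod.map Prod.swap id :
      (Pos d × Pos d) × FinConf d × FinConf d → (Pos d × Pos d) × FinConf d × FinConf d)
      (((volume : Measure (Pos d)).prod volume).prod
        ((lebesguePoisson d).prod (lebesguePoisson d)))
      (((volume : Measure (Pos d)).prod volume).prod
        ((lebesguePoisson d).prod (lebesguePoisson d))) :=
    Measure.measurePreserving_swap.prod (MeasurePreserving.id _)
  obtain ⟨-, h3, h4⟩ := FinConf.integral_kernel_erase hΨ hi
  obtain ⟨⟨h1, h2⟩, -⟩ := FinConf.integral_kernel_erase (hΨ.comp hsw.measurable)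
    (hsw.integrable_comp_of_integrable hi)
  have e1 : (fun η => hatOp (kawasakiPlus a φm φp ε) G η * k η) = fun η =>
      ∑ x ∈ η, ∫ y, ∑ ζ ∈ (η.erase x).powerset,
        (Ψ ∘ Prod.map Prod.swap id) ((x, y), ζ, η.erase x \ ζ) := by
    funext η
    rw [hatOp_kawasakiPlus ha hε hm hms hp hps hG, Finset.sum_mul]
    refine Finset.sum_congr rfl fun x hx => ?_
    rw [← integral_mul_const]
    refine integral_congr_ae (ae_of_all _ fun y => ?_)
    simp only [Finset.sum_mul]
    refine Finset.sum_congr rfl fun ζ hζ => ?_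
    have : ζ ∪ η.erase x \ ζ ∪ {x} = η :=
      Finset.union_sdiff_union_singleton hx (Finset.mem_powerset.1 hζ)
    simp only [Ψ, dualKernel, Function.comp_apply, Prod.map_apply, Prod.swap_prod_mk, id, this,
      scaledJump_sub_comm hae ε x y]
  have e2 : (fun η => G η * dualKawasakiPlus a φm φp ε k η) = fun η =>
      ∑ x ∈ η, ∫ y, ∫ ξ, Ψ ((x, y), η.erase x, ξ) ∂(lebesguePoisson d) := by
    funext η
    rw [dualKawasakiPlus, Finset.mul_sum]
    refine Finset.sum_congr rfl fun x hx => ?_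
    rw [← integral_const_mul]
    refine integral_congr_ae (ae_of_all _ fun y => ?_)
    simp only [← integral_const_mul]
    refine integral_congr_ae (ae_of_all _ fun ξ => ?_)
    have : η.erase x ∪ ξ ∪ {y} = insert y (ξ ∪ η.erase x) :=
      Finset.erase_union_union_singleton _ _ _ _
    simp only [Ψ, dualKernel, this, Finset.insert_erase hx, dualKawasakiPlusIntegrand,
      rate_ofFinset, scaledJump_sub_comm hae ε x y]
    simp only [jumpFactor]
    ring
  rw [e1, e2, h2, h4]
  exact ⟨h1, h3, FinConf.integral_comp_of_measurePreserving hsw hΨ⟩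

theorem isDualValue_glauberPlus [NeZero d] (hs0 : 0 ≤ s) (hs1 : s < 1)
    (hp : Continuous φp) (hps : HasCompactSupport φp)
    (hk : Measurable k) (hk0 : ∀ η, 0 ≤ k η) (hkb : ∀ η, k η ≤ growthBound s C η.card) :
    IsDualValue (glauberPlus φp) k (dualGlauberPlus φp k) := by
  intro G hG
  have hm : Continuous (0 : Pos d → ℝ) := continuous_zero
  have hms : HasCompactSupport (0 : Pos d → ℝ) := HasCompactSupport.zero
  obtain ⟨R, hR1, hR⟩ := exists_jumpFactor_le hm hms hp hps
  obtain ⟨I, hI, hfI⟩ := exists_lintegral_jumpFactor_le hm hms hp hps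
  have hf : Measurable fun p : Pos d × Pos d => jumpFactor 0 φp p.1 p.1 p.2 :=
    (measurable_jumpFactor hm hp).comp
      ((measurable_fst.prodMk measurable_fst).prodMk measurable_snd)
  let Ψ := dualKernel (W := Pos d) (fun _ => 1) id (fun _ => ∅)
    (fun w => jumpFactor 0 φp w w) k G
  have hΨ : Measurable Ψ :=
    measurable_dualKernel measurable_const measurable_id measurable_const hf hk hG.measurable
  have hi : Integrable Ψ ((volume : Measure (Pos d)).prod
      ((lebesguePoisson d).prod (lebesguePoisson d))) :=
    integrable_dualKernel hs0 hs1 measurable_const measurable_id measurable_const hf hk hG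
      (fun r => by
        have hK : MeasurableSet (Metric.closedBall (0 : Pos d) r) :=
          Metric.isClosed_closedBall.measurableSet
        simp only [enorm_one, one_mul, id]
        rw [lintegral_indicator_one hK]
        exact measure_closedBall_lt_top) (fun w => by simp) hR1
      (fun w u => hR _ _ _) hI (fun w => hfI _ _) hk0 hkb
  obtain ⟨⟨h1, h2⟩, h3, h4⟩ := FinConf.integral_kernel hΨ hi
  have e1 : (fun η => hatOp (glauberPlus φp) G η * k η) = fun η =>
      ∫ y, ∑ ζ ∈ η.powerset, Ψ (y, ζ, η \ ζ) := by
    funext η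
    rw [hatOp_glauberPlus hp hps hG, ← integral_mul_const]
    refine integral_congr_ae (ae_of_all _ fun y => ?_)
    simp only [Finset.sum_mul]
    refine Finset.sum_congr rfl fun ζ hζ => ?_
    simp only [Ψ, dualKernel, Finset.union_empty,
      Finset.union_sdiff_of_subset (Finset.mem_powerset.1 hζ), id]
  have e2 : (fun η => G η * dualGlauberPlus φp k η) = fun η =>
      ∑ x ∈ η, ∫ ξ, Ψ (x, η.erase x, ξ) ∂(lebesguePoisson d) := by
    funext η
    rw [dualGlauberPlus, Finset.mul_sum]
    refine Finset.sum_congr rfl fun x hx => ?_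
    rw [← integral_const_mul]
    refine integral_congr_ae (ae_of_all _ fun ξ => ?_)
    simp only [Ψ, dualKernel, Finset.union_empty, Finset.insert_erase hx, id,
      dualGlauberPlusIntegrand, ← rate_ofFinset]
    simp only [jumpFactor, rate, energy, Pi.zero_apply, tsum_zero, zero_sub]
    ring
  rw [e1, e2, h2, h4]
  exact ⟨h1, h3, rfl⟩

/-! ### The death part of the Glauber generator as a special case -/

theorem integral_scaledJump_one_sub (ha1 : ∫ x, a x = 1) (x : Pos d) :
    ∫ y, scaledJump a 1 (x - y) = 1 := by
  rw [integral_sub_left_eq_self (scaledJump a 1) volume x]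
  simpa [scaledJump] using ha1

theorem rate_zero_right (φm : Pos d → ℝ) (x y : Pos d) (γ : Configuration d) :
    rate φm 0 x y γ = Real.exp (energy φm x γ) := by
  simp [rate, energy]

theorem kawasakiMinus_zero_one (ha1 : ∫ x, a x = 1) (φm : Pos d → ℝ) :
    kawasakiMinus a φm 0 1 = glauberMinus φm := by
  funext F γ
  refine tsum_congr fun x => ?_
  simp only [rate_zero_right, mul_assoc]
  rw [integral_mul_const, integral_scaledJump_one_sub ha1, one_mul]

theorem dualKawasakiMinus_zero_one (ha1 : ∫ x, a x = 1) (φm : Pos d → ℝ) (k : FinConf d → ℝ) :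
    dualKawasakiMinus a φm 0 1 k = dualGlauberMinus φm k := by
  funext η
  unfold dualKawasakiMinus dualGlauberMinus
  congr 1
  refine Finset.sum_congr rfl fun x _ => ?_
  simp only [dualKawasakiMinusIntegrand, rate_zero_right, mul_assoc, integral_const_mul]
  simp only [Pi.zero_apply, sub_zero]
  rw [integral_mul_const, integral_scaledJump_one_sub ha1, one_mul, ← integral_const_mul]
  refine integral_congr_ae (ae_of_all _ fun ξ => ?_)
  simp only [dualGlauberMinusIntegrand, Finset.union_comm]
  ring

theorem isDualValue_glauberMinus [NeZero d] (hs0 : 0 ≤ s) (hs1 : s < 1) (ham : Measurable a)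
    (ha : Integrable a) (ha1 : ∫ x, a x = 1) (hm : Continuous φm) (hms : HasCompactSupport φm)
    (hk : Measurable k) (hk0 : ∀ η, 0 ≤ k η) (hkb : ∀ η, k η ≤ growthBound s C η.card) :
    IsDualValue (glauberMinus φm) k (dualGlauberMinus φm k) := by
  rw [← kawasakiMinus_zero_one ha1, ← dualKawasakiMinus_zero_one ha1]
  exact isDualValue_kawasakiMinus hs0 hs1 ham ha one_pos hm hms continuous_zero
    HasCompactSupport.zero hk hk0 hkb

/-! ### Absolute convergence -/

theorem integrable_mul_eLambda [NeZero d] (hs0 : 0 ≤ s) (hs1 : s < 1) {f : Pos d → ℝ}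
    (hf : Measurable f) (hfi : ∫⁻ u, ‖f u‖ₑ ≠ ∞) {N : ℕ} {K : FinConf d → ℝ} (hK : Measurable K)
    (hKb : ∀ ξ, |K ξ| ≤ growthBound s C (ξ.card + N)) :
    Integrable (fun ξ => K ξ * eLambda f ξ) (lebesguePoisson d) := by
  refine ⟨(hK.mul (FinConf.measurable_eLambda_right hf)).aestronglyMeasurable, ?_⟩
  refine (lintegral_mono fun ξ => ?_).trans_lt
    ((FinConf.lintegral_eLambda_mul_growthBound_le s C N hf le_rfl).trans_lt
      (expBound_lt_top hs0 hs1 C N hfi))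
  rw [enorm_mul, mul_comm]
  gcongr
  rw [Real.enorm_eq_ofReal_abs]
  exact ENNReal.ofReal_le_ofReal (hKb ξ)

theorem norm_integral_mul_eLambda_le [NeZero d] (hs0 : 0 ≤ s) (hs1 : s < 1) {f : Pos d → ℝ}
    (hf : Measurable f) {I : ℝ≥0∞} (hI : I ≠ ∞) (hfi : ∫⁻ u, ‖f u‖ₑ ≤ I) {N : ℕ}
    {K : FinConf d → ℝ} (hKb : ∀ ξ, |K ξ| ≤ growthBound s C (ξ.card + N)) :
    ‖∫ ξ, K ξ * eLambda f ξ ∂(lebesguePoisson d)‖ ≤ (expBound s C N I).toReal := by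
  refine (norm_integral_le_lintegral_norm _).trans
    (ENNReal.toReal_mono (expBound_lt_top hs0 hs1 C N hI).ne ?_)
  refine (lintegral_mono fun ξ => ?_).trans
    (FinConf.lintegral_eLambda_mul_growthBound_le s C N hf hfi)
  rw [norm_mul, ENNReal.ofReal_mul (norm_nonneg _), mul_comm, ofReal_norm]
  gcongr
  exact hKb ξ

theorem integrable_prod_mul_eLambda [NeZero d] {W : Type*} [MeasurableSpace W] {ν : Measure W}
    (hs0 : 0 ≤ s) (hs1 : s < 1) {b c : W → ℝ} (hbm : Measurable b)
    (hb : Integrable b ν) (hc : Measurable c) {M : ℝ} (hM : ∀ w, |c w| ≤ M) {f : W → Pos d → ℝ}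
    (hf : Measurable fun p : W × Pos d => f p.1 p.2) {I : ℝ≥0∞} (hI : I ≠ ∞)
    (hfi : ∀ w, ∫⁻ u, ‖f w u‖ₑ ≤ I) {N : ℕ} {K : W × FinConf d → ℝ} (hK : Measurable K)
    (hKb : ∀ w ξ, |K (w, ξ)| ≤ growthBound s C (ξ.card + N)) :
    Integrable (fun p : W × FinConf d => b p.1 * c p.1 * (K p * eLambda (f p.1) p.2))
      (ν.prod (lebesguePoisson d)) := by
  have hm : Measurable fun p : W × FinConf d => b p.1 * c p.1 * (K p * eLambda (f p.1) p.2) :=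
    ((hbm.comp measurable_fst).mul (hc.comp measurable_fst)).mul
      (hK.mul (FinConf.measurable_eLambda hf))
  refine ⟨hm.aestronglyMeasurable, ?_⟩
  change ∫⁻ p, ‖b p.1 * c p.1 * (K p * eLambda (f p.1) p.2)‖ₑ ∂(ν.prod (lebesguePoisson d)) < ∞
  rw [lintegral_prod _ hm.enorm.aemeasurable]
  have h1 : ∀ w, ∫⁻ ξ, ‖b w * c w * (K (w, ξ) * eLambda (f w) ξ)‖ₑ ∂(lebesguePoisson d) ≤
      ‖b w‖ₑ * (ENNReal.ofReal M * expBound s C N I) := fun w => by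
    simp only [enorm_mul, mul_assoc]
    rw [lintegral_const_mul' _ _ enorm_ne_top, lintegral_const_mul' _ _ enorm_ne_top]
    refine mul_le_mul_right (mul_le_mul' ?_ ?_) _
    · rw [Real.enorm_eq_ofReal_abs]
      exact ENNReal.ofReal_le_ofReal (hM w)
    · refine (lintegral_mono fun ξ => ?_).trans
        (FinConf.lintegral_eLambda_mul_growthBound_le s C N (f := f w)
          (hf.comp (measurable_const.prodMk measurable_id)) (hfi w))
      rw [mul_comm]
      gcongr
      rw [Real.enorm_eq_ofReal_abs]
      exact ENNReal.ofReal_le_ofReal (hKb w ξ)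
  refine (lintegral_mono h1).trans_lt ?_
  rw [lintegral_mul_const _ hbm.enorm]
  exact ENNReal.mul_lt_top hb.2
    (ENNReal.mul_lt_top ENNReal.ofReal_lt_top (expBound_lt_top hs0 hs1 C N hI))

theorem abs_le_growthBound (hs0 : 0 ≤ s) (hk0 : ∀ η, 0 ≤ k η)
    (hkb : ∀ η, k η ≤ growthBound s C η.card) {η : FinConf d} {n : ℕ} (h : η.card ≤ n) :
    |k η| ≤ growthBound s C n := by
  rw [abs_of_nonneg (hk0 η)]
  exact (hkb η).trans (growthBound_mono hs0 C h)

theorem integrable_dualKawasakiMinusIntegrand [NeZero d] (hs0 : 0 ≤ s) (hs1 : s < 1)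
    (ham : Measurable a) (ha : Integrable a) (hε : 0 < ε) (hm : Continuous φm)
    (hms : HasCompactSupport φm) (hp : Continuous φp) (hps : HasCompactSupport φp)
    (hk : Measurable k) (hk0 : ∀ η, 0 ≤ k η) (hkb : ∀ η, k η ≤ growthBound s C η.card)
    (η : FinConf d) (x : Pos d) :
    Integrable (fun p : Pos d × FinConf d => dualKawasakiMinusIntegrand a φm φp ε k η x p.1 p.2)
      ((volume : Measure (Pos d)).prod (lebesguePoisson d)) := by
  obtain ⟨R, hR1, hR⟩ := exists_jumpFactor_le hm hms hp hps
  obtain ⟨I, hI, hfI⟩ := exists_lintegral_jumpFactor_le hm hms hp hps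
  have hj : Measurable fun p : Pos d × Pos d => jumpFactor φm φp x p.1 p.2 :=
    (measurable_jumpFactor hm hp).comp
      ((measurable_const.prodMk measurable_fst).prodMk measurable_snd)
  have hb : Measurable fun y => scaledJump a ε (x - y) :=
    (measurable_scaledJump ham ε).comp (measurable_const.sub measurable_id)
  have hc : Measurable fun y => eLambda (jumpFactor φm φp x y) (η.erase x) :=
    FinConf.measurable_eLambda_left (fun u => hj.comp (measurable_id.prodMk measurable_const)) _
  have hK : Measurable fun p : Pos d × FinConf d => k (p.2 ∪ η) :=
    hk.comp (FinConf.measurable_union.comp (measurable_snd.prodMk measurable_const))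
  have hKb : ∀ (y : Pos d) (ξ : FinConf d), |k (ξ ∪ η)| ≤ growthBound s C (ξ.card + η.card) :=
    fun y ξ => abs_le_growthBound hs0 hk0 hkb (Finset.card_union_le _ _)
  have hcb : ∀ y, |eLambda (jumpFactor φm φp x y) (η.erase x)| ≤ R ^ (η.erase x).card :=
    fun y => FinConf.abs_eLambda_le (hR x y) _
  have := integrable_prod_mul_eLambda hs0 hs1 hb
    ((integrable_scaledJump ha hε).comp_sub_left x) hc hcb (hj.sub_const 1) hI (hfI x) hK hKb
  refine this.congr (ae_of_all _ fun p => ?_)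
  simp only [dualKawasakiMinusIntegrand, rate_ofFinset]
  simp only [jumpFactor]

theorem integrable_dualKawasakiPlusIntegrand [NeZero d] (hs0 : 0 ≤ s) (hs1 : s < 1)
    (ham : Measurable a) (ha : Integrable a) (hε : 0 < ε) (hm : Continuous φm)
    (hms : HasCompactSupport φm) (hp : Continuous φp) (hps : HasCompactSupport φp)
    (hk : Measurable k) (hk0 : ∀ η, 0 ≤ k η) (hkb : ∀ η, k η ≤ growthBound s C η.card)
    (η : FinConf d) (y : Pos d) :
    Integrable (fun p : Pos d × FinConf d => dualKawasakiPlusIntegrand a φm φp ε k η y p.1 p.2)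
      ((volume : Measure (Pos d)).prod (lebesguePoisson d)) := by
  obtain ⟨R, hR1, hR⟩ := exists_jumpFactor_le hm hms hp hps
  obtain ⟨I, hI, hfI⟩ := exists_lintegral_jumpFactor_le hm hms hp hps
  have hj : Measurable fun p : Pos d × Pos d => jumpFactor φm φp p.1 y p.2 :=
    (measurable_jumpFactor hm hp).comp
      ((measurable_fst.prodMk measurable_const).prodMk measurable_snd)
  have hb : Measurable fun x => scaledJump a ε (x - y) :=
    (measurable_scaledJump ham ε).comp (measurable_id.sub measurable_const)
  have hc : Measurable fun x => eLambda (jumpFactor φm φp x y) (η.erase y) :=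
    FinConf.measurable_eLambda_left (fun u => hj.comp (measurable_id.prodMk measurable_const)) _
  have hK : Measurable fun p : Pos d × FinConf d => k (insert p.1 (p.2 ∪ η.erase y)) :=
    hk.comp (FinConf.measurable_insert.comp (measurable_fst.prodMk
      (FinConf.measurable_union.comp (measurable_snd.prodMk measurable_const))))
  have hKb : ∀ (x : Pos d) (ξ : FinConf d),
      |k (insert x (ξ ∪ η.erase y))| ≤ growthBound s C (ξ.card + ((η.erase y).card + 1)) :=
    fun x ξ => abs_le_growthBound hs0 hk0 hkb ((Finset.card_insert_le _ _).trans
      (Nat.succ_le_succ (Finset.card_union_le _ _)))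
  have hcb : ∀ x, |eLambda (jumpFactor φm φp x y) (η.erase y)| ≤ R ^ (η.erase y).card :=
    fun x => FinConf.abs_eLambda_le (hR x y) _
  have := integrable_prod_mul_eLambda hs0 hs1 hb
    ((integrable_scaledJump ha hε).comp_sub_right y) hc hcb (hj.sub_const 1) hI
    (fun x => hfI x y) hK hKb
  refine this.congr (ae_of_all _ fun p => ?_)
  simp only [dualKawasakiPlusIntegrand, rate_ofFinset]
  simp only [jumpFactor]

theorem integrable_dualGlauberMinusIntegrand [NeZero d] (hs0 : 0 ≤ s) (hs1 : s < 1)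
    (hm : Continuous φm) (hms : HasCompactSupport φm) (hk : Measurable k) (hk0 : ∀ η, 0 ≤ k η)
    (hkb : ∀ η, k η ≤ growthBound s C η.card) (η : FinConf d) (x : Pos d) :
    Integrable (dualGlauberMinusIntegrand φm k η x) (lebesguePoisson d) := by
  have hf : Continuous fun u => Real.exp (φm (x - u)) - 1 := by fun_prop
  have := integrable_mul_eLambda (C := C) (N := η.card) hs0 hs1 hf.measurable
    ((integrable_exp_sub_one hm hms).comp_sub_left x).2.ne (K := fun ξ => k (η ∪ ξ))
    (hk.comp (FinConf.measurable_union.comp (measurable_const.prodMk measurable_id)))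
    (fun ξ => abs_le_growthBound hs0 hk0 hkb
      ((Finset.card_union_le _ _).trans (Nat.add_comm _ _).le))
  refine (this.const_mul (Real.exp (energy φm x (Configuration.ofFinset (η.erase x))))).congr
    (ae_of_all _ fun ξ => ?_)
  simp only [dualGlauberMinusIntegrand]
  ring

theorem integrable_dualGlauberPlusIntegrand [NeZero d] (hs0 : 0 ≤ s) (hs1 : s < 1)
    (hp : Continuous φp) (hps : HasCompactSupport φp) (hk : Measurable k) (hk0 : ∀ η, 0 ≤ k η)
    (hkb : ∀ η, k η ≤ growthBound s C η.card) (η : FinConf d) (y : Pos d) :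
    Integrable (dualGlauberPlusIntegrand φp k η y) (lebesguePoisson d) := by
  have := integrable_dualGlauberMinusIntegrand (C := C) hs0 hs1 (φm := fun u => -φp u) hp.neg
    (hps.comp_left (g := fun t => -t) (by simp)) hk hk0 hkb (η.erase y) y
  refine ((this.const_mul (Real.exp (-energy (fun u => -φp u) y
    (Configuration.ofFinset ((η.erase y).erase y))))).const_mul
      (Real.exp (-energy φp y (Configuration.ofFinset (η.erase y))))).congr
    (ae_of_all _ fun ξ => ?_)
  simp only [dualGlauberMinusIntegrand, dualGlauberPlusIntegrand]
  rw [← mul_assoc (Real.exp (-energy (fun u => -φp u) y _)), ← Real.exp_add, neg_add_cancel,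
    Real.exp_zero, one_mul]

theorem integrable_cMinusIntegrand [NeZero d] (hs0 : 0 ≤ s) (hs1 : s < 1)
    (hp : Continuous φp) (hps : HasCompactSupport φp) (hk : Measurable k) (hk0 : ∀ η, 0 ≤ k η)
    (hkb : ∀ η, k η ≤ growthBound s C η.card) :
    Integrable (cMinusIntegrand φp k) (lebesguePoisson d) := by
  have hf : Continuous fun u => Real.exp (-φp u) - 1 := by fun_prop
  have := integrable_mul_eLambda (C := C) (N := 0) hs0 hs1 hf.measurable
    (integrable_exp_sub_one (φ := fun u => -φp u) hp.neg
      (hps.comp_left (g := fun t => -t) (by simp))).2.ne (K := k) hk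
    (fun ξ => abs_le_growthBound hs0 hk0 hkb le_rfl)
  exact this.congr (ae_of_all _ fun ξ => mul_comm _ _)

theorem integrable_cPlusIntegrand [NeZero d] (hs0 : 0 ≤ s) (hs1 : s < 1)
    (hm : Continuous φm) (hms : HasCompactSupport φm) (hk : Measurable k) (hk0 : ∀ η, 0 ≤ k η)
    (hkb : ∀ η, k η ≤ growthBound s C η.card) :
    Integrable (cPlusIntegrand φm k) (lebesguePoisson d) := by
  have hf : Continuous fun u => Real.exp (φm u) - 1 := by fun_prop
  have := integrable_mul_eLambda (C := C) (N := 1) hs0 hs1 hf.measurable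
    (integrable_exp_sub_one hm hms).2.ne (K := fun ξ => k (insert 0 ξ))
    (hk.comp (FinConf.measurable_insert.comp (measurable_const.prodMk measurable_id)))
    (fun ξ => abs_le_growthBound hs0 hk0 hkb (Finset.card_insert_le _ _))
  exact this.congr (ae_of_all _ fun ξ => mul_comm _ _)

end

/-! ### Asymptotic factorization -/

theorem Finpartition.parts_avoid_of_mem {α : Type*} [DecidableEq α] {η T : Finset α}
    (π : Finpartition η) (hT : T ∈ π.parts) : (π.avoid T).parts = π.parts.erase T := by
  ext c
  rw [Finpartition.mem_avoid, Finset.mem_erase]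
  have key : ∀ D ∈ π.parts, D ≠ T → ¬ D ≤ T ∧ D \ T = D := fun D hD hne => by
    have hd : Disjoint D T := π.disjoint hD hT hne
    exact ⟨fun h => π.ne_bot hD (hd.eq_bot_of_le h), hd.sdiff_eq_left⟩
  constructor
  · rintro ⟨D, hD, hle, rfl⟩
    have hne : D ≠ T := fun h => hle h.le
    rw [(key D hD hne).2]
    exact ⟨hne, hD⟩
  · rintro ⟨hne, hc⟩
    exact ⟨c, hc, (key c hc hne).1, (key c hc hne).2⟩

theorem Finset.sum_powerset_union {α M : Type*} [DecidableEq α] [AddCommMonoid M]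
    {A B : Finset α} (h : Disjoint A B) (F : Finset α → M) :
    ∑ U ∈ (A ∪ B).powerset, F U = ∑ S ∈ A.powerset, ∑ T ∈ B.powerset, F (S ∪ T) := by
  rw [← Finset.sum_product']
  refine (Finset.sum_bij' (fun p _ => p.1 ∪ p.2) (fun U _ => (U ∩ A, U ∩ B)) ?_ ?_ ?_ ?_ ?_).symm
  · rintro ⟨S, T⟩ hp
    simp only [Finset.mem_product, Finset.mem_powerset] at hp ⊢
    exact Finset.union_subset_union hp.1 hp.2
  · intro U hU
    simp
  · rintro ⟨S, T⟩ hp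
    simp only [Finset.mem_product, Finset.mem_powerset] at hp ⊢
    have h' := Finset.disjoint_left.1 h
    refine Prod.ext ?_ ?_
    · ext x
      have h1 := @hp.1 x
      have h2 := @hp.2 x
      have h3 := @h' x
      simp only [Finset.mem_inter, Finset.mem_union]
      tauto
    · ext x
      have h1 := @hp.1 x
      have h2 := @hp.2 x
      have h3 := @h' x
      simp only [Finset.mem_inter, Finset.mem_union]
      tauto
  · intro U hU
    simp only [Finset.mem_powerset] at hU ⊢
    rw [← Finset.inter_union_distrib_left, Finset.inter_eq_left.2 hU]
  · intros; rfl

section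

variable {d : ℕ} {k : FinConf d → ℝ}

theorem ursell_sum_part (k : FinConf d → ℝ) (hk : k ∅ = 1) {η T : FinConf d} {a : Pos d}
    (haT : a ∈ T) (hT : T ⊆ η) :
    ∑ π : Finpartition η with π.part a = T, ∏ B ∈ π.parts, ursell k B =
      ursell k T * k (η \ T) := by
  have hne : T ≠ ⊥ := Finset.nonempty_iff_ne_empty.1 ⟨a, haT⟩
  have hdisj : Disjoint (η \ T) T := Finset.sdiff_disjoint
  have hsup : (η \ T) ⊔ T = η := Finset.sdiff_union_of_subset hT
  have hnot : ∀ σ : Finpartition (η \ T), T ∉ σ.parts := fun σ h =>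
    (Finset.mem_sdiff.1 (σ.le h haT)).2 haT
  rw [ursell_sum k hk (η \ T), Finset.mul_sum]
  refine (Finset.sum_bij (fun σ _ => σ.extend hne hdisj hsup) (fun σ _ => ?_)
    (fun σ _ τ _ h => ?_) (fun π hπ => ?_) fun σ _ => ?_).symm
  · rw [Finset.mem_filter]
    refine ⟨Finset.mem_univ _, Finpartition.part_eq_of_mem _ ?_ haT⟩
    exact Finset.mem_insert_self _ _
  · have h' : insert T σ.parts = insert T τ.parts := congrArg Finpartition.parts h
    refine Finpartition.ext ?_
    rw [← Finset.erase_insert (hnot σ), h', Finset.erase_insert (hnot τ)]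
  · have hp := (Finset.mem_filter.1 hπ).2
    have hTp : T ∈ π.parts := by
      rw [← hp]
      exact π.part_mem.2 (hT haT)
    refine ⟨π.avoid T, Finset.mem_univ _, Finpartition.ext ?_⟩
    change insert T (π.avoid T).parts = π.parts
    rw [π.parts_avoid_of_mem hTp, Finset.insert_erase hTp]
  · change _ = ∏ B ∈ insert T σ.parts, ursell k B
    rw [Finset.prod_insert (hnot σ)]

/-- The recursion for the Ursell functional, with respect to the block of a given point. -/
theorem ursell_recursion (k : FinConf d → ℝ) (hk : k ∅ = 1) {η : FinConf d} {a : Pos d}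
    (ha : a ∈ η) :
    k η = ∑ S ∈ (η.erase a).powerset, ursell k (insert a S) * k (η.erase a \ S) := by
  have hmaps : ∀ π ∈ (Finset.univ : Finset (Finpartition η)),
      (π.part a).erase a ∈ (η.erase a).powerset := fun π _ =>
    Finset.mem_powerset.2 (Finset.erase_subset_erase _ (π.part_subset a))
  rw [ursell_sum k hk η, ← Finset.sum_fiberwise_of_maps_to hmaps]
  refine Finset.sum_congr rfl fun S hS => ?_
  have hS' := Finset.mem_powerset.1 hS
  have haS : a ∉ S := fun h => Finset.notMem_erase a η (hS' h)
  have hsd : η.erase a \ S = η \ insert a S := by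
    ext x
    simp only [Finset.mem_sdiff, Finset.mem_erase, Finset.mem_insert]
    tauto
  rw [hsd, ← ursell_sum_part k hk (Finset.mem_insert_self a S)
    (Finset.insert_subset ha (hS'.trans (Finset.erase_subset _ _)))]
  refine Finset.sum_congr (Finset.filter_congr fun π _ => ?_) fun _ _ => rfl
  constructor
  · rintro rfl
    exact (Finset.insert_erase (π.mem_part ha)).symm
  · intro h
    rw [h, Finset.erase_insert haS]

theorem FinConf.shift_empty (v : Pos d) : FinConf.shift (∅ : FinConf d) v = ∅ := rfl

theorem FinConf.shift_injective (v : Pos d) :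
    Function.Injective fun η : FinConf d => FinConf.shift η v :=
  Finset.image_injective (add_left_injective v)

theorem FinConf.shift_union (η ξ : FinConf d) (v : Pos d) :
    FinConf.shift (η ∪ ξ) v = FinConf.shift η v ∪ FinConf.shift ξ v :=
  Finset.image_union _ _

theorem FinConf.shift_shift (η : FinConf d) (v w : Pos d) :
    FinConf.shift (FinConf.shift η v) w = FinConf.shift η (v + w) := by
  simp only [FinConf.shift, Finset.image_image]
  congr 1
  funext x
  exact add_assoc _ _ _

theorem tendsto_norm_inv_smul {h : Pos d} (hh : h ≠ 0) :
    Tendsto (fun ε : ℝ => ‖ε⁻¹ • h‖) (𝓝[>] 0) atTop := by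
  simp only [norm_smul]
  exact (tendsto_norm_atTop_atTop.comp tendsto_inv_nhdsGT_zero).atTop_mul_const
    (norm_pos_iff.2 hh)

theorem eventually_disjoint_shift (A B : FinConf d) {h : Pos d} (hh : h ≠ 0) :
    ∀ᶠ ε : ℝ in 𝓝[>] 0, Disjoint A (FinConf.shift B (ε⁻¹ • h)) := by
  have key : ∀ a ∈ A, ∀ b ∈ B, ∀ᶠ ε : ℝ in 𝓝[>] 0, a ≠ b + ε⁻¹ • h := fun a _ b _ => by
    filter_upwards [(tendsto_norm_inv_smul hh).eventually_gt_atTop ‖a - b‖] with ε hε heq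
    rw [heq, add_sub_cancel_left] at hε
    exact lt_irrefl _ hε
  filter_upwards [(Filter.eventually_all_finset A).2 fun a ha =>
    (Filter.eventually_all_finset B).2 (key a ha)] with ε hε
  rw [Finset.disjoint_left]
  intro a ha hab
  obtain ⟨b, hb, rfl⟩ := Finset.mem_image.1 hab
  exact hε _ ha b hb rfl

theorem HasDecay.tendsto {u : FinConf d → ℝ} (hu : HasDecay u) {A B : FinConf d}
    (hA : A.Nonempty) (hB : B.Nonempty) {h : Pos d} (hh : h ≠ 0) :
    Tendsto (fun ε : ℝ => u (A ∪ FinConf.shift B (ε⁻¹ • h))) (𝓝[>] 0) (𝓝 0) := by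
  obtain ⟨ε₀, hε₀⟩ := (eventually_disjoint_shift A B hh).exists
  have h1 := hu A (FinConf.shift B (ε₀⁻¹ • h)) hA (hB.image _) hε₀ h hh
  have h2 : Tendsto (fun ε : ℝ => (ε⁻¹ - ε₀⁻¹)⁻¹) (𝓝[>] 0) (𝓝[>] 0) :=
    tendsto_inv_atTop_nhdsGT_zero.comp
      (tendsto_atTop_add_const_right _ (-ε₀⁻¹) tendsto_inv_nhdsGT_zero)
  refine (h1.comp h2).congr fun ε => ?_
  simp only [Function.comp_apply, inv_inv, FinConf.shift_shift, ← add_smul, add_sub_cancel]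

/-- Decay of the Ursell functional: distant groups of points become independent. -/
theorem tendsto_union_shift (hk : k ∅ = 1) (ht : IsTranslationInvariant k)
    (hu : HasDecay (ursell k)) {h : Pos d} (hh : h ≠ 0) (A B : FinConf d) :
    Tendsto (fun ε : ℝ => k (A ∪ FinConf.shift B (ε⁻¹ • h))) (𝓝[>] 0) (𝓝 (k A * k B)) := by
  induction A using Finset.strongInduction generalizing B with
  | H A ih =>
    rcases A.eq_empty_or_nonempty with rfl | ⟨a, ha⟩
    · have ht' : ∀ v, k (FinConf.shift B v) = k B := fun v => ht v B
      simp only [Finset.empty_union, ht', hk, one_mul]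
      exact tendsto_const_nhds
    have hexp : ∀ᶠ ε : ℝ in 𝓝[>] 0,
        ∑ S ∈ (A.erase a).powerset, ∑ T ∈ B.powerset,
          ursell k (insert a S ∪ FinConf.shift T (ε⁻¹ • h)) *
            k (A.erase a \ S ∪ FinConf.shift (B \ T) (ε⁻¹ • h)) =
          k (A ∪ FinConf.shift B (ε⁻¹ • h)) := by
      filter_upwards [eventually_disjoint_shift A B hh] with ε hd
      set v := ε⁻¹ • h
      have hav : a ∉ FinConf.shift B v := Finset.disjoint_left.1 hd ha
      have hd' : Disjoint (A.erase a) (FinConf.shift B v) :=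
        hd.mono_left (Finset.erase_subset _ _)
      rw [ursell_recursion k hk (Finset.mem_union_left _ ha), Finset.erase_union_distrib,
        Finset.erase_eq_of_notMem hav, Finset.sum_powerset_union hd']
      refine Finset.sum_congr rfl fun S hS => ?_
      have hS' := Finset.mem_powerset.1 hS
      have hpow : (FinConf.shift B v).powerset = B.powerset.image fun T => FinConf.shift T v :=
        Finset.powerset_image
      rw [hpow, Finset.sum_image fun T _ T' _ hTT => FinConf.shift_injective v hTT]
      refine Finset.sum_congr rfl fun T hT => ?_
      have hT' : FinConf.shift T v ⊆ FinConf.shift B v :=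
        Finset.image_subset_image (Finset.mem_powerset.1 hT)
      have e1 : (A.erase a ∪ FinConf.shift B v) \ (S ∪ FinConf.shift T v) =
          A.erase a \ S ∪ FinConf.shift (B \ T) v := by
        have e2 : FinConf.shift (B \ T) v = FinConf.shift B v \ FinConf.shift T v :=
          Finset.image_sdiff _ _ (add_left_injective v)
        rw [e2]
        have h' := Finset.disjoint_left.1 hd'
        ext x
        have h1 := @hS' x
        have h2 := @hT' x
        have h3 := @h' x
        simp only [Finset.mem_sdiff, Finset.mem_union]
        tauto
      rw [e1, Finset.insert_union]
    refine Tendsto.congr' hexp ?_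
    have hlim : k A * k B = ∑ S ∈ (A.erase a).powerset, ∑ T ∈ B.powerset,
        if T = ∅ then ursell k (insert a S) * (k (A.erase a \ S) * k B) else 0 := by
      rw [ursell_recursion k hk ha, Finset.sum_mul]
      refine Finset.sum_congr rfl fun S _ => ?_
      rw [Finset.sum_ite_eq' B.powerset ∅, if_pos (Finset.empty_mem_powerset B), mul_assoc]
    rw [hlim]
    refine tendsto_finsetSum _ fun S hS => tendsto_finsetSum _ fun T hT => ?_
    have hss : A.erase a \ S ⊂ A :=
      Finset.ssubset_of_subset_of_ssubset Finset.sdiff_subset (Finset.erase_ssubset ha)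
    have hkk := ih _ hss (B \ T)
    by_cases hT0 : T = ∅
    · subst hT0
      simp only [FinConf.shift_empty, Finset.union_empty, if_true, Finset.sdiff_empty] at hkk ⊢
      exact hkk.const_mul _
    · rw [if_neg hT0]
      have := (hu.tendsto (Finset.insert_nonempty a S) (Finset.nonempty_iff_ne_empty.2 hT0)
        hh).mul hkk
      rwa [zero_mul] at this

end

/-! ### The scaling limit -/

theorem enorm_abs_real (x : ℝ) : ‖|x|‖ₑ = ‖x‖ₑ := by
  rw [Real.enorm_eq_ofReal_abs, Real.enorm_eq_ofReal_abs, abs_abs]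

section

variable {d : ℕ} {k : FinConf d → ℝ} {s C M : ℝ} {α β : Pos d → ℝ}

theorem eLambda_shift (f : Pos d → ℝ) (ξ : FinConf d) (v : Pos d) :
    eLambda f (FinConf.shift ξ v) = eLambda (fun u => f (u + v)) ξ :=
  Finset.prod_image fun _ _ _ _ h => add_left_injective v h

theorem abs_eLambda (f : Pos d → ℝ) (ξ : FinConf d) :
    |eLambda f ξ| = eLambda (fun u => |f u|) ξ :=
  Finset.abs_prod _ _

theorem eLambda_nonneg {f : Pos d → ℝ} (hf : ∀ u, 0 ≤ f u) (ξ : FinConf d) : 0 ≤ eLambda f ξ :=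
  Finset.prod_nonneg fun u _ => hf u

theorem eLambda_le_eLambda {f g : Pos d → ℝ} (hf : ∀ u, 0 ≤ f u) (hfg : ∀ u, f u ≤ g u)
    (ξ : FinConf d) : eLambda f ξ ≤ eLambda g ξ :=
  Finset.prod_le_prod (fun u _ => hf u) fun u _ => hfg u

theorem FinConf.card_shift (ξ : FinConf d) (v : Pos d) : (FinConf.shift ξ v).card = ξ.card :=
  Finset.card_image_of_injective _ (add_left_injective v)

theorem integrable_growthBound_mul_eLambda_eLambda [NeZero d] (hs0 : 0 ≤ s) (hs1 : s < 1) (C : ℝ)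
    (N : ℕ) (hα : Measurable α) (hβ : Measurable β) (hα0 : ∀ u, 0 ≤ α u) (hβ0 : ∀ u, 0 ≤ β u)
    (hαi : ∫⁻ u, ‖α u‖ₑ ≠ ∞) (hβi : ∫⁻ u, ‖β u‖ₑ ≠ ∞) :
    Integrable (fun p : FinConf d × FinConf d =>
      growthBound s C (p.1.card + p.2.card + N) * (eLambda α p.1 * eLambda β p.2))
      ((lebesguePoisson d).prod (lebesguePoisson d)) := by
  have hc : Measurable fun p : FinConf d × FinConf d =>
      growthBound s C (p.1.card + p.2.card + N) :=
    (measurable_from_top (f := fun n : ℕ => growthBound s C (n + N))).comp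
      ((FinConf.measurable_card.comp measurable_fst).add
        (FinConf.measurable_card.comp measurable_snd))
  have hm : Measurable fun p : FinConf d × FinConf d =>
      growthBound s C (p.1.card + p.2.card + N) * (eLambda α p.1 * eLambda β p.2) :=
    hc.mul (((FinConf.measurable_eLambda_right hα).comp measurable_fst).mul
      ((FinConf.measurable_eLambda_right hβ).comp measurable_snd))
  have h0 : ∀ p : FinConf d × FinConf d,
      0 ≤ growthBound s C (p.1.card + p.2.card + N) * (eLambda α p.1 * eLambda β p.2) := fun p =>
    mul_nonneg (growthBound_nonneg hs0 _ _)
      (mul_nonneg (eLambda_nonneg hα0 _) (eLambda_nonneg hβ0 _))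
  refine ⟨hm.aestronglyMeasurable, ?_⟩
  rw [hasFiniteIntegral_iff_ofReal (ae_of_all _ h0),
    ← FinConf.lintegral_sum_powerset hm.ennreal_ofReal]
  have hsum : ∀ ξ : FinConf d, ∑ ζ ∈ ξ.powerset, ENNReal.ofReal
      (growthBound s C (ζ.card + (ξ \ ζ).card + N) * (eLambda α ζ * eLambda β (ξ \ ζ))) =
      ENNReal.ofReal (growthBound s C (ξ.card + N) * eLambda (fun u => α u + β u) ξ) := fun ξ => by
    rw [← ENNReal.ofReal_sum_of_nonneg fun ζ _ => h0 (ζ, ξ \ ζ), FinConf.eLambda_add,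
      Finset.mul_sum]
    congr 1
    refine Finset.sum_congr rfl fun ζ hζ => ?_
    have := Finset.card_sdiff_add_card_eq_card (Finset.mem_powerset.1 hζ)
    rw [show ζ.card + (ξ \ ζ).card = ξ.card by omega]
  simp only [hsum]
  have hi : ∫⁻ u, ‖α u + β u‖ₑ ≠ ∞ := by
    refine ne_top_of_le_ne_top (ENNReal.add_ne_top.2 ⟨hαi, hβi⟩) ?_
    rw [← lintegral_add_left hα.enorm]
    exact lintegral_mono fun u => enorm_add_le _ _
  have hint := integrable_mul_eLambda hs0 hs1 (f := fun u => α u + β u) (hα.add hβ) hi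
    (FinConf.measurable_growthBound_card s C N)
    (fun ξ => (abs_of_nonneg (growthBound_nonneg hs0 _ _)).le)
  exact (hasFiniteIntegral_iff_ofReal (ae_of_all _ fun ξ => mul_nonneg (growthBound_nonneg hs0 _ _)
    (eLambda_nonneg (fun u => add_nonneg (hα0 u) (hβ0 u)) _))).1 hint.2

theorem tendsto_eLambda {ι : Type*} {l : Filter ι} {f : ι → Pos d → ℝ} {g : Pos d → ℝ}
    (h : ∀ u, Tendsto (fun i => f i u) l (𝓝 (g u))) (ξ : FinConf d) :
    Tendsto (fun i => eLambda (f i) ξ) l (𝓝 (eLambda g ξ)) :=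
  tendsto_finsetProd _ fun u _ => h u

theorem tendsto_comp_shift_zero {f : Pos d → ℝ} (hf : Tendsto f (cocompact (Pos d)) (𝓝 0))
    {h : Pos d} (hh : h ≠ 0) (u : Pos d) :
    Tendsto (fun ε : ℝ => f (u + ε⁻¹ • h)) (𝓝[>] 0) (𝓝 0) := by
  refine hf.comp ?_
  rw [← Metric.cobounded_eq_cocompact, ← tendsto_norm_atTop_iff_cobounded]
  refine tendsto_atTop_mono (fun ε => ?_)
    (tendsto_atTop_add_const_right _ (-‖u‖) (tendsto_norm_inv_smul hh))
  have := norm_sub_norm_le (ε⁻¹ • h) (-u)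
  rw [norm_neg, sub_neg_eq_add, add_comm (ε⁻¹ • h)] at this
  linarith

/-- The effect of the points of a configuration on a jump of length `v`: the functional which is
integrated against the jump density. -/
noncomputable def jumpFunctional (k : FinConf d → ℝ) (α β : Pos d → ℝ) (A B D : FinConf d)
    (v : Pos d) : ℝ :=
  eLambda (fun u => (1 + α u) * (1 + β (u - v))) D *
    ∫ ξ, k (ξ ∪ A ∪ FinConf.shift B v) * eLambda (fun u => (1 + α u) * (1 + β (u - v)) - 1) ξ
      ∂(lebesguePoisson d)

theorem measurable_jumpFunctional (hk : Measurable k) (hα : Measurable α) (hβ : Measurable β)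
    (A B D : FinConf d) : Measurable (jumpFunctional k α β A B D) := by
  have hf : Measurable fun p : Pos d × Pos d => (1 + α p.2) * (1 + β (p.2 - p.1)) :=
    ((hα.comp measurable_snd).const_add 1).mul
      ((hβ.comp (measurable_snd.sub measurable_fst)).const_add 1)
  have h1 : Measurable fun v => eLambda (fun u => (1 + α u) * (1 + β (u - v))) D :=
    FinConf.measurable_eLambda_left
      (fun u => hf.comp (measurable_id.prodMk measurable_const)) D
  have h2 : Measurable fun p : Pos d × FinConf d => k (p.2 ∪ A ∪ FinConf.shift B p.1) :=
    hk.comp (FinConf.measurable_union.comp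
      ((FinConf.measurable_union.comp (measurable_snd.prodMk measurable_const)).prodMk
        (FinConf.measurable_shift.comp (measurable_fst.prodMk measurable_const))))
  have h3 : Measurable fun p : Pos d × FinConf d =>
      eLambda (fun u => (1 + α u) * (1 + β (u - p.1)) - 1) p.2 :=
    FinConf.measurable_eLambda (f := fun v u => (1 + α u) * (1 + β (u - v)) - 1) (hf.sub_const 1)
  exact h1.mul (h2.mul h3).stronglyMeasurable.integral_prod_right'.measurable

theorem norm_jumpFunctional_le [NeZero d] (hs0 : 0 ≤ s) (hs1 : s < 1) (hk0 : ∀ η, 0 ≤ k η)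
    (hkb : ∀ η, k η ≤ growthBound s C η.card) (hα : Measurable α) (hβ : Measurable β)
    (hαM : ∀ u, |1 + α u| ≤ M) (hβM : ∀ u, |1 + β u| ≤ M) (hαi : ∫⁻ u, ‖α u‖ₑ ≠ ∞)
    (hβi : ∫⁻ u, ‖β u‖ₑ ≠ ∞) (A B D : FinConf d) (v : Pos d) :
    ‖jumpFunctional k α β A B D v‖ ≤ (M * M) ^ D.card *
      (expBound s C (A.card + B.card)
        ((∫⁻ u, ‖α u‖ₑ) + ENNReal.ofReal M * ∫⁻ u, ‖β u‖ₑ)).toReal := by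
  have hM : 0 ≤ M := (abs_nonneg _).trans (hαM 0)
  have hβv : Measurable fun u => β (u - v) := hβ.comp (measurable_id.sub measurable_const)
  rw [jumpFunctional, norm_mul]
  refine mul_le_mul ?_ ?_ (norm_nonneg _) (by positivity)
  · refine FinConf.abs_eLambda_le (fun u => ?_) D
    rw [abs_mul]
    exact mul_le_mul (hαM u) (hβM _) (abs_nonneg _) hM
  · refine norm_integral_mul_eLambda_le (N := A.card + B.card) hs0 hs1
      (f := fun u => (1 + α u) * (1 + β (u - v)) - 1)
      (((hα.const_add 1).mul (hβv.const_add 1)).sub_const 1)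
      (ENNReal.add_ne_top.2 ⟨hαi, ENNReal.mul_ne_top ENNReal.ofReal_ne_top hβi⟩) ?_ fun ξ => ?_
    · have := lintegral_mul_sub_one_le hα hβv hαM
      rwa [lintegral_sub_right_eq_self (fun u => ‖β u‖ₑ) v] at this
    · refine abs_le_growthBound hs0 hk0 hkb ?_
      have e1 := Finset.card_union_le (ξ ∪ A) (FinConf.shift B v)
      have e2 := Finset.card_union_le ξ A
      rw [FinConf.card_shift] at e1
      omega

theorem integral_jump_eq [NeZero d] (hs0 : 0 ≤ s) (hs1 : s < 1) (hk : Measurable k)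
    (hk0 : ∀ η, 0 ≤ k η) (hkb : ∀ η, k η ≤ growthBound s C η.card) (hα : Measurable α)
    (hβ : Measurable β) (hαM : ∀ u, |1 + α u| ≤ M) (hαi : ∫⁻ u, ‖α u‖ₑ ≠ ∞)
    (hβi : ∫⁻ u, ‖β u‖ₑ ≠ ∞) (A B : FinConf d) (v : Pos d) :
    ∫ ξ, k (ξ ∪ A ∪ FinConf.shift B v) * eLambda (fun u => (1 + α u) * (1 + β (u - v)) - 1) ξ
      ∂(lebesguePoisson d) =
    ∫ p : FinConf d × FinConf d, k ((p.1 ∪ A) ∪ FinConf.shift (p.2 ∪ B) v) *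
      (eLambda α p.1 * eLambda (fun u => β u * (1 + α (u + v))) p.2)
      ∂((lebesguePoisson d).prod (lebesguePoisson d)) := by
  have hβv : Measurable fun u => β (u - v) := hβ.comp (measurable_id.sub measurable_const)
  have hγ : Measurable fun u => β (u - v) * (1 + α u) := hβv.mul (hα.const_add 1)
  have hγi : ∫⁻ u, ‖β (u - v) * (1 + α u)‖ₑ ≠ ∞ := by
    refine ne_top_of_le_ne_top (ENNReal.mul_ne_top hβi (ENNReal.ofReal_ne_top (r := M))) ?_
    rw [← lintegral_sub_right_eq_self (fun u => ‖β u‖ₑ) v, ← lintegral_mul_const _ hβv.enorm]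
    refine lintegral_mono fun u => ?_
    rw [enorm_mul]
    gcongr
    rw [Real.enorm_eq_ofReal_abs]
    exact ENNReal.ofReal_le_ofReal (hαM u)
  let Q : FinConf d × FinConf d → ℝ := fun p => k (p.1 ∪ p.2 ∪ A ∪ FinConf.shift B v) *
    (eLambda α p.1 * eLambda (fun u => β (u - v) * (1 + α u)) p.2)
  have hQ : Measurable Q :=
    (hk.comp (FinConf.measurable_union.comp ((FinConf.measurable_union.comp
      (FinConf.measurable_union.prodMk measurable_const)).prodMk measurable_const))).mul
      (((FinConf.measurable_eLambda_right hα).comp measurable_fst).mul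
        ((FinConf.measurable_eLambda_right hγ).comp measurable_snd))
  have hQi : Integrable Q ((lebesguePoisson d).prod (lebesguePoisson d)) := by
    refine (integrable_growthBound_mul_eLambda_eLambda hs0 hs1 C (A.card + B.card)
      (α := fun u => |α u|) (β := fun u => |β (u - v) * (1 + α u)|) hα.norm hγ.norm
      (fun _ => abs_nonneg _) (fun _ => abs_nonneg _) ?_ ?_).mono' hQ.aestronglyMeasurable
      (ae_of_all _ fun p => ?_)
    · simpa only [enorm_abs_real] using hαi
    · simpa only [enorm_abs_real] using hγi
    · rw [norm_mul, norm_mul, Real.norm_eq_abs, Real.norm_eq_abs, Real.norm_eq_abs, abs_eLambda,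
        abs_eLambda]
      refine mul_le_mul_of_nonneg_right ?_ (mul_nonneg (eLambda_nonneg (fun _ => abs_nonneg _) _)
        (eLambda_nonneg (fun _ => abs_nonneg _) _))
      refine abs_le_growthBound hs0 hk0 hkb ?_
      have e1 := Finset.card_union_le (p.1 ∪ p.2 ∪ A) (FinConf.shift B v)
      have e2 := Finset.card_union_le (p.1 ∪ p.2) A
      have e3 := Finset.card_union_le p.1 p.2
      rw [FinConf.card_shift] at e1
      omega
  have hmp : MeasurePreserving
      (Prod.map id fun ξ => FinConf.shift ξ v : FinConf d × FinConf d → FinConf d × FinConf d)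
      ((lebesguePoisson d).prod (lebesguePoisson d))
      ((lebesguePoisson d).prod (lebesguePoisson d)) :=
    (MeasurePreserving.id _).prod (FinConf.measurePreserving_shift v)
  trans ∫ p, Q p ∂((lebesguePoisson d).prod (lebesguePoisson d))
  · rw [← (FinConf.integral_sum_powerset hQ hQi).2]
    refine integral_congr_ae (ae_of_all _ fun ξ => ?_)
    have : (fun u => (1 + α u) * (1 + β (u - v)) - 1) =
        fun u => α u + β (u - v) * (1 + α u) := funext fun u => by ring
    simp only [this]
    rw [FinConf.eLambda_add, Finset.mul_sum]
    refine Finset.sum_congr rfl fun ζ hζ => ?_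
    simp only [Q, Finset.union_sdiff_of_subset (Finset.mem_powerset.1 hζ)]
  · rw [← FinConf.integral_comp_of_measurePreserving hmp hQ]
    refine integral_congr_ae (ae_of_all _ fun p => ?_)
    have hset : p.1 ∪ FinConf.shift p.2 v ∪ A ∪ FinConf.shift B v =
        p.1 ∪ A ∪ FinConf.shift (p.2 ∪ B) v := by
      rw [FinConf.shift_union]
      ac_rfl
    simp only [Q, Prod.map_fst, Prod.map_snd, id, hset, eLambda_shift, add_sub_cancel_right]

theorem tendsto_jumpFunctional [NeZero d] (hs0 : 0 ≤ s) (hs1 : s < 1) (hk : Measurable k)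
    (hk0 : ∀ η, 0 ≤ k η) (hkb : ∀ η, k η ≤ growthBound s C η.card) (hk1 : k ∅ = 1)
    (ht : IsTranslationInvariant k) (hu : HasDecay (ursell k)) (hα : Measurable α)
    (hβ : Measurable β) (hαM : ∀ u, |1 + α u| ≤ M) (hαi : ∫⁻ u, ‖α u‖ₑ ≠ ∞)
    (hβi : ∫⁻ u, ‖β u‖ₑ ≠ ∞) (hα0 : Tendsto α (cocompact (Pos d)) (𝓝 0))
    (hβ0 : Tendsto β (cocompact (Pos d)) (𝓝 0)) (A B D : FinConf d) {h : Pos d} (hh : h ≠ 0) :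
    Tendsto (fun ε : ℝ => jumpFunctional k α β A B D (ε⁻¹ • h)) (𝓝[>] 0)
      (𝓝 (eLambda (fun u => 1 + α u) D *
        ((∫ ξ, k (ξ ∪ A) * eLambda α ξ ∂(lebesguePoisson d)) *
          ∫ ξ, k (ξ ∪ B) * eLambda β ξ ∂(lebesguePoisson d)))) := by
  have hM : 0 ≤ M := (abs_nonneg _).trans (hαM 0)
  refine Tendsto.mul (tendsto_eLambda (fun u => ?_) D) ?_
  · have h1 := tendsto_comp_shift_zero hβ0 (neg_ne_zero.2 hh) u
    simpa [sub_eq_add_neg] using (h1.const_add 1).const_mul (1 + α u)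
  simp only [integral_jump_eq hs0 hs1 hk hk0 hkb hα hβ hαM hαi hβi]
  have hMβi : ∫⁻ u, ‖|β u| * M‖ₑ ≠ ∞ := by
    simp only [enorm_mul, enorm_abs_real]
    rw [lintegral_mul_const _ hβ.enorm]
    exact ENNReal.mul_ne_top hβi enorm_ne_top
  have hbd := integrable_growthBound_mul_eLambda_eLambda hs0 hs1 C (A.card + B.card)
    (α := fun u => |α u|) (β := fun u => |β u| * M) hα.norm (hβ.norm.mul_const M)
    (fun _ => abs_nonneg _) (fun _ => mul_nonneg (abs_nonneg _) hM)
    (by simpa only [enorm_abs_real] using hαi) hMβi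
  rw [← integral_prod_mul]
  refine tendsto_integral_filter_of_dominated_convergence _ (Eventually.of_forall fun ε => ?_)
    (Eventually.of_forall fun ε => ae_of_all _ fun p => ?_) hbd (ae_of_all _ fun p => ?_)
  · have hγ : Measurable fun u => β u * (1 + α (u + ε⁻¹ • h)) :=
      hβ.mul ((hα.comp (measurable_id.add measurable_const)).const_add 1)
    refine Measurable.aestronglyMeasurable (Measurable.mul (hk.comp ?_)
      (((FinConf.measurable_eLambda_right hα).comp measurable_fst).mul
        ((FinConf.measurable_eLambda_right hγ).comp measurable_snd)))
    exact FinConf.measurable_union.comp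
      ((FinConf.measurable_union.comp (measurable_fst.prodMk measurable_const)).prodMk
        ((FinConf.measurable_shift_right _).comp
          (FinConf.measurable_union.comp (measurable_snd.prodMk measurable_const))))
  · rw [norm_mul, norm_mul, Real.norm_eq_abs, Real.norm_eq_abs, Real.norm_eq_abs, abs_eLambda α,
      abs_eLambda]
    refine mul_le_mul ?_ (mul_le_mul_of_nonneg_left (eLambda_le_eLambda (fun _ => abs_nonneg _)
      (fun u => ?_) _) (eLambda_nonneg (fun _ => abs_nonneg _) _))
      (mul_nonneg (eLambda_nonneg (fun _ => abs_nonneg _) _)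
        (eLambda_nonneg (fun _ => abs_nonneg _) _)) (growthBound_nonneg hs0 _ _)
    · refine abs_le_growthBound hs0 hk0 hkb ?_
      have e1 := Finset.card_union_le (p.1 ∪ A) (FinConf.shift (p.2 ∪ B) (ε⁻¹ • h))
      have e2 := Finset.card_union_le p.1 A
      have e3 := Finset.card_union_le p.2 B
      rw [FinConf.card_shift] at e1
      omega
    · rw [abs_mul]
      exact mul_le_mul_of_nonneg_left (hαM _) (abs_nonneg _)
  · have h1 := tendsto_union_shift hk1 ht hu hh (p.1 ∪ A) (p.2 ∪ B)
    have h2 : Tendsto (fun ε : ℝ => eLambda (fun u => β u * (1 + α (u + ε⁻¹ • h))) p.2) (𝓝[>] 0)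
        (𝓝 (eLambda β p.2)) := tendsto_eLambda (fun u => by
      simpa using ((tendsto_comp_shift_zero hα0 hh u).const_add 1).const_mul (β u)) _
    convert h1.mul (h2.const_mul (eLambda α p.1)) using 2
    ring

theorem integral_scaledJump_mul {a : Pos d → ℝ} {ε : ℝ} (hε : 0 < ε) (J : Pos d → ℝ) (x : Pos d) :
    ∫ y, scaledJump a ε (y - x) * J (y - x) = ∫ h, a h * J (ε⁻¹ • h) := by
  rw [integral_sub_right_eq_self (fun v => scaledJump a ε v * J v) x]
  have h1 := Measure.integral_comp_smul (volume : Measure (Pos d)) (fun h => a h * J (ε⁻¹ • h)) ε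
  simp only [smul_smul, inv_mul_cancel₀ hε.ne', one_smul, finrank_euclideanSpace_fin,
    smul_eq_mul] at h1
  simp only [scaledJump, mul_assoc]
  rw [integral_const_mul, h1, ← mul_assoc, abs_of_pos (by positivity),
    mul_inv_cancel₀ (by positivity), one_mul]

theorem tendsto_integral_scaledJump_mul [NeZero d] {a : Pos d → ℝ} (ha : Integrable a)
    (ha1 : ∫ x, a x = 1) {J : Pos d → ℝ} (hJ : Measurable J) {K l : ℝ} (hK : ∀ v, ‖J v‖ ≤ K)
    (hl : ∀ h : Pos d, h ≠ 0 → Tendsto (fun ε : ℝ => J (ε⁻¹ • h)) (𝓝[>] 0) (𝓝 l)) (x : Pos d) :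
    Tendsto (fun ε : ℝ => ∫ y, scaledJump a ε (y - x) * J (y - x)) (𝓝[>] 0) (𝓝 l) := by
  have hev : ∀ᶠ ε : ℝ in 𝓝[>] 0, ∫ h, a h * J (ε⁻¹ • h) =
      ∫ y, scaledJump a ε (y - x) * J (y - x) := by
    filter_upwards [self_mem_nhdsWithin] with ε hε
    exact (integral_scaledJump_mul hε J x).symm
  refine Tendsto.congr' hev ?_
  have hlim : l = ∫ h, a h * l := by rw [integral_mul_const, ha1, one_mul]
  rw [hlim]
  refine tendsto_integral_filter_of_dominated_convergence (fun h => ‖a h‖ * K)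
    (Eventually.of_forall fun ε => ?_) (Eventually.of_forall fun ε => ae_of_all _ fun h => ?_)
    (ha.norm.mul_const K) ?_
  · exact ha.aestronglyMeasurable.mul (hJ.comp (measurable_const_smul _)).aestronglyMeasurable
  · rw [norm_mul]
    exact mul_le_mul_of_nonneg_left (hK _) (norm_nonneg _)
  · filter_upwards [(Set.countable_singleton (0 : Pos d)).ae_notMem volume] with h hh
    exact (hl h hh).const_mul _

theorem integral_union_shift_mul_eLambda [NeZero d] (hk : Measurable k)
    (ht : IsTranslationInvariant k) {f : Pos d → ℝ} (hf : Measurable f) (hfe : Function.Even f)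
    (B : FinConf d) (x : Pos d) :
    ∫ ξ, k (ξ ∪ FinConf.shift B x) * eLambda (fun u => f (x - u)) ξ ∂(lebesguePoisson d) =
      ∫ ξ, k (ξ ∪ B) * eLambda f ξ ∂(lebesguePoisson d) := by
  have hm : Measurable fun ξ : FinConf d =>
      k (ξ ∪ FinConf.shift B x) * eLambda (fun u => f (x - u)) ξ :=
    (hk.comp (FinConf.measurable_union.comp (measurable_id.prodMk measurable_const))).mul
      (FinConf.measurable_eLambda_right (hf.comp (measurable_const.sub measurable_id)))
  rw [← FinConf.integral_comp_of_measurePreserving (FinConf.measurePreserving_shift x) hm]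
  refine integral_congr_ae (ae_of_all _ fun ξ => ?_)
  simp only
  rw [← FinConf.shift_union, ht, eLambda_shift]
  simp only [sub_add_cancel_right, hfe _]

end

section

variable {d : ℕ} {a φ ψ φm φp : Pos d → ℝ} {k : FinConf d → ℝ} {s C : ℝ}

theorem hasCompactSupport_comp_sub_left (hφs : HasCompactSupport φ) (x : Pos d) :
    HasCompactSupport fun u => φ (x - u) :=
  hφs.comp_homeomorph (Homeomorph.subLeft x)

theorem tendsto_exp_sub_one_cocompact (hφs : HasCompactSupport φ) :
    Tendsto (fun u => Real.exp (φ u) - 1) (cocompact (Pos d)) (𝓝 0) :=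
  (hφs.comp_left (g := fun t => Real.exp t - 1) (by simp)).is_zero_at_infty

theorem exists_abs_exp_le (hφ : Continuous φ) (hφs : HasCompactSupport φ) :
    ∃ M : ℝ, ∀ u, |1 + (Real.exp (φ u) - 1)| ≤ M := by
  obtain ⟨M, hM⟩ := hφ.bounded_above_of_compact_support hφs
  refine ⟨Real.exp M, fun u => ?_⟩
  rw [add_sub_cancel, Real.abs_exp, Real.exp_le_exp]
  exact (le_abs_self _).trans (hM u)

theorem tendsto_integral_scaledJump_mul_jumpFunctional [NeZero d] (ha : Integrable a)
    (ha1 : ∫ x, a x = 1) (hφ : Continuous φ) (hφs : HasCompactSupport φ) (hψ : Continuous ψ)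
    (hψs : HasCompactSupport ψ) (hψe : Function.Even ψ) (hs0 : 0 ≤ s) (hs1 : s < 1)
    (hk : Measurable k) (hk0 : ∀ η, 0 ≤ k η) (hkb : ∀ η, k η ≤ growthBound s C η.card)
    (hk1 : k ∅ = 1) (ht : IsTranslationInvariant k) (hu : HasDecay (ursell k))
    (A B D : FinConf d) (x : Pos d) :
    Tendsto (fun ε : ℝ => ∫ y, scaledJump a ε (y - x) *
      jumpFunctional k (fun u => Real.exp (φ (x - u)) - 1) (fun u => Real.exp (ψ (x - u)) - 1)
        A (FinConf.shift B x) D (y - x)) (𝓝[>] 0)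
      (𝓝 (eLambda (fun u => Real.exp (φ (x - u))) D *
        ((∫ ξ, k (ξ ∪ A) * eLambda (fun u => Real.exp (φ (x - u)) - 1) ξ ∂(lebesguePoisson d)) *
          ∫ ξ, k (ξ ∪ B) * eLambda (fun u => Real.exp (ψ u) - 1) ξ ∂(lebesguePoisson d)))) := by
  have hφx : Continuous fun u => φ (x - u) := hφ.comp (continuous_sub_left x)
  have hψx : Continuous fun u => ψ (x - u) := hψ.comp (continuous_sub_left x)
  have hφxs := hasCompactSupport_comp_sub_left hφs x
  have hψxs := hasCompactSupport_comp_sub_left hψs x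
  obtain ⟨M, hM⟩ := exists_abs_exp_le hφx hφxs
  obtain ⟨N, hN⟩ := exists_abs_exp_le hψx hψxs
  have hαm : Measurable fun u => Real.exp (φ (x - u)) - 1 :=
    (hφx.rexp.sub continuous_const).measurable
  have hβm : Measurable fun u => Real.exp (ψ (x - u)) - 1 :=
    (hψx.rexp.sub continuous_const).measurable
  have hαM := fun u => (hM u).trans (le_max_left M N)
  have hβM := fun u => (hN u).trans (le_max_right M N)
  have hαi := (integrable_exp_sub_one hφx hφxs).2.ne
  have hβi := (integrable_exp_sub_one hψx hψxs).2.ne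
  have hψe' : Function.Even fun u => Real.exp (ψ u) - 1 := fun u => by simp only [hψe u]
  have hψm : Measurable fun u => Real.exp (ψ u) - 1 := (hψ.rexp.sub continuous_const).measurable
  rw [← integral_union_shift_mul_eLambda hk ht hψm hψe' B x]
  refine tendsto_integral_scaledJump_mul ha ha1 (measurable_jumpFunctional hk hαm hβm _ _ _)
    (norm_jumpFunctional_le hs0 hs1 hk0 hkb hαm hβm hαM hβM hαi hβi A _ D) (fun h hh => ?_) x
  have := tendsto_jumpFunctional hs0 hs1 hk hk0 hkb hk1 ht hu hαm hβm hαM hαi hβi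
    (tendsto_exp_sub_one_cocompact hφxs) (tendsto_exp_sub_one_cocompact hψxs) A
    (FinConf.shift B x) D hh
  simpa only [add_sub_cancel] using this

theorem integral_dualKawasakiMinusIntegrand (hae : Function.Even a) (ε : ℝ) (η : FinConf d)
    (x y : Pos d) :
    ∫ ξ, dualKawasakiMinusIntegrand a φm φp ε k η x y ξ ∂(lebesguePoisson d) =
      scaledJump a ε (y - x) * jumpFunctional k (fun u => Real.exp (φm (x - u)) - 1)
        (fun u => Real.exp (-φp (x - u)) - 1) η (FinConf.shift ∅ x) (η.erase x) (y - x) := by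
  have h : ∀ u, (1 + (Real.exp (φm (x - u)) - 1)) *
      (1 + (Real.exp (-φp (x - (u - (y - x)))) - 1)) =
      jumpFactor φm φp x y u := fun u => by
    rw [add_sub_cancel, add_sub_cancel, ← Real.exp_add, jumpFactor,
      show x - (u - (y - x)) = y - u by abel, ← sub_eq_add_neg]
  simp only [jumpFunctional, h, FinConf.shift_empty, Finset.union_empty]
  simp only [dualKawasakiMinusIntegrand]
  rw [integral_const_mul, rate_ofFinset, scaledJump_sub_comm hae, mul_assoc]
  rfl

theorem integral_dualKawasakiPlusIntegrand (ε : ℝ) (η : FinConf d) (x y : Pos d) :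
    ∫ ξ, dualKawasakiPlusIntegrand a φm φp ε k η y x ξ ∂(lebesguePoisson d) =
      scaledJump a ε (x - y) * jumpFunctional k (fun u => Real.exp (-φp (y - u)) - 1)
        (fun u => Real.exp (φm (y - u)) - 1) (η.erase y) (FinConf.shift {0} y) (η.erase y)
        (x - y) := by
  have h : ∀ u, (1 + (Real.exp (-φp (y - u)) - 1)) *
      (1 + (Real.exp (φm (y - (u - (x - y)))) - 1)) =
      jumpFactor φm φp x y u := fun u => by
    rw [add_sub_cancel, add_sub_cancel, ← Real.exp_add, jumpFactor,
      show y - (u - (x - y)) = x - u by abel, neg_add_eq_sub]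
  have hset : ∀ ξ : FinConf d, ξ ∪ η.erase y ∪ FinConf.shift (FinConf.shift {0} y) (x - y) =
      insert x (ξ ∪ η.erase y) := fun ξ => by
    have : FinConf.shift (FinConf.shift {0} y) (x - y) = {x} := by
      simp only [FinConf.shift, Finset.image_singleton, zero_add, add_sub_cancel]
    rw [this, Finset.union_comm, ← Finset.insert_eq]
  simp only [jumpFunctional, h, hset]
  simp only [dualKawasakiPlusIntegrand]
  rw [integral_const_mul, rate_ofFinset, mul_assoc]
  rfl

theorem integral_dualGlauberMinusIntegrand (η : FinConf d) (x : Pos d) :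
    ∫ ξ, dualGlauberMinusIntegrand φm k η x ξ ∂(lebesguePoisson d) =
      eLambda (fun u => Real.exp (φm (x - u))) (η.erase x) *
        ∫ ξ, k (ξ ∪ η) * eLambda (fun u => Real.exp (φm (x - u)) - 1) ξ ∂(lebesguePoisson d) := by
  simp only [dualGlauberMinusIntegrand]
  rw [integral_const_mul, energy_ofFinset, Real.exp_sum]
  simp only [mul_comm (k _), Finset.union_comm η]
  rfl

theorem integral_dualGlauberPlusIntegrand (η : FinConf d) (y : Pos d) :
    ∫ ξ, dualGlauberPlusIntegrand φp k η y ξ ∂(lebesguePoisson d) =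
      eLambda (fun u => Real.exp (-φp (y - u))) (η.erase y) *
        ∫ ξ, k (ξ ∪ η.erase y) * eLambda (fun u => Real.exp (-φp (y - u)) - 1) ξ
          ∂(lebesguePoisson d) := by
  simp only [dualGlauberPlusIntegrand]
  rw [integral_const_mul, energy_ofFinset, ← Finset.sum_neg_distrib, Real.exp_sum]
  simp only [mul_comm (k _), Finset.union_comm (η.erase y)]
  rfl

theorem tendsto_dualKawasakiMinus [NeZero d] (ha : Integrable a)
    (ha1 : ∫ x, a x = 1) (hae : Function.Even a) (hm : Continuous φm) (hms : HasCompactSupport φm)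
    (hp : Continuous φp) (hps : HasCompactSupport φp) (hpe : Function.Even φp) (hs0 : 0 ≤ s)
    (hs1 : s < 1) (hk : Measurable k) (hk0 : ∀ η, 0 ≤ k η)
    (hkb : ∀ η, k η ≤ growthBound s C η.card) (hk1 : k ∅ = 1) (ht : IsTranslationInvariant k)
    (hu : HasDecay (ursell k)) (η : FinConf d) :
    Tendsto (fun ε : ℝ => dualKawasakiMinus a φm φp ε k η) (𝓝[>] 0)
      (𝓝 (cMinus φp k * dualGlauberMinus φm k η)) := by
  simp only [dualKawasakiMinus, integral_dualKawasakiMinusIntegrand hae, dualGlauberMinus,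
    integral_dualGlauberMinusIntegrand]
  rw [mul_neg, Finset.mul_sum]
  refine Tendsto.neg (tendsto_finsetSum _ fun x _ => ?_)
  have hc : cMinus φp k = ∫ ξ, k (ξ ∪ ∅) * eLambda (fun u => Real.exp (-φp u) - 1) ξ
      ∂(lebesguePoisson d) := by
    simp only [cMinus, cMinusIntegrand, Finset.union_empty, mul_comm (k _)]
  rw [hc, mul_comm, mul_assoc]
  exact tendsto_integral_scaledJump_mul_jumpFunctional (ψ := fun u => -φp u) ha ha1 hm hms hp.neg
    (hps.comp_left (g := fun t => -t) (by simp)) (fun u => by simp only [hpe u]) hs0 hs1 hk hk0 hkb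
    hk1 ht hu η ∅ (η.erase x) x

theorem tendsto_dualKawasakiPlus [NeZero d] (ha : Integrable a)
    (ha1 : ∫ x, a x = 1) (hm : Continuous φm) (hms : HasCompactSupport φm)
    (hme : Function.Even φm) (hp : Continuous φp) (hps : HasCompactSupport φp) (hs0 : 0 ≤ s)
    (hs1 : s < 1) (hk : Measurable k) (hk0 : ∀ η, 0 ≤ k η)
    (hkb : ∀ η, k η ≤ growthBound s C η.card) (hk1 : k ∅ = 1) (ht : IsTranslationInvariant k)
    (hu : HasDecay (ursell k)) (η : FinConf d) :
    Tendsto (fun ε : ℝ => dualKawasakiPlus a φm φp ε k η) (𝓝[>] 0)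
      (𝓝 (cPlus φm k * dualGlauberPlus φp k η)) := by
  simp only [dualKawasakiPlus, integral_dualKawasakiPlusIntegrand, dualGlauberPlus,
    integral_dualGlauberPlusIntegrand]
  rw [Finset.mul_sum]
  refine tendsto_finsetSum _ fun y _ => ?_
  have hc : cPlus φm k = ∫ ξ, k (ξ ∪ {0}) * eLambda (fun u => Real.exp (φm u) - 1) ξ
      ∂(lebesguePoisson d) := by
    simp only [cPlus, cPlusIntegrand, mul_comm (k _), Finset.union_comm _ {(0 : Pos d)},
      ← Finset.insert_eq]
  rw [hc, mul_comm, mul_assoc]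
  exact tendsto_integral_scaledJump_mul_jumpFunctional (φ := fun u => -φp u) ha ha1 hp.neg
    (hps.comp_left (g := fun t => -t) (by simp)) hm hms hme hs0 hs1 hk hk0 hkb
    hk1 ht hu (η.erase y) {0} (η.erase y) y

end

theorem theorem1 (d : ℕ) (hd : 0 < d)
    (a φm φp : Pos d → ℝ)
    (ha_meas : Measurable a) (ha_even : Function.Even a) (ha_bdd : ∃ M : ℝ, ∀ x, a x ≤ M)
    (ha_nonneg : ∀ x, 0 ≤ a x) (ha_int : Integrable a volume) (ha_one : ∫ x, a x = 1)
    (hφm_even : Function.Even φm) (hφm_cont : Continuous φm) (hφm_supp : HasCompactSupport φm)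
    (hφp_even : Function.Even φp) (hφp_cont : Continuous φp) (hφp_supp : HasCompactSupport φp)
    (μ : Measure (Configuration d)) (hμ : IsProbabilityMeasure μ)
    (k : FinConf d → ℝ) (hk : IsCorrelationFunctional μ k)
    (s C : ℝ) (hs0 : 0 ≤ s) (hs1 : s < 1) (hC : 0 < C)
    (h_bound : ∀ η : FinConf d, k η ≤ (η.card.factorial : ℝ) ^ s * C ^ η.card)
    (h_transl : IsTranslationInvariant k)
    (h_decay : HasDecay (ursell k)) :
    -- the integrals that define the functionals and the constants converge absolutely
    ((∀ ε : ℝ, 0 < ε → ∀ η : FinConf d, ∀ x ∈ η,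
        Integrable (fun p : Pos d × FinConf d =>
          dualKawasakiMinusIntegrand a φm φp ε k η x p.1 p.2)
          ((volume : Measure (Pos d)).prod (lebesguePoisson d)) ∧
        Integrable (fun p : Pos d × FinConf d =>
          dualKawasakiPlusIntegrand a φm φp ε k η x p.1 p.2)
          ((volume : Measure (Pos d)).prod (lebesguePoisson d))) ∧
      (∀ η : FinConf d, ∀ x ∈ η,
        Integrable (dualGlauberMinusIntegrand φm k η x) (lebesguePoisson d) ∧
        Integrable (dualGlauberPlusIntegrand φp k η x) (lebesguePoisson d)) ∧
      Integrable (cMinusIntegrand φp k) (lebesguePoisson d) ∧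
      Integrable (cPlusIntegrand φm k) (lebesguePoisson d)) ∧
    -- the functionals are the values at `k` of the dual operators
    ((∀ ε : ℝ, 0 < ε →
        IsDualValue (kawasakiMinus a φm φp ε) k (dualKawasakiMinus a φm φp ε k) ∧
        IsDualValue (kawasakiPlus a φm φp ε) k (dualKawasakiPlus a φm φp ε k)) ∧
      IsDualValue (glauberMinus φm) k (dualGlauberMinus φm k) ∧
      IsDualValue (glauberPlus φp) k (dualGlauberPlus φp k)) ∧
    -- the convergence, for each finite configuration
    ∀ η : FinConf d,
      Tendsto (fun ε : ℝ => dualKawasakiMinus a φm φp ε k η) (𝓝[>] 0)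
        (𝓝 (cMinus φp k * dualGlauberMinus φm k η)) ∧
      Tendsto (fun ε : ℝ => dualKawasakiPlus a φm φp ε k η) (𝓝[>] 0)
        (𝓝 (cPlus φm k * dualGlauberPlus φp k η)) := by
  have : NeZero d := ⟨hd.ne'⟩
  have hk1 := hk.apply_empty
  have hkb : ∀ η : FinConf d, k η ≤ growthBound s C η.card := fun η =>
    le_growthBound hC (h_bound η)
  have hkm := hk.measurable
  have hk0 := hk.nonneg
  refine ⟨⟨fun ε hε η x _ => ⟨?_, ?_⟩, fun η x _ => ⟨?_, ?_⟩, ?_, ?_⟩,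
    ⟨fun ε hε => ⟨?_, ?_⟩, ?_, ?_⟩, fun η => ⟨?_, ?_⟩⟩
  · exact integrable_dualKawasakiMinusIntegrand hs0 hs1 ha_meas ha_int hε hφm_cont hφm_supp
      hφp_cont hφp_supp hkm hk0 hkb η x
  · exact integrable_dualKawasakiPlusIntegrand hs0 hs1 ha_meas ha_int hε hφm_cont hφm_supp
      hφp_cont hφp_supp hkm hk0 hkb η x
  · exact integrable_dualGlauberMinusIntegrand hs0 hs1 hφm_cont hφm_supp hkm hk0 hkb η x
  · exact integrable_dualGlauberPlusIntegrand hs0 hs1 hφp_cont hφp_supp hkm hk0 hkb η x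
  · exact integrable_cMinusIntegrand hs0 hs1 hφp_cont hφp_supp hkm hk0 hkb
  · exact integrable_cPlusIntegrand hs0 hs1 hφm_cont hφm_supp hkm hk0 hkb
  · exact isDualValue_kawasakiMinus hs0 hs1 ha_meas ha_int hε hφm_cont hφm_supp hφp_cont
      hφp_supp hkm hk0 hkb
  · exact isDualValue_kawasakiPlus hs0 hs1 ha_meas ha_even ha_int hε hφm_cont hφm_supp hφp_cont
      hφp_supp hkm hk0 hkb
  · exact isDualValue_glauberMinus hs0 hs1 ha_meas ha_int ha_one hφm_cont hφm_supp hkm hk0 hkb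
  · exact isDualValue_glauberPlus hs0 hs1 hφp_cont hφp_supp hkm hk0 hkb
  · exact tendsto_dualKawasakiMinus ha_int ha_one ha_even hφm_cont hφm_supp hφp_cont hφp_supp
      hφp_even hs0 hs1 hkm hk0 hkb hk1 h_transl h_decay η
  · exact tendsto_dualKawasakiPlus ha_int ha_one hφm_cont hφm_supp hφm_even hφp_cont hφp_supp
      hs0 hs1 hkm hk0 hkb hk1 h_transl h_decay η
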